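/- Let $K$ be an algebraically closed field and let $\mathcal H(n,K)$ be the variety of all pairs $(A,B)$ of $n\times n$ nilpotent matrices over $K$ with $AB=BA$, with its Zariski topology. For a nilpotent $n\times n$ matrix $B$ over $K$ whose Jordan blocks have orders $u_1\ge\dots\ge u_t$, let $s_B$ be the maximal cardinality of a subset $\{i_1<\dots<i_r\}$ of $\{1,\dots,t\}$ such that $u_{i_1}-u_{i_r}\le 1$. Let $\mathcal A$ be an open subset of $\mathcal H(n,K)$, let $(A,B)\in\mathcal A$, let $u_1\ge\dots\ge u_t$ be the orders of the Jordan blocks of $B$, and let $\{i_1<\dots<i_{s_B}\}\subseteq\{1,\dots,t\}$ be such that $u_{i_1}-u_{i_{s_B}}\le 1$. Then there exist $(A',B')\in\mathcal A$ and $f\in K[x]$ with $x\mid f$ such that, if $u'_1\ge\dots\ge u'_{t'}$ are the orders of the Jordan blocks of $B'+f(A')$, then exactly $s_{B'+f(A')}$ of the $u'_j$ are equal to $1$, $t'\ge t$, and $u'_i=u_i$ for $i=1,\dots,i_1-1$. -/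

import Mathlib

open Polynomial

namespace CommNilp

/-- The set of all pairs `(A, B)` of nilpotent `n × n` matrices over `K` with `A B = B A`. -/
def commNilpPairs (n : ℕ) (K : Type*) [Field K] :
    Set (Matrix (Fin n) (Fin n) K × Matrix (Fin n) (Fin n) K) :=
  {p | IsNilpotent p.1 ∧ IsNilpotent p.2 ∧ Commute p.1 p.2}

/-- The `2 n ^ 2` coordinates (matrix entries) of a pair of `n × n` matrices. -/
def coords {n : ℕ} {K : Type*}
    (p : Matrix (Fin n) (Fin n) K × Matrix (Fin n) (Fin n) K) :
    (Fin n × Fin n) ⊕ (Fin n × Fin n) → K :=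
  Sum.elim (fun e => p.1 e.1 e.2) (fun e => p.2 e.1 e.2)

/-- Zariski-open subsets of the variety of commuting pairs of nilpotent matrices: complements, in
that variety, of the common zero set of an ideal of polynomials in the matrix entries. -/
def IsZariskiOpen {n : ℕ} {K : Type*} [Field K]
    (𝒜 : Set (Matrix (Fin n) (Fin n) K × Matrix (Fin n) (Fin n) K)) : Prop :=
  ∃ I : Ideal (MvPolynomial ((Fin n × Fin n) ⊕ (Fin n × Fin n)) K),
    𝒜 = {p ∈ commNilpPairs n K | coords p ∉ MvPolynomial.zeroLocus K I}

/-- The nilpotent Jordan block of order `m`. -/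
def jordanBlock (m : ℕ) (K : Type*) [Field K] : Matrix (Fin m) (Fin m) K :=
  Matrix.of fun i j => if (i : ℕ) + 1 = (j : ℕ) then 1 else 0

/-- `u 0 ≥ u 1 ≥ … ≥ u (t - 1)` are the orders of the Jordan blocks of the nilpotent matrix `B`:
in some basis of `K ^ n`, the endomorphism `B` is represented by the block diagonal matrix whose
diagonal blocks are the nilpotent Jordan blocks of orders `u 0, …, u (t - 1)`. -/
def IsJordanOrders {n : ℕ} {K : Type*} [Field K] (B : Matrix (Fin n) (Fin n) K)
    {t : ℕ} (u : Fin t → ℕ) : Prop :=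
  Antitone u ∧ (∀ h, 0 < u h) ∧
    ∃ b : Module.Basis (Σ h : Fin t, Fin (u h)) K (Fin n → K),
      LinearMap.toMatrix b b (Matrix.toLin' B) =
        Matrix.blockDiagonal' fun h => jordanBlock (u h) K

/-- The entries of `u` with indices in `S` differ by at most `1`. For a nonincreasing `u` and
`S = {i_1 < … < i_r}` this says `u i_1 - u i_r ≤ 1`. -/
def AlmostEqual {t : ℕ} (u : Fin t → ℕ) (S : Finset (Fin t)) : Prop :=
  ∀ i ∈ S, ∀ j ∈ S, u i ≤ u j + 1

open Classical in
/-- The maximal cardinality of a set of indices on which the entries of `u` differ by at most `1`.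
If `u` is the sequence of the orders of the Jordan blocks of `B`, this is `s_B`. -/
noncomputable def maxAlmostEqual {t : ℕ} (u : Fin t → ℕ) : ℕ :=
  (Finset.univ.filter fun S : Finset (Fin t) => AlmostEqual u S).sup Finset.card

end CommNilp

/-! Write s for s_B and decompose K^n as the sum of the K[y]/(y^{u_i}) with generators e_i, B acting
as y. A nilpotent A commuting with B is K[y]-linear and, after a change of basis commuting with B,
triangular (`IsJordanOrders.exists_conj`). Because no s + 1 block orders differ by at most 1, one
can give e_i a weight w_i, and y^l e_i the weight w_i + s l, so that every such A raises weights by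
at least 1 while B raises them by exactly s (`exists_isWeight`). Then C = B - A^s z(A) raises
weights by at least s for every polynomial z. As the weights of the chains are centred, the powers
of C have ranks at most those of the powers of B (`IsWeight.rank_pow_le`).

Let e_f, …, e_g be the s chains whose orders are u_{i_1} or u_{i_1} - 1, and let A₁ send e_f ↦ … ↦
e_g ↦ y e_f and kill the other e_i. On these chains A₁^s = B, so B - A₁^s vanishes there and equals
B elsewhere. This behaviour is carried to a generic point A_τ of the line joining A₁ (τ = 0) to A (τ
= 1). A vector over K[x]/(x^h) which is an eigenvector of A_τ for x and of B for g(x) = x^s z(x) has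
its coefficients in the kernel of B - g(A_τ). After the substitution y = z x^s such vectors come
from the equation det(1 - `symbol`) = 0. At x = 0 this is a plane curve in (τ, z) through (0, 1),
where z = 1 is a simple root. The needed nonvanishing conditions hold at (0, 1), hence at points of
the curve with τ outside any finite set (`exists_evalEval_eq_zero_ne_zero`), and
`exists_approximate_root` lifts z from x = 0 to a power of x. The left and right kernel vectors so
obtained pair nondegenerately (`exists_pairing`), which forces s Jordan blocks of order 1
(`IsJordanOrders.le_card_ones`). A nonvanishing minor keeps the ranks of the k-th powers for k ≥
u_{i_1} (`tailSum_le_rank`), hence the blocks longer than u_{i_1}.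

A generic τ also keeps (A_τ, B - f(A_τ)) in the open set, and `Reach` absorbs the change of
polynomial from f to g. Each application of `Reach.exists_step` strictly increases the number of
blocks of order 1, unless that number is already maximal; iterating gives `Reach.exists_final`. -/

namespace CommNilp

/-! ### Jordan chains and Jordan orders -/

/-- `b` is a basis of Jordan chains of `f`: `f` shifts every chain by one step. -/
def IsChainBasis {K V : Type*} [Field K] [AddCommGroup V] [Module K V] (f : V →ₗ[K] V)
    {ι : Type*} {u : ι → ℕ} (b : Module.Basis (Σ h : ι, Fin (u h)) K V) : Prop :=
  ∀ (h : ι) (l : Fin (u h)),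
    f (b ⟨h, l⟩) = if hl : (l : ℕ) + 1 < u h then b ⟨h, ⟨l + 1, hl⟩⟩ else 0

/-- The chain of one cyclic summand is the power basis of `AdjoinRoot (X ^ k)`, carried over by `ψ`,
which is the identity on underlying elements. -/
theorem quotient_X_pow_chainBasis (K : Type*) [Field K] (k : ℕ) :
    ∃ b : Module.Basis (Fin k) K (K[X] ⧸ K[X] ∙ (X : K[X]) ^ k),
      ∀ l : Fin k, (X : K[X]) • b l = if hl : (l : ℕ) + 1 < k then b ⟨l + 1, hl⟩ else 0 := by
  have hm : ((X : K[X]) ^ k).Monic := monic_X_pow k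
  have hd : ((X : K[X]) ^ k).natDegree = k := natDegree_X_pow k
  let ψ : AdjoinRoot ((X : K[X]) ^ k) ≃ₗ[K] (K[X] ⧸ K[X] ∙ (X : K[X]) ^ k) :=
    { toFun := fun v => v
      invFun := fun v => v
      map_add' := fun _ _ => rfl
      map_smul' := fun a v => by
        obtain ⟨p, rfl⟩ := AdjoinRoot.mk_surjective v
        rw [AdjoinRoot.smul_mk]
        rfl
      left_inv := fun _ => rfl
      right_inv := fun _ => rfl }
  have hψ : ∀ p : K[X], ψ (AdjoinRoot.mk _ p) = Submodule.Quotient.mk p := fun p => rfl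
  let b0 : Module.Basis (Fin k) K (AdjoinRoot ((X : K[X]) ^ k)) :=
    (AdjoinRoot.powerBasisAux' hm).reindex (finCongr hd)
  have hb0 : ∀ l : Fin k, b0 l = AdjoinRoot.mk ((X : K[X]) ^ k) (X ^ (l : ℕ)) := by
    intro l
    have := (AdjoinRoot.powerBasis' hm).basis_eq_pow ((finCongr hd).symm l)
    rw [map_pow, AdjoinRoot.mk_X, Module.Basis.reindex_apply]
    rw [AdjoinRoot.powerBasis'_gen] at this
    exact this
  refine ⟨b0.map ψ, fun l => ?_⟩
  simp only [Module.Basis.map_apply, hb0, hψ]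
  rw [← Submodule.Quotient.mk_smul, smul_eq_mul, ← pow_succ']
  split_ifs with hl
  · rfl
  · have : (l : ℕ) + 1 = k := by omega
    rw [this, Submodule.Quotient.mk_eq_zero]
    exact Submodule.mem_span_singleton_self _

/-- The structure theorem over K[X], applied to V with X acting as f: nilpotency makes it X-power
torsion. The lengths come unsorted and may be zero, which `exists_chainBasis` repairs. -/
theorem exists_unordered_chainBasis {K V : Type*} [Field K] [AddCommGroup V] [Module K V]
    [FiniteDimensional K V] (f : V →ₗ[K] V) (hf : IsNilpotent f) :
    ∃ (d : ℕ) (k : Fin d → ℕ) (b : Module.Basis (Σ h : Fin d, Fin (k h)) K V),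
      IsChainBasis f b := by
  have ht : Module.IsTorsion' (Module.AEval K V f) (Submonoid.powers (X : K[X])) := by
    intro x
    obtain ⟨m, hm⟩ := hf
    refine ⟨⟨X ^ m, m, rfl⟩, ?_⟩
    obtain ⟨v, rfl⟩ := (Module.AEval.of K V f).surjective x
    change (X ^ m : K[X]) • (Module.AEval.of K V f) v = 0
    rw [Module.AEval.X_pow_smul_of, hm]
    simp
  obtain ⟨d, k, ⟨e⟩⟩ := Module.torsion_by_prime_power_decomposition (R := K[X])
    Polynomial.irreducible_X ht
  choose c hc using fun i => quotient_X_pow_chainBasis K (k i)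
  let e' : Module.AEval K V f ≃ₗ[K] DirectSum (Fin d) fun i => K[X] ⧸ K[X] ∙ (X : K[X]) ^ k i :=
    e.restrictScalars K
  let b : Module.Basis (Σ h : Fin d, Fin (k h)) K V :=
    (DFinsupp.basis c).map (e'.symm.trans (Module.AEval.of K V f).symm)
  have hb : ∀ h l, b ⟨h, l⟩ = (Module.AEval.of K V f).symm
      (e.symm (DirectSum.lof K[X] (Fin d) (fun i => K[X] ⧸ K[X] ∙ (X : K[X]) ^ k i) h (c h l))) := by
    intro h l
    have : (DFinsupp.basis c) ⟨h, l⟩ = DFinsupp.single h (c h l) := by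
      apply (DFinsupp.basis c).repr.injective
      rw [Module.Basis.repr_self]
      ext ⟨i, j⟩
      rw [DFinsupp.basis]
      simp only [LinearEquiv.trans_apply]
      by_cases hi : i = h
      · subst hi
        simp [Finsupp.single_apply]
      · simp [hi, DFinsupp.single_eq_of_ne hi]
    change (Module.AEval.of K V f).symm (e.symm ((DFinsupp.basis c) ⟨h, l⟩)) = _
    rw [this]
    rfl
  refine ⟨d, k, b, fun h l => ?_⟩
  have key : ∀ x : Module.AEval K V f, f ((Module.AEval.of K V f).symm x) =
      (Module.AEval.of K V f).symm ((X : K[X]) • x) := by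
    intro x
    obtain ⟨v, rfl⟩ := (Module.AEval.of K V f).surjective x
    rw [Module.AEval.X_smul_of]
    simp
  rw [hb, key, ← map_smul, ← map_smul, hc]
  split_ifs with hl
  · rw [hb]
  · simp

theorem exists_chainBasis {K V : Type*} [Field K] [AddCommGroup V] [Module K V]
    [FiniteDimensional K V] (f : V →ₗ[K] V) (hf : IsNilpotent f) :
    ∃ (t : ℕ) (u : Fin t → ℕ), Antitone u ∧ (∀ h, 0 < u h) ∧
      ∃ b : Module.Basis (Σ h : Fin t, Fin (u h)) K V, IsChainBasis f b := by
  obtain ⟨d, k, b, hb⟩ := exists_unordered_chainBasis f hf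
  let e := (Fintype.equivFin {i // 0 < k i}).symm
  let srt := Tuple.sort fun j => OrderDual.toDual (k (e j))
  let σ : Fin (Fintype.card {i // 0 < k i}) → Fin d := fun j => (e (srt j)).1
  have hσ : Function.Injective σ := fun i j h =>
    srt.injective (e.injective (Subtype.ext h))
  let φ : (Σ h, Fin (k (σ h))) → Σ h, Fin (k h) := fun x => ⟨σ x.1, x.2⟩
  have hφ : Function.Bijective φ := by
    constructor
    · rintro ⟨i, l⟩ ⟨j, m⟩ h
      simp only [φ, Sigma.mk.injEq] at h
      obtain rfl := hσ h.1
      simpa using h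
    · rintro ⟨i, l⟩
      have hi : 0 < k i := lt_of_le_of_lt (Nat.zero_le _) l.2
      obtain ⟨j, hj⟩ := (srt.trans e).surjective ⟨i, hi⟩
      have : σ j = i := congrArg Subtype.val hj
      subst this
      exact ⟨⟨j, l⟩, rfl⟩
  refine ⟨_, fun j => k (σ j), ?_, fun h => (e (srt h)).2,
    b.reindex (Equiv.ofBijective φ hφ).symm, fun h l => ?_⟩
  · intro i j hij
    exact Tuple.monotone_sort (fun j => OrderDual.toDual (k (e j))) hij
  · simp only [Module.Basis.reindex_apply, Equiv.symm_symm, Equiv.ofBijective_apply, φ]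
    exact hb _ _

/-- A superdiagonal Jordan block sends each basis vector to the preceding one, whereas a chain basis
moves to the following one. Reversing every chain passes between the two conventions. -/
theorem isJordanOrders_iff {n : ℕ} {K : Type*} [Field K] (B : Matrix (Fin n) (Fin n) K)
    {t : ℕ} (u : Fin t → ℕ) : IsJordanOrders B u ↔ Antitone u ∧ (∀ h, 0 < u h) ∧
      ∃ b : Module.Basis (Σ h : Fin t, Fin (u h)) K (Fin n → K),
        IsChainBasis (Matrix.toLin' B) b := by
  let rv : (Σ h : Fin t, Fin (u h)) ≃ (Σ h : Fin t, Fin (u h)) :=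
    Equiv.sigmaCongrRight fun h => Fin.revPerm
  have hrv : ∀ h l, rv.symm ⟨h, l⟩ = ⟨h, l.rev⟩ := fun h l => by
    rw [Equiv.symm_apply_eq]; simp [rv]
  have key : ∀ b : Module.Basis (Σ h : Fin t, Fin (u h)) K (Fin n → K),
      LinearMap.toMatrix b b (Matrix.toLin' B) =
        (Matrix.blockDiagonal' fun h => jordanBlock (u h) K) ↔
      IsChainBasis (Matrix.toLin' B) (b.reindex rv) := by
    intro b
    have hcol : ∀ h (l : Fin (u h)),
        Matrix.toLin b b (Matrix.blockDiagonal' fun h => jordanBlock (u h) K) (b ⟨h, l.rev⟩) =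
        if hl : (l : ℕ) + 1 < u h then b.reindex rv ⟨h, ⟨l + 1, hl⟩⟩ else 0 := by
      intro h l
      rw [Matrix.toLin_self, Fintype.sum_sigma, Finset.sum_eq_single h]
      · simp only [Matrix.blockDiagonal'_apply_eq, jordanBlock, Matrix.of_apply, ite_smul,
          one_smul, zero_smul]
        split_ifs with hl
        · rw [Finset.sum_eq_single (Fin.rev ⟨l + 1, hl⟩)]
          · rw [if_pos (by simp only [Fin.val_rev]; omega), Module.Basis.reindex_apply, hrv]
          · intro m _ hm
            rw [if_neg]
            intro h'
            apply hm
            ext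
            simp only [Fin.val_rev] at h' ⊢
            omega
          · simp
        · refine Finset.sum_eq_zero fun m _ => if_neg ?_
          simp only [Fin.val_rev]
          have := l.2
          omega
      · intro j _ hj
        refine Finset.sum_eq_zero fun m _ => ?_
        rw [Matrix.blockDiagonal'_apply_ne _ _ _ hj, zero_smul]
      · simp
    rw [← LinearEquiv.eq_symm_apply, LinearMap.toMatrix_symm]
    constructor
    · intro h i l
      rw [← hcol, ← h, Module.Basis.reindex_apply, hrv]
    · intro h
      refine b.ext fun ⟨i, l⟩ => ?_
      have h1 := h i l.rev
      rw [← hcol, Module.Basis.reindex_apply, hrv, Fin.rev_rev] at h1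
      exact h1
  unfold IsJordanOrders
  refine and_congr_right fun _ => and_congr_right fun _ => ⟨?_, ?_⟩
  · rintro ⟨b, hb⟩
    exact ⟨_, (key b).1 hb⟩
  · rintro ⟨b, hb⟩
    refine ⟨b.reindex rv.symm, (key _).2 ?_⟩
    convert hb
    ext
    simp [Module.Basis.reindex_apply]

/-! ### Ranks of powers and blocks of order one -/

theorem IsChainBasis.pow_apply {K V : Type*} [Field K] [AddCommGroup V] [Module K V]
    {f : V →ₗ[K] V} {ι : Type*} {u : ι → ℕ}
    {b : Module.Basis (Σ h : ι, Fin (u h)) K V} (hb : IsChainBasis f b) (k : ℕ) (h : ι)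
    (l : Fin (u h)) :
    (f ^ k) (b ⟨h, l⟩) = if hl : (l : ℕ) + k < u h then b ⟨h, ⟨l + k, hl⟩⟩ else 0 := by
  induction k with
  | zero => simp
  | succ k ih =>
    rw [pow_succ', Module.End.mul_apply, ih]
    by_cases h1 : (l : ℕ) + k < u h
    · rw [dif_pos h1, hb]
      rfl
    · rw [dif_neg h1, dif_neg (by omega), map_zero]

/-- The image of `f ^ k` is spanned by the basis vectors at positions at least `k` in their chains.
-/
theorem IsChainBasis.finrank_range_pow {K V : Type*} [Field K] [AddCommGroup V] [Module K V]
    {f : V →ₗ[K] V} {ι : Type*} [Fintype ι] {u : ι → ℕ}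
    {b : Module.Basis (Σ h : ι, Fin (u h)) K V} (hb : IsChainBasis f b) (k : ℕ) :
    Module.finrank K (LinearMap.range (f ^ k)) = ∑ h, (u h - k) := by
  let g : (Σ h : ι, Fin (u h - k)) → Σ h : ι, Fin (u h) :=
    fun x => ⟨x.1, ⟨x.2 + k, by have := x.2.2; omega⟩⟩
  have hg : Function.Injective g := by
    rintro ⟨i, l⟩ ⟨j, m⟩ h
    simp only [g, Sigma.mk.injEq] at h
    obtain ⟨rfl, h⟩ := h
    simp only [heq_eq_eq, Fin.mk.injEq, add_left_inj] at h
    rw [Fin.ext h]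
  have hr : LinearMap.range (f ^ k) = Submodule.span K (Set.range (b ∘ g)) := by
    rw [LinearMap.range_eq_map, ← b.span_eq, Submodule.map_span]
    apply le_antisymm
    · rw [Submodule.span_le]
      rintro _ ⟨_, ⟨⟨h, l⟩, rfl⟩, rfl⟩
      rw [hb.pow_apply]
      split_ifs with hl
      · exact Submodule.subset_span ⟨⟨h, ⟨l, by omega⟩⟩, rfl⟩
      · exact Submodule.zero_mem _
    · rw [Submodule.span_le]
      rintro _ ⟨⟨h, l⟩, rfl⟩
      refine Submodule.subset_span ⟨b ⟨h, ⟨l, by omega⟩⟩, ⟨_, rfl⟩, ?_⟩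
      rw [hb.pow_apply, dif_pos (by have := l.2; simp only; omega)]
      rfl
  rw [hr, finrank_span_eq_card (b.linearIndependent.comp g hg)]
  simp

/-- The numbers `∑ (u h - k)`, i.e. the ranks of the powers of a nilpotent matrix with Jordan
blocks of orders `u`. -/
def tailSum {ι : Type*} [Fintype ι] (u : ι → ℕ) (k : ℕ) : ℕ := ∑ h, (u h - k)

theorem IsJordanOrders.rank_pow {n : ℕ} {K : Type*} [Field K] {B : Matrix (Fin n) (Fin n) K}
    {t : ℕ} {u : Fin t → ℕ} (h : IsJordanOrders B u) (k : ℕ) : (B ^ k).rank = tailSum u k := by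
  obtain ⟨-, -, b, hb⟩ := (isJordanOrders_iff B u).1 h
  rw [tailSum, ← hb.finrank_range_pow k, ← Matrix.toLin'_pow, Matrix.rank]
  rfl

theorem exists_isJordanOrders {n : ℕ} {K : Type*} [Field K] {B : Matrix (Fin n) (Fin n) K}
    (hB : IsNilpotent B) : ∃ (t : ℕ) (u : Fin t → ℕ), IsJordanOrders B u := by
  have : IsNilpotent (Matrix.toLin' B) := by
    obtain ⟨k, hk⟩ := hB
    exact ⟨k, by rw [← Matrix.toLin'_pow, hk, map_zero]⟩
  obtain ⟨t, u, h1, h2, h3⟩ := exists_chainBasis _ this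
  exact ⟨t, u, (isJordanOrders_iff B u).2 ⟨h1, h2, h3⟩⟩

/-- A nondegenerate pairing between `s` vectors of the kernel of `C` and `s` functionals vanishing
on its image forces `s` Jordan blocks of order one. -/
theorem IsJordanOrders.le_card_ones {n : ℕ} {K : Type*} [Field K] {C : Matrix (Fin n) (Fin n) K}
    {t : ℕ} {u : Fin t → ℕ} (h : IsJordanOrders C u) {s : ℕ} (D₁ : Matrix (Fin n) (Fin s) K)
    (D₂ : Matrix (Fin s) (Fin n) K) (h₁ : C * D₁ = 0) (h₂ : D₂ * C = 0)
    (hdet : (D₂ * D₁).det ≠ 0) :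
    s ≤ (Finset.univ.filter fun j => u j = 1).card := by
  obtain ⟨-, hpos, b, hb⟩ := (isJordanOrders_iff C u).1 h
  -- expand the columns of `D₁` in the Jordan basis
  let m : Fin s → (Σ h : Fin t, Fin (u h)) → K := fun j => b.repr (fun i => D₁ i j)
  have hcol : ∀ j, (fun i => D₁ i j) = ∑ x, m j x • b x := fun j => (b.sum_repr _).symm
  -- Kernel vectors involve only the last vectors of the chains.
  have hm : ∀ j h (l : Fin (u h)), (l : ℕ) + 1 < u h → m j ⟨h, l⟩ = 0 := by
    intro j i l hl
    have h0 : Matrix.toLin' C (fun i => D₁ i j) = 0 := by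
      ext i
      have := congrFun (congrFun h₁ i) j
      simpa [Matrix.mul_apply, Matrix.mulVec, dotProduct] using this
    rw [hcol, map_sum] at h0
    have h1 := congrArg (fun v => b.repr v ⟨i, ⟨l + 1, hl⟩⟩) h0
    simp only [map_sum, map_smul, Finsupp.coe_finsetSum, Finset.sum_apply, Finsupp.smul_apply,
      smul_eq_mul, map_zero, Finsupp.coe_zero, Pi.zero_apply] at h1
    rw [Finset.sum_eq_single ⟨i, l⟩] at h1
    · rw [hb, dif_pos hl] at h1
      simpa using h1
    · rintro ⟨i', l'⟩ _ hne
      rw [hb]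
      split_ifs with hl'
      · rw [Module.Basis.repr_self, Finsupp.single_apply, if_neg, mul_zero]
        intro heq
        apply hne
        simp only [Sigma.mk.injEq] at heq
        obtain ⟨rfl, heq⟩ := heq
        simp only [heq_eq_eq, Fin.mk.injEq, add_left_inj] at heq
        rw [Fin.ext heq]
      · simp
    · simp
  -- Functionals vanishing on the image see only the first vectors of the chains.
  have hn : ∀ k h (l : Fin (u h)), 0 < (l : ℕ) → D₂.mulVec (b ⟨h, l⟩) k = 0 := by
    intro k i l hl
    have h3 : b ⟨i, l⟩ = C.mulVec (b ⟨i, ⟨l - 1, by omega⟩⟩) := by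
      have := hb i ⟨l - 1, by omega⟩
      rw [dif_pos (by have := l.2; simp only; omega), Matrix.toLin'_apply] at this
      rw [this]
      congr 2
      ext
      simp only
      omega
    rw [h3, Matrix.mulVec_mulVec, h₂, Matrix.zero_mulVec, Pi.zero_apply]
  -- A vector that is both first and last spans a chain of length one, so `D₂ * D₁`, of rank `s`,
  -- factors through the space indexed by such chains.
  let P : Matrix (Fin s) {j // u j = 1} K :=
    Matrix.of fun k j => D₂.mulVec (b ⟨j.1, ⟨0, hpos _⟩⟩) k
  let Q : Matrix {j // u j = 1} (Fin s) K := Matrix.of fun j k => m k ⟨j.1, ⟨0, hpos _⟩⟩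
  have hPQ : D₂ * D₁ = P * Q := by
    ext k j
    have e1 : (D₂ * D₁) k j = D₂.mulVec (fun i => D₁ i j) k := by
      simp [Matrix.mul_apply, Matrix.mulVec, dotProduct]
    rw [e1, hcol, Matrix.mulVec_sum, Finset.sum_apply, Fintype.sum_sigma, Matrix.mul_apply]
    have e2 : ∀ i : Fin t, ∑ l : Fin (u i), D₂.mulVec (m j ⟨i, l⟩ • b ⟨i, l⟩) k =
        if hi : u i = 1 then D₂.mulVec (b ⟨i, ⟨0, hpos _⟩⟩) k * m j ⟨i, ⟨0, hpos _⟩⟩ else 0 := by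
      intro i
      rw [Finset.sum_eq_single ⟨0, hpos i⟩]
      · rw [Matrix.mulVec_smul, Pi.smul_apply, smul_eq_mul, mul_comm]
        split_ifs with hi
        · rfl
        · rw [hm j i ⟨0, hpos i⟩ (by have := hpos i; simp only; omega), mul_zero]
      · intro l _ hl
        rw [Matrix.mulVec_smul, Pi.smul_apply, hn k i l, smul_zero]
        rcases Nat.eq_zero_or_pos (l : ℕ) with h0 | h0
        · exact absurd (Fin.ext h0) hl
        · exact h0
      · simp
    simp only [e2]
    rw [Finset.sum_dite, Finset.sum_const_zero, add_zero]
    refine Finset.sum_bij (fun x _ => ⟨x.1, (Finset.mem_filter.1 x.2).2⟩) (by simp) ?_ ?_ ?_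
    · rintro ⟨a, _⟩ _ ⟨c, _⟩ _ h; simpa using h
    · rintro ⟨a, ha⟩ _
      exact ⟨⟨a, by simpa using ha⟩, by simp, rfl⟩
    · rintro ⟨a, ha⟩ _
      rfl
  have hrank : (D₂ * D₁).rank = s := by
    rw [Matrix.rank_of_det_ne_zero hdet, Fintype.card_fin]
  calc s = (P * Q).rank := by rw [← hPQ, hrank]
    _ ≤ P.rank := Matrix.rank_mul_le_left P Q
    _ ≤ Fintype.card {j // u j = 1} := Matrix.rank_le_card_width P
    _ = _ := Fintype.card_subtype _

/-! ### Counting blocks by order -/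

/-- The number of entries of `u` which are at least `k`. -/
def countGE {t : ℕ} (u : Fin t → ℕ) (k : ℕ) : ℕ := (Finset.univ.filter fun i => k ≤ u i).card

/-- The number of entries of `u` which are equal to `p` or `p - 1`. -/
def window {t : ℕ} (u : Fin t → ℕ) (p : ℕ) : ℕ :=
  (Finset.univ.filter fun i => u i = p ∨ u i + 1 = p).card

/-- Differences of consecutive ranks of powers give the conjugate partition. Information about ranks
becomes information about block orders through this identity. -/
theorem tailSum_eq {t : ℕ} (u : Fin t → ℕ) (k : ℕ) :
    tailSum u k = tailSum u (k + 1) + countGE u (k + 1) := by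
  rw [tailSum, tailSum, countGE, Finset.card_filter, ← Finset.sum_add_distrib]
  refine Finset.sum_congr rfl fun i _ => ?_
  split_ifs <;> omega

/-- For nonincreasing `u` the indices counted by `countGE u k` form an initial segment, so the
counts determine `u`. -/
theorem le_iff_lt_countGE {t : ℕ} {u : Fin t → ℕ} (hu : Antitone u) (i : Fin t) (k : ℕ) :
    k ≤ u i ↔ (i : ℕ) < countGE u k := by
  constructor
  · intro h
    have : Finset.Iic i ⊆ Finset.univ.filter fun i => k ≤ u i := by
      intro j hj
      simp only [Finset.mem_Iic] at hj
      simpa using h.trans (hu hj)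
    have := Finset.card_le_card this
    rw [Fin.card_Iic] at this
    exact this
  · intro h
    by_contra h'
    have : (Finset.univ.filter fun i => k ≤ u i) ⊆ Finset.Iio i := by
      intro j hj
      simp only [Finset.mem_filter, Finset.mem_univ, true_and, Finset.mem_Iio] at hj ⊢
      by_contra hij
      exact h' (hj.trans (hu (not_lt.1 hij)))
    have := Finset.card_le_card this
    rw [Fin.card_Iio] at this
    exact absurd h (not_lt.2 this)

theorem countGE_add_window {t : ℕ} (u : Fin t → ℕ) (k : ℕ) :
    countGE u k = countGE u (k + 2) + window u (k + 1) := by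
  rw [countGE, countGE, window, ← Finset.card_union_of_disjoint]
  · congr 1
    ext i
    simp only [Finset.mem_filter, Finset.mem_univ, true_and, Finset.mem_union]
    omega
  · rw [Finset.disjoint_left]
    intro i hi
    simp only [Finset.mem_filter, Finset.mem_univ, true_and] at hi ⊢
    omega

theorem countGE_le {t : ℕ} (u : Fin t → ℕ) (k : ℕ) : countGE u k ≤ t := by
  simpa [countGE] using Finset.card_filter_le (Finset.univ : Finset (Fin t)) fun i => k ≤ u i

theorem countGE_zero {t : ℕ} (u : Fin t → ℕ) : countGE u 0 = t := by simp [countGE]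

theorem countGE_one {t : ℕ} {u : Fin t → ℕ} (hpos : ∀ h, 0 < u h) : countGE u 1 = t := by
  simp only [countGE]
  rw [Finset.filter_true_of_mem fun i _ => Nat.succ_le_of_lt (hpos i), Finset.card_univ,
    Fintype.card_fin]

theorem card_le_maxAlmostEqual {t : ℕ} {u : Fin t → ℕ} {S : Finset (Fin t)}
    (hS : AlmostEqual u S) : S.card ≤ maxAlmostEqual u := by
  classical
  unfold maxAlmostEqual
  exact Finset.le_sup (f := Finset.card) (by simpa using hS)

theorem window_le {t : ℕ} (u : Fin t → ℕ) (p : ℕ) : window u p ≤ maxAlmostEqual u := by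
  apply card_le_maxAlmostEqual
  intro i hi j hj
  simp only [Finset.mem_filter, Finset.mem_univ, true_and] at hi hj
  omega

/-- The least index carries the largest value of `u` on `S`, so all of `S` lies in the window below
that value. -/
theorem window_eq_of_isLeast {t : ℕ} {u : Fin t → ℕ} (hu : Antitone u) {S : Finset (Fin t)}
    (hS : AlmostEqual u S) (hcard : S.card = maxAlmostEqual u) {i : Fin t}
    (hi : IsLeast (S : Set (Fin t)) i) : window u (u i) = maxAlmostEqual u := by
  apply le_antisymm (window_le u _)
  rw [← hcard]
  apply Finset.card_le_card
  intro j hj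
  have h1 := hS i hi.1 j hj
  have h2 := hu (hi.2 hj)
  simp only [Finset.mem_filter, Finset.mem_univ, true_and]
  omega

theorem exists_window_eq {t : ℕ} {u : Fin t → ℕ} (hu : Antitone u) (h0 : 0 < maxAlmostEqual u) :
    ∃ i, window u (u i) = maxAlmostEqual u := by
  classical
  obtain ⟨S, hS, hcard⟩ := Finset.exists_mem_eq_sup
    (Finset.univ.filter fun S : Finset (Fin t) => AlmostEqual u S)
    ⟨∅, Finset.mem_filter.2 ⟨Finset.mem_univ _, fun i hi => absurd hi (Finset.notMem_empty i)⟩⟩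
    Finset.card
  have hc : S.card = maxAlmostEqual u := by
    unfold maxAlmostEqual
    convert hcard.symm
  have hne : S.Nonempty := Finset.card_pos.1 (hc ▸ h0)
  exact ⟨_, window_eq_of_isLeast hu (by simpa using hS) hc (Finset.isLeast_min' S hne)⟩

theorem card_ones_eq_window {t : ℕ} {u : Fin t → ℕ} (hpos : ∀ h, 0 < u h) :
    (Finset.univ.filter fun j => u j = 1).card = window u 1 := by
  rw [window]
  congr 1
  ext i
  have := hpos i
  simp only [Finset.mem_filter, Finset.mem_univ, true_and]
  omega

/-- `A` is the first component of an element of `𝒜` whose second component differs from `C` by a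
polynomial without constant term in `A`. -/
def Reach {n : ℕ} {K : Type*} [Field K]
    (𝒜 : Set (Matrix (Fin n) (Fin n) K × Matrix (Fin n) (Fin n) K))
    (A C : Matrix (Fin n) (Fin n) K) : Prop :=
  ∃ f : K[X], X ∣ f ∧ (A, C - aeval A f) ∈ 𝒜

/-! ### Weights -/

/-- Integer weights of the first vectors of the Jordan chains for which every nilpotent matrix
commuting with the Jordan form (in triangular position) raises weights by at least one, while the
Jordan form itself raises them by `s`. The weights of the vectors of each chain are centred. -/
structure IsWeight {t : ℕ} (u : Fin t → ℕ) (s : ℕ) (w : Fin t → ℕ) : Prop where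
  raise : ∀ i j l, u j ≤ u i + l → (l = 0 → i < j) → w i + 1 ≤ w j + s * l
  centre : ∀ k : ℕ, ∃ c : ℤ, ∀ i,
    (k ≤ u i → (w i : ℤ) < c + s ∧ c + s * k ≤ w i + s * u i) ∧
    (u i ≤ k → c ≤ w i ∧ (w i : ℤ) + s * u i < c + s * k + s)
  consecutive : ∀ p, window u (p + 1) = s → ∀ i j, (u i = p + 1 ∨ u i = p) →
    (u j = p + 1 ∨ u j = p) → w i + j = w j + i

/-- Let N(k) be the number of chains of length at least k. The chains of length v have indices from
N(v + 1) to N(v) - 1, so 2i + 1 - N(v) - N(v + 1) is symmetric about 0 on them, and subtracting s v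
centres each chain. The resulting `z` is twice the weight, up to translation and rounding. The bound
on windows is used in the form N(k) ≤ N(k + 2) + s. -/
theorem exists_isWeight {t : ℕ} {u : Fin t → ℕ} (hu : Antitone u) {s : ℕ}
    (hs : ∀ p, window u p ≤ s) : ∃ w, IsWeight u s w := by
  let N : ℕ → ℕ := countGE u
  have hN : ∀ k, N k ≤ N (k + 2) + s := fun k => by
    have := countGE_add_window u k
    have := hs (k + 1)
    simp only [N]
    omega
  have hN1 : ∀ k, N (k + 1) ≤ N k := fun k =>
    Finset.card_le_card fun i hi => by
      simp only [Finset.mem_filter, Finset.mem_univ, true_and] at hi ⊢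
      omega
  have hN2 : ∀ k, N (k + 2) ≤ N (k + 1) := fun k => hN1 (k + 1)
  have hi1 : ∀ i : Fin t, (i : ℕ) < N (u i) := fun i => (le_iff_lt_countGE hu i _).1 le_rfl
  have hi2 : ∀ i : Fin t, N (u i + 1) ≤ i := fun i => by
    by_contra h
    have := (le_iff_lt_countGE hu i (u i + 1)).2 (by simpa [N] using h)
    omega
  have hNt : ∀ k, N k ≤ t := countGE_le u
  obtain ⟨U, hU⟩ : ∃ U, ∀ i, u i ≤ U := ⟨∑ i, u i, fun i =>
    Finset.single_le_sum (f := u) (fun _ _ => Nat.zero_le _) (Finset.mem_univ i)⟩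
  -- A translation large enough to make all weights natural numbers.
  let T : ℤ := t + s * U + s
  let z : Fin t → ℤ := fun i => 2 * i + 1 - N (u i) - N (u i + 1) - s * u i
  have hz : ∀ i, 0 ≤ z i + 2 * T := fun i => by
    have h1 := hNt (u i)
    have h2 := hNt (u i + 1)
    have h3 : (s : ℤ) * u i ≤ s * U := by exact_mod_cast Nat.mul_le_mul_left s (hU i)
    simp only [z, T]
    have : (0 : ℤ) ≤ s * U := by positivity
    omega
  have hw : ∀ i, ((((z i + 2 * T) / 2).toNat : ℕ) : ℤ) = (z i + 2 * T) / 2 := fun i =>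
    Int.toNat_of_nonneg (Int.ediv_nonneg (hz i) (by norm_num))
  refine ⟨fun i => ((z i + 2 * T) / 2).toNat, ?_, ?_, ?_⟩
  · intro i j l hl h0
    -- A gap of 2 between doubled weights remains a gap of 1 after halving with rounding. The
    -- critical cases are lengths differing by exactly one, where the bound on windows is needed.
    have key : z i + 2 ≤ z j + 2 * (s * l : ℕ) := by
      have a1 := hi1 i
      have a2 := hi2 i
      have b1 := hi1 j
      have b2 := hi2 j
      have c1 := hN (u i)
      have c2 := hN (u j)
      have d1 := hN2 (u i)
      have d2 := hN2 (u j)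
      have d3 := hN1 (u i)
      have d4 := hN1 (u j)
      simp only [z, Nat.cast_mul]
      clear hz hw
      clear_value T
      generalize u i = a at *
      generalize u j = b at *
      rcases lt_trichotomy a b with h | h | h
      · have hl1 : 1 ≤ l := by omega
        have e : (s : ℤ) * b ≤ s * a + s * l := by
          rw [← mul_add]; exact_mod_cast Nat.mul_le_mul_left s hl
        rcases Nat.lt_or_ge l 2 with h2 | h2
        · have : l = 1 := by omega
          subst this
          have e3 : b = a + 1 := by omega
          subst e3
          push_cast at *
          simp only [Nat.add_assoc, Nat.reduceAdd, mul_add] at *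
          omega
        · have : (s : ℤ) * 2 ≤ s * l := by exact_mod_cast Nat.mul_le_mul_left s h2
          omega
      · subst h
        rcases Nat.eq_zero_or_pos l with h2 | h2
        · have := h0 h2
          subst h2
          have : (i : ℕ) < j := this
          push_cast
          omega
        · have : (s : ℤ) * 1 ≤ s * l := by exact_mod_cast Nat.mul_le_mul_left s h2
          omega
      · have e0 : (0 : ℤ) ≤ s * l := by positivity
        rcases Nat.lt_or_ge (b + 1) a with h2 | h2
        · have : (s : ℤ) * (b + 2) ≤ s * a := by exact_mod_cast Nat.mul_le_mul_left s h2
          rw [mul_add] at this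
          omega
        · have e3 : a = b + 1 := by omega
          subst e3
          push_cast at *
          simp only [Nat.add_assoc, Nat.reduceAdd, mul_add] at *
          omega
    have h1 := hw i
    have h2 := hw j
    generalize s * l = m at *
    omega
  · intro k
    -- The chains are centred near `T - s / 2`; up to rounding, so is the interval of length `s * k`
    -- starting here.
    refine ⟨T - ((s * k + s : ℕ) : ℤ) / 2, fun i => ?_⟩
    simp only [hw]
    have a1 := hi1 i
    have a2 := hi2 i
    have c1 := hN (u i)
    have d1 := hN2 (u i)
    constructor
    · intro hk
      have : (s : ℤ) * k ≤ s * u i := by exact_mod_cast Nat.mul_le_mul_left s hk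
      simp only [z]
      push_cast
      generalize (s : ℤ) * k = x at *
      generalize (s : ℤ) * u i = y at *
      omega
    · intro hk
      have : (s : ℤ) * u i ≤ s * k := by exact_mod_cast Nat.mul_le_mul_left s hk
      simp only [z]
      push_cast
      generalize (s : ℤ) * k = x at *
      generalize (s : ℤ) * u i = y at *
      omega
  · intro p hp
    -- For a full window the formulas for the lengths `p` and `p + 1` coincide, so the weights
    -- follow the indices.
    have hc : N p = N (p + 2) + s := by
      have := countGE_add_window u p
      rw [hp] at this
      exact this
    have key : ∀ i, (u i = p + 1 ∨ u i = p) → z i = 2 * i + 1 - N p - N (p + 1) - s * p := by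
      rintro i (h | h)
      · simp only [z, h, hc]
        push_cast
        simp only [Nat.add_assoc, Nat.reduceAdd]
        ring
      · simp only [z, h]
    intro i j hi hj
    have h1 := hw i
    have h2 := hw j
    rw [key i hi] at h1
    rw [key j hj] at h2
    rw [key i hi, key j hj]
    generalize (s : ℤ) * p = y at *
    omega

/-! ### Moving along a plane curve and lifting a simple root -/

/-- A condition `D ≠ 0` satisfied at one point of a plane curve `Q = 0` can be satisfied at another
point of the curve, outside any finite number of vertical lines. -/
theorem exists_evalEval_eq_zero_ne_zero {K : Type*} [Field K] [IsAlgClosed K] {Q D : K[X][X]}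
    {h : K[X]} (hQ : Q.evalEval 0 1 = 0) (hQ0 : Q.eval 0 = 1) (hD : D.evalEval 0 1 ≠ 0)
    (hh : h ≠ 0) : ∃ τ z : K, Q.evalEval τ z = 0 ∧ D.evalEval τ z ≠ 0 ∧ h.eval τ ≠ 0 := by
  classical
  have hQne : Q ≠ 0 := by rintro rfl; simp at hQ0
  obtain ⟨F, hFirr, u, hu⟩ := WfDvdMonoid.exists_factors Q hQne
  have hz : ∃ q ∈ F, evalEvalRingHom 0 1 q = 0 := by
    have h1 : evalEvalRingHom 0 1 (F.prod * (u : K[X][X])) = 0 := by rw [hu]; exact hQ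
    rw [map_mul, map_multiset_prod, mul_eq_zero] at h1
    rcases h1 with h1 | h1
    · rw [Multiset.prod_eq_zero_iff] at h1
      simpa using h1
    · exact absurd h1 (u.isUnit.map _).ne_zero
  obtain ⟨q, hqF, hq⟩ := hz
  have hirr := hFirr q hqF
  have hq' : q.evalEval 0 1 = 0 := hq
  obtain ⟨r, hr⟩ : q ∣ Q := (Multiset.dvd_prod hqF).trans ⟨u, hu.symm⟩
  -- The component `q` through (0, 1) contains no vertical line: a factor depending on τ alone would
  -- vanish at τ = 0, against `Q.eval 0 = 1`.
  have hdeg : q.natDegree ≠ 0 := by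
    intro h0
    obtain ⟨c, rfl⟩ := natDegree_eq_zero.1 h0
    have h2 : c * r.eval 0 = 1 := by
      rw [← hQ0, hr, eval_mul, eval_C]
    have h3 := congrArg (eval 0) h2
    rw [eval_mul, eval_one] at h3
    have h4 : c.eval 0 = 0 := by simpa [evalEval] using hq'
    rw [h4, zero_mul] at h3
    exact zero_ne_one h3
  have hprim : q.IsPrimitive := hirr.isPrimitive hdeg
  have hndvd : ¬ q ∣ D := by
    rintro ⟨d, rfl⟩
    exact hD (by rw [evalEval_mul, hq', zero_mul])
  let _ : NormalizedGCDMonoid K[X] := Classical.choice inferInstance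
  have hirr' : Irreducible (q.map (algebraMap K[X] (FractionRing K[X]))) :=
    (hprim.irreducible_iff_irreducible_map_fraction_map).1 hirr
  have hcop : IsCoprime (q.map (algebraMap K[X] (FractionRing K[X])))
      (D.map (algebraMap K[X] (FractionRing K[X]))) :=
    hirr'.coprime_iff_not_dvd.2 fun hd => hndvd (hprim.dvd_of_fraction_map_dvd_fraction_map hd)
  -- By Gauss's lemma `q` is irreducible over K(τ), and it does not divide `D`, so the two are
  -- coprime there.
  have hres : resultant q D ≠ 0 := by
    intro h0
    have inj := FaithfulSMul.algebraMap_injective K[X] (FractionRing K[X])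
    have h1 := resultant_map_map q D q.natDegree D.natDegree
      (algebraMap K[X] (FractionRing K[X]))
    rw [h0, map_zero] at h1
    have h2 : resultant (q.map (algebraMap K[X] (FractionRing K[X])))
        (D.map (algebraMap K[X] (FractionRing K[X]))) = 0 := by
      rw [natDegree_map_eq_of_injective inj, natDegree_map_eq_of_injective inj]
      exact h1
    exact (resultant_eq_zero_iff.1 h2).2 hcop
  obtain ⟨a, b, -, -, hab⟩ := exists_mul_add_mul_eq_C_resultant q D le_rfl le_rfl (Or.inl hdeg)
  have hlc : q.leadingCoeff ≠ 0 := leadingCoeff_ne_zero.2 hirr.ne_zero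
  -- The leading coefficient keeps the degree of `q`, so that it has a root `z` above τ. The nonzero
  -- resultant then forbids `D` to vanish at the same point.
  obtain ⟨τ, hτ⟩ : ∃ τ : K, (h * resultant q D * q.leadingCoeff).eval τ ≠ 0 := by
    by_contra hcon
    push Not at hcon
    exact mul_ne_zero (mul_ne_zero hh hres) hlc (Polynomial.funext (by simpa using hcon))
  rw [eval_mul, eval_mul] at hτ
  have hτ1 := left_ne_zero_of_mul (left_ne_zero_of_mul hτ)
  have hτ2 := right_ne_zero_of_mul (left_ne_zero_of_mul hτ)
  have hτ3 := right_ne_zero_of_mul hτ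
  have hdeg' : (q.map (evalRingHom τ)).natDegree = q.natDegree :=
    natDegree_map_of_leadingCoeff_ne_zero _ hτ3
  obtain ⟨z, hz⟩ := IsAlgClosed.exists_root (q.map (evalRingHom τ)) (by
    intro h0
    rw [← natDegree_eq_zero_iff_degree_le_zero.2 h0.le] at hdeg
    exact hdeg hdeg'.symm)
  have hqz : q.evalEval τ z = 0 := by
    rw [← map_evalRingHom_eval]; exact hz
  refine ⟨τ, z, by rw [hr, evalEval_mul, hqz, zero_mul], fun hDz => hτ2 ?_, hτ1⟩
  have h5 := congrArg (evalEval τ z) hab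
  rw [evalEval_add, evalEval_mul, evalEval_mul, hqz, hDz, zero_mul, zero_mul, zero_add] at h5
  simpa [evalEval] using h5.symm

/-- Newton approximation of a simple root modulo powers of `X`. -/
theorem exists_approximate_root {K : Type*} [Field K] (f : K[X][X]) (z₀ : K)
    (h0 : (f.eval (C z₀)).eval 0 = 0) (h1 : (f.derivative.eval (C z₀)).eval 0 ≠ 0) (n : ℕ) :
    ∃ z : K[X], z.eval 0 = z₀ ∧ X ^ n ∣ f.eval z := by
  -- The induction starts from a root modulo `X`, which is `z₀` itself.
  suffices H : ∃ z : K[X], z.eval 0 = z₀ ∧ X ^ (n + 1) ∣ f.eval z by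
    obtain ⟨z, hz, hd⟩ := H
    exact ⟨z, hz, (pow_dvd_pow X n.le_succ).trans hd⟩
  induction n with
  | zero =>
    refine ⟨C z₀, by simp, ?_⟩
    rw [zero_add, pow_one, X_dvd_iff, coeff_zero_eq_eval_zero]
    exact h0
  | succ n ih =>
    obtain ⟨z, hz, q, hq⟩ := ih
    have hev : ∀ (p : K[X][X]), (p.eval z).eval 0 = (p.eval (C z₀)).eval 0 := by
      intro p
      have e : ∀ y : K[X], (p.eval y).eval 0 = (p.map (evalRingHom 0)).eval (y.eval 0) :=
        fun y => (eval_map_apply (evalRingHom (0 : K)) y).symm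
      rw [e, e, hz, eval_C]
    set c := (f.derivative.eval (C z₀)).eval 0 with hc
    -- Inverting the derivative modulo `X` suffices, since each Newton step has to gain only one
    -- power.
    have hX : X ∣ 1 - f.derivative.eval z * C c⁻¹ := by
      rw [X_dvd_iff, coeff_zero_eq_eval_zero]
      simp only [eval_sub, eval_one, eval_mul, eval_C, hev, ← hc]
      rw [mul_inv_cancel₀ h1, sub_self]
    obtain ⟨k, hk⟩ := binomExpansion f z (-(X ^ (n + 1) * q * C c⁻¹))
    refine ⟨z + -(X ^ (n + 1) * q * C c⁻¹), by simp [hz], ?_⟩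
    rw [hk, hq]
    obtain ⟨m, hm⟩ := hX
    refine ⟨q * m + k * X ^ n * (q * C c⁻¹) ^ 2, ?_⟩
    calc _ = X ^ (n + 1) * q * (1 - f.derivative.eval z * C c⁻¹) +
          k * (X ^ (n + 1) * q * C c⁻¹) ^ 2 := by ring
      _ = _ := by rw [hm]; ring

/-! ### Endomorphisms commuting with the shift, and their symbols -/

/-- The matrix of a `K[y]`-linear endomorphism of `⨁ K[y] / y ^ (u i)` in the basis of the
`y ^ l e_i`, when the image of `e_i` is `∑ a j i l y ^ l e_j`. -/
def toep {R : Type*} [Zero R] {t : ℕ} (u : Fin t → ℕ) (a : Fin t → Fin t → ℕ → R) :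
    Matrix (Σ i : Fin t, Fin (u i)) (Σ i : Fin t, Fin (u i)) R :=
  Matrix.of fun b c => if (c.2 : ℕ) ≤ b.2 then a b.1 c.1 (b.2 - c.2) else 0

/-- The matrix of multiplication by `y` on `⨁ K[y] / y ^ (u i)`. -/
def shiftMatrix (R : Type*) [Zero R] [One R] {t : ℕ} (u : Fin t → ℕ) :
    Matrix (Σ i : Fin t, Fin (u i)) (Σ i : Fin t, Fin (u i)) R :=
  Matrix.of fun b c => if b.1 = c.1 ∧ (b.2 : ℕ) = c.2 + 1 then 1 else 0

/-- The weight of the basis vector `y ^ l e_i`. -/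
def wt {t : ℕ} {u : Fin t → ℕ} (s : ℕ) (w : Fin t → ℕ) (b : Σ i : Fin t, Fin (u i)) : ℕ :=
  w b.1 + s * b.2

/-- Coefficients defining a nilpotent endomorphism in triangular position. -/
structure IsCoeff {R : Type*} [Zero R] {t : ℕ} (u : Fin t → ℕ) (L : ℕ)
    (a : Fin t → Fin t → ℕ → R) : Prop where
  le_of_ne : ∀ j i l, a j i l ≠ 0 → u j ≤ u i + l
  lt_of_ne : ∀ j i, a j i 0 ≠ 0 → i < j
  eq_zero : ∀ j i l, L ≤ l → a j i l = 0

theorem IsCoeff.weight {R : Type*} [Zero R] {t : ℕ} {u : Fin t → ℕ} {L : ℕ}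
    {a : Fin t → Fin t → ℕ → R} (ha : IsCoeff u L a) {s : ℕ} {w : Fin t → ℕ}
    (hw : IsWeight u s w) {j i : Fin t} {l : ℕ} (h : a j i l ≠ 0) : w i + 1 ≤ w j + s * l :=
  hw.raise i j l (ha.le_of_ne j i l h) fun h0 => ha.lt_of_ne j i (h0 ▸ h)

/-- The normalised symbol of the endomorphism with coefficients `a`, after the substitution
`y = z x ^ s` and conjugation by the weights. -/
def symbol {R : Type*} [CommRing R] {t : ℕ} (s : ℕ) (w : Fin t → ℕ) (L : ℕ)
    (a : Fin t → Fin t → ℕ → R) (x z : R) : Matrix (Fin t) (Fin t) R :=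
  Matrix.of fun j i => ∑ l ∈ Finset.range L, a j i l * z ^ l * x ^ (w j + s * l - w i - 1)

theorem symbol_map {R R' : Type*} [CommRing R] [CommRing R'] (φ : R →+* R') {t : ℕ} (s : ℕ)
    (w : Fin t → ℕ) (L : ℕ) (a : Fin t → Fin t → ℕ → R) (x z : R) :
    (symbol s w L a x z).map φ = symbol s w L (fun j i l => φ (a j i l)) (φ x) (φ z) := by
  ext j i
  simp [symbol]

/-! ### Simultaneous eigenvectors over a ring with nilpotent `x` -/

section Eigen

variable {R : Type*} [CommRing R] {t : ℕ} {u : Fin t → ℕ} {L s : ℕ} {w : Fin t → ℕ}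
  {a : Fin t → Fin t → ℕ → R} {x z : R} {h : ℕ}

/-- Kernel row vectors of `1 - symbol` yield simultaneous left eigenvectors. -/
theorem vecMul_toep_of_symbol (ha : IsCoeff u L a) (hw : IsWeight u s w) (hx : x ^ h = 0)
    (hh : ∀ i, h ≤ w i + s * u i) {ν : Fin t → R}
    (hν : Matrix.vecMul ν (symbol s w L a x z) = ν) :
    Matrix.vecMul (fun b : Σ i : Fin t, Fin (u i) => x ^ wt s w b * z ^ (b.2 : ℕ) * ν b.1)
      (toep u a) = x • fun b => x ^ wt s w b * z ^ (b.2 : ℕ) * ν b.1 := by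
  have hx' : ∀ m, h ≤ m → x ^ m = 0 := fun m hm => by
    rw [← Nat.add_sub_cancel' hm, pow_add, hx, zero_mul]
  funext ⟨i, l⟩
  have e1 : ∀ j, (∑ l' : Fin (u j), x ^ wt s w (⟨j, l'⟩ : Σ i, Fin (u i)) * z ^ (l' : ℕ) * ν j *
      toep u a ⟨j, l'⟩ ⟨i, l⟩) =
      ∑ m ∈ Finset.range L, x ^ (w j + s * (l + m)) * z ^ ((l : ℕ) + m) * ν j * a j i m := by
    intro j
    let φ : ℕ → R := fun l' => x ^ (w j + s * l') * z ^ l' * ν j *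
      if (l : ℕ) ≤ l' then a j i (l' - l) else 0
    -- Positions past the end of a chain may be added freely: by `hh` their weight is at least `h`,
    -- so the power of `x` is zero.
    have h1 : ∀ N, u j ≤ N → ∑ l' ∈ Finset.range (u j), φ l' = ∑ l' ∈ Finset.range N, φ l' := by
      intro N hN
      refine Finset.sum_subset (Finset.range_mono hN) fun l' _ hl' => ?_
      have h2 : u j ≤ l' := by simpa using hl'
      have h3 : s * u j ≤ s * l' := Nat.mul_le_mul_left s h2
      have h4 := hh j
      simp only [φ]
      rw [hx' _ (by omega)]
      simp
    have h2 : ∀ N, l + L ≤ N →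
        ∑ l' ∈ Finset.range (l + L), φ l' = ∑ l' ∈ Finset.range N, φ l' := by
      intro N hN
      refine Finset.sum_subset (Finset.range_mono hN) fun l' _ hl' => ?_
      have h2 : l + L ≤ l' := by simpa using hl'
      simp only [φ]
      rw [ha.eq_zero j i (l' - l) (by omega)]
      simp
    have h3 : ∑ l' ∈ Finset.range (l + L), φ l' =
        ∑ m ∈ Finset.range L, x ^ (w j + s * (l + m)) * z ^ ((l : ℕ) + m) * ν j * a j i m := by
      rw [Finset.sum_range_add, Finset.sum_eq_zero, zero_add]
      · refine Finset.sum_congr rfl fun m _ => ?_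
        simp [φ]
      · intro l' hl'
        have : ¬ (l : ℕ) ≤ l' := by simpa using hl'
        simp [φ, this]
    rw [← h3, h2 (l + L + u j) (by omega), ← h1 (l + L + u j) (by omega), Finset.sum_range]
    rfl
  simp only [Matrix.vecMul, dotProduct, Fintype.sum_sigma, Pi.smul_apply, smul_eq_mul]
  simp only [e1]
  -- Where `a j i m ≠ 0`, weights rise by at least one, so the truncated subtraction in `symbol` is
  -- a true one and a factor `x` splits off.
  have e2 : ∀ j, ∑ m ∈ Finset.range L,
      x ^ (w j + s * (l + m)) * z ^ ((l : ℕ) + m) * ν j * a j i m =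
      x * (x ^ (w i + s * l) * z ^ (l : ℕ)) * (ν j * symbol s w L a x z j i) := by
    intro j
    simp only [symbol, Matrix.of_apply, Finset.mul_sum]
    refine Finset.sum_congr rfl fun m _ => ?_
    by_cases hm : a j i m = 0
    · simp [hm]
    · have h1 := ha.weight hw hm
      have h2 : w j + s * (l + m) = 1 + (w i + s * l) + (w j + s * m - w i - 1) := by
        rw [mul_add]; omega
      rw [h2, pow_add, pow_add, pow_one, pow_add]
      ring
  simp only [e2, ← Finset.mul_sum]
  have e3 : ∑ j, ν j * symbol s w L a x z j i = ν i := congrFun hν i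
  rw [e3]
  simp only [wt]
  ring

/-- Moving one step along a chain multiplies the entry by `x ^ s * z`; the term missing at the end
of the chain has weight at least `h`. -/
theorem vecMul_shiftMatrix (hx : x ^ h = 0) (hh : ∀ i, h ≤ w i + s * u i) (ν : Fin t → R) :
    Matrix.vecMul (fun b : Σ i : Fin t, Fin (u i) => x ^ wt s w b * z ^ (b.2 : ℕ) * ν b.1)
      (shiftMatrix R u) = (x ^ s * z) • fun b => x ^ wt s w b * z ^ (b.2 : ℕ) * ν b.1 := by
  funext ⟨i, l⟩
  simp only [Matrix.vecMul, dotProduct, shiftMatrix, Matrix.of_apply, mul_ite, mul_one, mul_zero,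
    Pi.smul_apply, smul_eq_mul]
  have e : x ^ s * z * (x ^ wt s w (⟨i, l⟩ : Σ i, Fin (u i)) * z ^ (l : ℕ) * ν i) =
      x ^ (w i + s * (l + 1)) * z ^ ((l : ℕ) + 1) * ν i := by
    simp only [wt]
    ring
  rw [e]
  by_cases hl : (l : ℕ) + 1 < u i
  · rw [Finset.sum_eq_single ⟨i, ⟨l + 1, hl⟩⟩]
    · simp [wt]
    · rintro ⟨j, m⟩ _ hne
      rw [if_neg]
      rintro ⟨h1, h2⟩
      simp only at h1 h2
      subst h1
      exact hne (by rw [Sigma.mk.injEq]; exact ⟨rfl, heq_of_eq (Fin.ext h2)⟩)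
    · simp
  · have : (l : ℕ) + 1 = u i := by omega
    have h4 := hh i
    have h5 : x ^ (w i + s * (l + 1)) = 0 := by
      rw [this, ← Nat.add_sub_cancel' h4, pow_add, hx, zero_mul]
    rw [h5, zero_mul, zero_mul]
    refine Finset.sum_eq_zero ?_
    rintro ⟨j, m⟩ _
    rw [if_neg]
    rintro ⟨h1, h2⟩
    simp only at h1 h2
    subst h1
    have := m.2
    omega

/-- Kernel column vectors of `1 - symbol` yield simultaneous right eigenvectors. -/
theorem toep_mulVec_of_symbol (ha : IsCoeff u L a) (hw : IsWeight u s w) (hx : x ^ h = 0)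
    {M U : ℕ} (hh : ∀ i, h + w i ≤ M + s) (hM : ∀ i, w i + s * u i ≤ M + s) (hU : ∀ i, u i ≤ U)
    {m : Fin t → R} (hm : (symbol s w L a x z).mulVec m = m) :
    (toep u a).mulVec (fun b => x ^ (M - wt s w b) * z ^ (U - b.2) * m b.1) =
      x • fun b => x ^ (M - wt s w b) * z ^ (U - b.2) * m b.1 := by
  have hx' : ∀ m, h ≤ m → x ^ m = 0 := fun m hm => by
    rw [← Nat.add_sub_cancel' hm, pow_add, hx, zero_mul]
  funext ⟨j, l'⟩
  have hl' := l'.2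
  have hsl : s * l' + s ≤ s * u j := by
    rw [← Nat.mul_succ]; exact Nat.mul_le_mul_left s hl'
  have hMj := hM j
  have hUj := hU j
  have e1 : ∀ i, (∑ l : Fin (u i), toep u a ⟨j, l'⟩ ⟨i, l⟩ *
      (x ^ (M - wt s w (⟨i, l⟩ : Σ i, Fin (u i))) * z ^ (U - l) * m i)) =
      x * (x ^ (M - wt s w (⟨j, l'⟩ : Σ i, Fin (u i))) * z ^ (U - l')) *
        (symbol s w L a x z j i * m i) := by
    intro i
    let φ : ℕ → R := fun l => (if l ≤ (l' : ℕ) then a j i (l' - l) else 0) *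
      (x ^ (M - (w i + s * l)) * z ^ (U - l) * m i)
    let ψ : ℕ → R := fun p => x * (x ^ (M - (w j + s * l')) * z ^ (U - l')) *
      (a j i p * z ^ p * x ^ (w j + s * p - w i - 1) * m i)
    have hi := hh i
    have h0 : ∀ p, a j i p ≠ 0 → w i + 1 ≤ w j + s * p := fun p hp => ha.weight hw hp
    have h1 : ∑ l ∈ Finset.range (u i), φ l = ∑ l ∈ Finset.range (l' + 1), φ l := by
      -- Positions `l ≥ u i` contribute nothing: a nonzero coefficient would require `u j ≤ u i +
      -- (l' - l)`, contrary to `l' < u j`.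
      have r1 : ∑ l ∈ Finset.range (u i), φ l = ∑ l ∈ Finset.range (u i + (l' + 1)), φ l := by
        refine Finset.sum_subset (Finset.range_mono (by omega)) fun l _ hl => ?_
        have h2 : u i ≤ l := by simpa using hl
        by_cases h3 : l ≤ (l' : ℕ)
        · have : a j i (l' - l) = 0 := by
            by_contra hne
            have := ha.le_of_ne j i _ hne
            omega
          simp [φ, this]
        · simp [φ, h3]
      have r2 : ∑ l ∈ Finset.range (l' + 1), φ l = ∑ l ∈ Finset.range (u i + (l' + 1)), φ l := by
        refine Finset.sum_subset (Finset.range_mono (by omega)) fun l _ hl => ?_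
        have h2 : ¬ l ≤ (l' : ℕ) := by simp only [Finset.mem_range] at hl; omega
        simp [φ, h2]
      rw [r1, r2]
    have h2 : ∑ p ∈ Finset.range L, ψ p = ∑ p ∈ Finset.range (l' + 1), ψ p := by
      have r1 : ∑ p ∈ Finset.range L, ψ p = ∑ p ∈ Finset.range (L + (l' + 1)), ψ p := by
        refine Finset.sum_subset (Finset.range_mono (by omega)) fun p _ hp => ?_
        simp [ψ, ha.eq_zero j i p (by simpa using hp)]
      -- Terms with `p > l'` would come from negative positions; by `hh` their exponent of `x`
      -- reaches `h`.
      have r2 : ∑ p ∈ Finset.range (l' + 1), ψ p = ∑ p ∈ Finset.range (L + (l' + 1)), ψ p := by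
        refine Finset.sum_subset (Finset.range_mono (by omega)) fun p _ hp => ?_
        have hp' : (l' : ℕ) + 1 ≤ p := by simpa using hp
        by_cases hap : a j i p = 0
        · simp [ψ, hap]
        have h3 := h0 p hap
        have h4 : s * (l' + 1) ≤ s * p := Nat.mul_le_mul_left s hp'
        rw [mul_add, mul_one] at h4
        have h5 : x * x ^ (M - (w j + s * l')) * x ^ (w j + s * p - w i - 1) = 0 := by
          rw [← pow_succ', ← pow_add]
          exact hx' _ (by omega)
        calc ψ p = (x * x ^ (M - (w j + s * l')) * x ^ (w j + s * p - w i - 1)) *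
              (z ^ (U - l') * (a j i p * z ^ p * m i)) := by simp only [ψ]; ring
          _ = 0 := by rw [h5, zero_mul]
      rw [r1, r2]
    have h3 : ∑ l ∈ Finset.range (l' + 1), φ l = ∑ p ∈ Finset.range (l' + 1), ψ p := by
      rw [← Finset.sum_range_reflect]
      refine Finset.sum_congr rfl fun p hp => ?_
      have hp' : p ≤ l' := by simp only [Finset.mem_range] at hp; omega
      have e5 : (l' : ℕ) + 1 - 1 - p = l' - p := by omega
      have e6 : (l' : ℕ) - (l' - p) = p := by omega
      simp only [φ, ψ, e5, e6, if_pos (Nat.sub_le (l' : ℕ) p)]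
      by_cases hap : a j i p = 0
      · simp [hap]
      have h3 := h0 p hap
      have h4 : s * (l' - p) = s * l' - s * p := Nat.mul_sub s l' p
      have h5 : s * p ≤ s * l' := Nat.mul_le_mul_left s hp'
      have h6 : M - (w i + s * (l' - p)) =
          1 + (M - (w j + s * l')) + (w j + s * p - w i - 1) := by omega
      have h7 : U - (l' - p) = U - l' + p := by omega
      rw [h6, h7, pow_add, pow_add, pow_one, pow_add]
      ring
    have h4 : x * (x ^ (M - wt s w (⟨j, l'⟩ : Σ i, Fin (u i))) * z ^ (U - l')) *
        (symbol s w L a x z j i * m i) = ∑ p ∈ Finset.range L, ψ p := by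
      simp only [symbol, Matrix.of_apply, Finset.sum_mul, Finset.mul_sum]
      rfl
    rw [h4, h2, ← h3, ← h1, Finset.sum_range]
    rfl
  simp only [Matrix.mulVec, dotProduct, Fintype.sum_sigma, Pi.smul_apply, smul_eq_mul]
  simp only [e1, ← Finset.mul_sum]
  have e3 : ∑ i, symbol s w L a x z j i * m i = m j := congrFun hm j
  rw [e3]
  ring

theorem shiftMatrix_mulVec (hx : x ^ h = 0) {M U : ℕ} (hh : ∀ i, h + w i ≤ M + s)
    (hM : ∀ i, w i + s * u i ≤ M + s) (hU : ∀ i, u i ≤ U) (m : Fin t → R) :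
    (shiftMatrix R u).mulVec (fun b => x ^ (M - wt s w b) * z ^ (U - b.2) * m b.1) =
      (x ^ s * z) • fun b => x ^ (M - wt s w b) * z ^ (U - b.2) * m b.1 := by
  funext ⟨j, l'⟩
  have hl' := l'.2
  have hsl : s * l' + s ≤ s * u j := by
    rw [← Nat.mul_succ]; exact Nat.mul_le_mul_left s hl'
  have hMj := hM j
  have hUj := hU j
  have hhj := hh j
  simp only [Matrix.mulVec, dotProduct, shiftMatrix, Matrix.of_apply, ite_mul, one_mul, zero_mul,
    Pi.smul_apply, smul_eq_mul]
  have e : x ^ s * z * (x ^ (M - wt s w (⟨j, l'⟩ : Σ i, Fin (u i))) * z ^ (U - l') * m j) =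
      x ^ (s + M - (w j + s * l')) * z ^ (U - l' + 1) * m j := by
    have : s + M - (w j + s * l') = s + (M - (w j + s * l')) := by omega
    simp only [wt]
    rw [this, pow_add, pow_succ]
    ring
  rw [e]
  rcases Nat.eq_zero_or_pos (l' : ℕ) with h0 | h0
  · have h5 : x ^ (s + M - (w j + s * l')) = 0 := by
      rw [h0, mul_zero, add_zero]
      have : h ≤ s + M - w j := by omega
      rw [← Nat.add_sub_cancel' this, pow_add, hx, zero_mul]
    rw [h5, zero_mul, zero_mul]
    refine Finset.sum_eq_zero ?_
    rintro ⟨i, l⟩ _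
    rw [if_neg]
    rintro ⟨-, h2⟩
    simp only at h2
    omega
  · rw [Finset.sum_eq_single ⟨j, ⟨l' - 1, by omega⟩⟩]
    · rw [if_pos ⟨rfl, by simp only; omega⟩]
      have h6 : s * (l' - 1) = s * l' - s := by rw [Nat.mul_sub, mul_one]
      have h7 : s ≤ s * l' := Nat.le_mul_of_pos_right s h0
      have h8 : M - wt s w (⟨j, ⟨l' - 1, by omega⟩⟩ : Σ i, Fin (u i)) =
          s + M - (w j + s * l') := by
        simp only [wt]
        omega
      have h9 : U - ((l' : ℕ) - 1) = U - l' + 1 := by omega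
      rw [h8, h9]
    · rintro ⟨i, l⟩ _ hne
      rw [if_neg]
      rintro ⟨h1, h2⟩
      simp only at h1 h2
      subst h1
      exact hne (by rw [Sigma.mk.injEq]; exact ⟨rfl, heq_of_eq (Fin.ext (by simp only; omega))⟩)
    · simp

end Eigen

/-! ### Matrices raising weights and their leading parts -/

/-- The endomorphism with matrix `M` raises the weights `ω` of the basis vectors by at least `d`. -/
def Raises {R ι : Type*} [Zero R] (ω : ι → ℕ) (d : ℕ) (M : Matrix ι ι R) : Prop :=
  ∀ b a, M b a ≠ 0 → ω a + d ≤ ω b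

/-- The part of a matrix which raises the weights by exactly `d`. -/
def leadPart {R ι : Type*} [Zero R] (ω : ι → ℕ) (d : ℕ) (M : Matrix ι ι R) : Matrix ι ι R :=
  Matrix.of fun b a => if ω b = ω a + d then M b a else 0

section Raises

variable {R ι : Type*} [CommRing R] {ω : ι → ℕ} {d e : ℕ} {M N : Matrix ι ι R}

theorem Raises.sub (h : Raises ω d M) (h' : Raises ω d N) : Raises ω d (M - N) := by
  intro b a hba
  by_cases h0 : M b a = 0
  · refine h' b a fun h1 => hba ?_
    simp [h0, h1]
  · exact h b a h0

theorem leadPart_sub : leadPart ω d (M - N) = leadPart ω d M - leadPart ω d N := by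
  ext b a
  simp only [leadPart, Matrix.of_apply, Matrix.sub_apply]
  split_ifs <;> simp

/-- A minor of a matrix raising weights by at least `d` which pairs rows and columns whose weights
differ by `d` only depends on the leading part. -/
theorem Raises.det_submatrix (h : Raises ω d M) {J : Type*} [Fintype J] [DecidableEq J]
    (r c : J → ι) (hrc : ∀ j, ω (r j) = ω (c j) + d) :
    (M.submatrix r c).det = ((leadPart ω d M).submatrix r c).det := by
  -- Ordered by weight, both minors are block triangular with the same diagonal blocks.
  have h1 : (M.submatrix r c).BlockTriangular (OrderDual.toDual ∘ fun j => ω (c j)) := by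
    intro i j hij
    have hij' : ω (c i) < ω (c j) := hij
    by_contra hne
    have := h _ _ hne
    have := hrc i
    omega
  have h2 : ((leadPart ω d M).submatrix r c).BlockTriangular
      (OrderDual.toDual ∘ fun j => ω (c j)) := by
    intro i j hij
    have hij' : ω (c i) < ω (c j) := hij
    have := hrc i
    simp only [Matrix.submatrix_apply, leadPart, Matrix.of_apply]
    rw [if_neg (by omega)]
  rw [h1.det, h2.det]
  refine Finset.prod_congr rfl fun k _ => ?_
  congr 1
  ext i j
  have hi : ω (c i) = ω (c j) := OrderDual.toDual.injective (i.2.trans j.2.symm)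
  have := hrc i
  simp only [Matrix.toSquareBlock_def, Matrix.of_apply, Matrix.submatrix_apply, leadPart]
  rw [if_pos (by omega)]

theorem raises_one [DecidableEq ι] : Raises ω 0 (1 : Matrix ι ι R) := by
  intro b a hba
  by_cases h : b = a
  · simp [h]
  · simp [h] at hba

variable [Fintype ι]

theorem Raises.mul (h : Raises ω d M) (h' : Raises ω e N) : Raises ω (d + e) (M * N) := by
  intro b a hba
  obtain ⟨x, -, hx⟩ := Finset.exists_ne_zero_of_sum_ne_zero (s := Finset.univ) hba
  have h1 := h b x (left_ne_zero_of_mul hx)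
  have h2 := h' x a (right_ne_zero_of_mul hx)
  omega

theorem leadPart_mul (h : Raises ω d M) (h' : Raises ω e N) :
    leadPart ω (d + e) (M * N) = leadPart ω d M * leadPart ω e N := by
  ext b a
  simp only [leadPart, Matrix.of_apply, Matrix.mul_apply]
  by_cases hba : ω b = ω a + (d + e)
  · rw [if_pos hba]
    refine Finset.sum_congr rfl fun x _ => ?_
    by_cases h1 : M b x = 0
    · simp [h1]
    by_cases h2 : N x a = 0
    · simp [h2]
    have h3 := h b x h1
    have h4 := h' x a h2
    rw [if_pos (by omega), if_pos (by omega)]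
  · rw [if_neg hba]
    refine (Finset.sum_eq_zero fun x _ => ?_).symm
    by_cases h1 : ω b = ω x + d
    · rw [if_neg (c := ω x = ω a + e) (by omega), mul_zero]
    · rw [if_neg h1, zero_mul]

variable [DecidableEq ι]

theorem Raises.pow (h : Raises ω d M) (k : ℕ) : Raises ω (d * k) (M ^ k) := by
  induction k with
  | zero => simpa using raises_one
  | succ k ih => rw [pow_succ, Nat.mul_succ]; exact ih.mul h

theorem Raises.isNilpotent (h : Raises ω 1 M) : IsNilpotent M := by
  refine ⟨∑ i, ω i + 1, ?_⟩
  ext b a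
  by_contra hne
  have h1 := h.pow _ b a hne
  have h2 : ω b ≤ ∑ i, ω i :=
    Finset.single_le_sum (fun _ _ => Nat.zero_le _) (Finset.mem_univ b)
  omega

theorem Raises.aeval {K : Type*} [Field K] {M : Matrix ι ι K} (h : Raises ω 1 M) (z : K[X]) :
    Raises ω 0 (aeval M z) := by
  intro b a hba
  rw [aeval_eq_sum_range, Matrix.sum_apply] at hba
  obtain ⟨k, -, hk⟩ := Finset.exists_ne_zero_of_sum_ne_zero hba
  have := h.pow k b a (right_ne_zero_of_mul hk)
  omega

theorem leadPart_pow (h : Raises ω d M) (k : ℕ) :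
    leadPart ω (d * k) (M ^ k) = leadPart ω d M ^ k := by
  induction k with
  | zero =>
    ext b a
    simp only [leadPart, mul_zero, pow_zero, Matrix.of_apply, add_zero]
    by_cases hba : b = a
    · simp [hba]
    · simp [hba]
  | succ k ih => rw [pow_succ, Nat.mul_succ, leadPart_mul (h.pow k) h, ih, pow_succ]

/-- Only the constant term of `z` can preserve weights; the rest is a multiple of `M`. -/
theorem leadPart_aeval {K : Type*} [Field K] {M : Matrix ι ι K} (h : Raises ω 1 M) (z : K[X]) :
    leadPart ω 0 (Polynomial.aeval M z) = z.eval 0 • (1 : Matrix ι ι K) := by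
  have h1 : Polynomial.aeval M z =
      Polynomial.aeval M z.divX * M + algebraMap K (Matrix ι ι K) (z.eval 0) := by
    conv_lhs => rw [← divX_mul_X_add z]
    rw [map_add, map_mul, aeval_X, aeval_C, coeff_zero_eq_eval_zero]
  have h2 : Raises ω 1 (Polynomial.aeval M z.divX * M) := by
    simpa using (h.aeval z.divX).mul h
  rw [h1, Algebra.algebraMap_eq_smul_one]
  ext b a
  simp only [leadPart, Matrix.of_apply, Matrix.add_apply, add_zero]
  split_ifs with hba
  · by_cases h3 : (Polynomial.aeval M z.divX * M) b a = 0
    · rw [h3, zero_add]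
    · have := h2 b a h3
      omega
  · have : b ≠ a := fun h => hba (by rw [h])
    simp [this]

theorem leadPart_sub_aeval {K : Type*} [Field K] {S M : Matrix ι ι K} (h : Raises ω 1 M) (s : ℕ)
    (z : K[X]) : leadPart ω s (S - Polynomial.aeval M (X ^ s * z)) =
      leadPart ω s S - z.eval 0 • leadPart ω 1 M ^ s := by
  have h1 : Raises ω (s + 0) (M ^ s) := by simpa using h.pow s
  have h2 := leadPart_pow h s
  rw [one_mul] at h2
  have h3 : leadPart ω (s + 0) (M ^ s * Polynomial.aeval M z) = _ :=
    leadPart_mul h1 (h.aeval z)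
  rw [add_zero, h2, leadPart_aeval h] at h3
  rw [leadPart_sub, map_mul, map_pow, aeval_X, h3, mul_smul_comm, mul_one]

theorem Raises.sub_aeval {K : Type*} [Field K] {S M : Matrix ι ι K} {s : ℕ} (hS : Raises ω s S)
    (h : Raises ω 1 M) (z : K[X]) : Raises ω s (S - Polynomial.aeval M (X ^ s * z)) := by
  rw [map_mul, map_pow, aeval_X]
  refine hS.sub ?_
  simpa using (h.pow s).mul (h.aeval z)

/-- A matrix which raises weights by at least `d` vanishes modulo the weights outside any interval
of length `d`. -/
theorem Raises.rank_add_le {K : Type*} [Field K] {M : Matrix ι ι K} (h : Raises ω d M) (c : ℤ) :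
    M.rank + (Finset.univ.filter fun b => c ≤ ω b ∧ (ω b : ℤ) < c + d).card ≤
      Fintype.card ι := by
  classical
  let T := Finset.univ.filter fun b => (ω b : ℤ) < c
  let S := Finset.univ.filter fun b => c + d ≤ (ω b : ℤ)
  let W := Finset.univ.filter fun b => c ≤ ω b ∧ (ω b : ℤ) < c + d
  -- A column of weight at least `c` is supported on rows of weight at least `c + d`. Hence the
  -- columns of weight below `c` and the unit vectors of weight at least `c + d` span the image, and
  -- the weights in between are not counted.
  let V : Finset (ι → K) := T.image M.col ∪ S.image fun b => Pi.single b 1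
  have h1 : M.rank ≤ V.card := by
    rw [Matrix.rank_eq_finrank_span_cols]
    refine (Submodule.finrank_mono (Submodule.span_le.2 ?_)).trans (finrank_span_finset_le_card V)
    rintro _ ⟨a, rfl⟩
    by_cases ha : (ω a : ℤ) < c
    · exact Submodule.subset_span
        (Finset.mem_union_left _ (Finset.mem_image_of_mem _ (by simpa [T] using ha)))
    · have : M.col a = ∑ b ∈ S, M b a • Pi.single b (1 : K) := by
        funext x
        rw [Finset.sum_apply]
        by_cases hx : x ∈ S
        · rw [Finset.sum_eq_single x]
          · simp
          · intro b _ hb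
            simp [Ne.symm hb]
          · exact fun h => absurd hx h
        · rw [Finset.sum_eq_zero]
          · by_contra hne
            have h3 := h x a hne
            simp only [S, Finset.mem_filter, Finset.mem_univ, true_and] at hx
            omega
          · intro b hb
            have : x ≠ b := fun h => hx (h ▸ hb)
            simp [this]
      rw [this]
      refine Submodule.sum_mem _ fun b hb => Submodule.smul_mem _ _ (Submodule.subset_span ?_)
      exact Finset.mem_union_right _ (Finset.mem_image_of_mem _ hb)
  have h2 : V.card ≤ T.card + S.card :=
    (Finset.card_union_le _ _).trans (Nat.add_le_add Finset.card_image_le Finset.card_image_le)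
  have h3 : T.card + S.card + W.card = Fintype.card ι := by
    rw [← Finset.card_union_of_disjoint, ← Finset.card_union_of_disjoint, ← Finset.card_univ]
    · congr 1
      ext b
      simp only [T, S, W, Finset.mem_union, Finset.mem_filter, Finset.mem_univ, true_and, iff_true]
      omega
    · rw [Finset.disjoint_left]
      intro b hb
      simp only [T, S, W, Finset.mem_union, Finset.mem_filter, Finset.mem_univ, true_and] at hb ⊢
      omega
    · rw [Finset.disjoint_left]
      intro b hb
      simp only [T, S, Finset.mem_filter, Finset.mem_univ, true_and] at hb ⊢
      omega
  change M.rank + W.card ≤ _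
  omega

end Raises

/-! ### Bounds for the ranks of powers -/

theorem card_le_rank_of_det_submatrix_ne_zero {K ι J : Type*} [Field K] [Fintype ι] [Fintype J]
    [DecidableEq J] (M : Matrix ι ι K) (r c : J → ι) (h : (M.submatrix r c).det ≠ 0) :
    Fintype.card J ≤ M.rank := by
  classical
  have h1 := Matrix.rank_of_isUnit (M.submatrix r c)
    ((Matrix.isUnit_iff_isUnit_det _).2 (isUnit_iff_ne_zero.2 h))
  rw [← h1]
  exact Matrix.rank_submatrix_le M r c

theorem exists_int_le_add_mul {s w : ℕ} {c : ℤ} (hs : (0 : ℤ) < s) (h : (w : ℤ) < c + s) :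
    ∃ l : ℕ, c ≤ w + s * l ∧ (w : ℤ) + s * l < c + s := by
  by_cases hc : c ≤ w
  · exact ⟨0, by simpa using hc, by simpa using h⟩
  · refine ⟨((c - w + s - 1) / s).toNat, ?_⟩
    have h0 : 0 ≤ (c - w + s - 1) / s := Int.ediv_nonneg (by omega) hs.le
    rw [Int.toNat_of_nonneg h0]
    have h1 := Int.mul_ediv_add_emod (c - w + s - 1) s
    have h2 := Int.emod_nonneg (c - w + s - 1) hs.ne'
    have h3 := Int.emod_lt_of_pos (c - w + s - 1) hs
    constructor <;> linarith

theorem raises_shiftMatrix {R : Type*} [CommRing R] {t : ℕ} (u : Fin t → ℕ) (s : ℕ)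
    (w : Fin t → ℕ) : Raises (wt s w) s (shiftMatrix R u) := by
  rintro ⟨j, l'⟩ ⟨i, l⟩ h
  simp only [shiftMatrix, Matrix.of_apply, ne_eq, ite_eq_right_iff, not_forall] at h
  obtain ⟨⟨h1, h2⟩, -⟩ := h
  subst h1
  simp only [wt, h2]
  rw [mul_add, mul_one, add_assoc]

theorem leadPart_shiftMatrix {R : Type*} [CommRing R] {t : ℕ} (u : Fin t → ℕ) (s : ℕ)
    (w : Fin t → ℕ) : leadPart (wt s w) s (shiftMatrix R u) = shiftMatrix R u := by
  ext ⟨j, l'⟩ ⟨i, l⟩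
  simp only [shiftMatrix, Matrix.of_apply, leadPart]
  split_ifs with h1 h2 h2
  · rfl
  · rfl
  · obtain ⟨h3, h4⟩ := h2
    refine absurd ?_ h1
    subst h3
    simp only [wt, h4]
    ring
  · rfl

theorem IsCoeff.raises_toep {R : Type*} [CommRing R] {t : ℕ} {u : Fin t → ℕ} {L s : ℕ}
    {w : Fin t → ℕ} {a : Fin t → Fin t → ℕ → R} (ha : IsCoeff u L a) (hw : IsWeight u s w) :
    Raises (wt s w) 1 (toep u a) := by
  rintro ⟨j, l'⟩ ⟨i, l⟩ h
  simp only [toep, Matrix.of_apply, ne_eq, ite_eq_right_iff, not_forall] at h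
  obtain ⟨h1, h2⟩ := h
  have h3 := ha.weight hw h2
  simp only [wt]
  have : s * l' = s * l + s * (l' - l) := by rw [← mul_add]; congr 1; omega
  omega

/-- The coefficients of the part of an endomorphism which raises weights by exactly one. -/
def leadCoeffs {R : Type*} [Zero R] {t : ℕ} (s : ℕ) (w : Fin t → ℕ) (a : Fin t → Fin t → ℕ → R) :
    Fin t → Fin t → ℕ → R :=
  fun j i l => if w j + s * l = w i + 1 then a j i l else 0

theorem leadPart_toep {R : Type*} [Zero R] {t : ℕ} (u : Fin t → ℕ) (s : ℕ) (w : Fin t → ℕ)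
    (a : Fin t → Fin t → ℕ → R) :
    leadPart (wt s w) 1 (toep u a) = toep u (leadCoeffs s w a) := by
  ext ⟨j, l'⟩ ⟨i, l⟩
  simp only [toep, leadPart, leadCoeffs, Matrix.of_apply, wt]
  by_cases h : (l : ℕ) ≤ l'
  · have : s * l' = s * l + s * (l' - l) := by rw [← mul_add]; congr 1; omega
    rw [if_pos h, if_pos h]
    refine if_congr ?_ rfl rfl
    omega
  · simp [h]

/-- `M ^ k` raises weights by `s * k`, so its rank is at most the number of basis vectors outside
any interval of that length. The centred interval contains at least `min (u i) k` vectors of each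
chain. -/
theorem IsWeight.rank_pow_le {K : Type*} [Field K] {t : ℕ} {u : Fin t → ℕ} {s : ℕ} {w : Fin t → ℕ}
    (hw : IsWeight u s w) {M : Matrix (Σ i : Fin t, Fin (u i)) (Σ i : Fin t, Fin (u i)) K}
    (hM : Raises (wt s w) s M) (k : ℕ) : (M ^ k).rank ≤ tailSum u k := by
  classical
  obtain ⟨c, hc⟩ := hw.centre k
  have h1 := (hM.pow k).rank_add_le c
  -- `l₀` is where the chain enters the interval. A chain of length at most `k` lies inside it
  -- entirely.
  have h2 : ∀ i, ∃ l₀, ∀ l < min (u i) k, l₀ + l < u i ∧ c ≤ w i + s * (l₀ + l : ℕ) ∧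
      (w i : ℤ) + s * (l₀ + l : ℕ) < c + (s * k : ℕ) := by
    intro i
    rcases le_total k (u i) with hk | hk
    · obtain ⟨h3, h4⟩ := (hc i).1 hk
      have hs : (0 : ℤ) < s := by
        rcases Nat.eq_zero_or_pos s with h | h
        · simp only [h, Nat.cast_zero, add_zero, zero_mul] at h3 h4
          omega
        · exact_mod_cast h
      obtain ⟨l₀, h5, h6⟩ := exists_int_le_add_mul hs h3
      refine ⟨l₀, fun l hl => ?_⟩
      have hl' : l + 1 ≤ k := hl.trans_le (min_le_right _ _)
      have h7 : (s : ℤ) * l + s ≤ s * k := by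
        have := Nat.mul_le_mul_left s hl'
        rw [mul_add, mul_one] at this
        exact_mod_cast this
      have h8 : (0 : ℤ) ≤ s * l := by positivity
      push_cast
      rw [mul_add]
      refine ⟨?_, by linarith, by linarith⟩
      by_contra h9
      have h10 : (s : ℤ) * u i ≤ s * (l₀ + l) := by
        exact_mod_cast Nat.mul_le_mul_left s (not_lt.1 h9)
      rw [mul_add] at h10
      linarith
    · obtain ⟨h3, h4⟩ := (hc i).2 hk
      refine ⟨0, fun l hl => ?_⟩
      have hl' : l + 1 ≤ u i := hl.trans_le (min_le_left _ _)
      have h7 : (s : ℤ) * l + s ≤ s * u i := by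
        have := Nat.mul_le_mul_left s hl'
        rw [mul_add, mul_one] at this
        exact_mod_cast this
      have h8 : (0 : ℤ) ≤ s * l := by positivity
      rw [zero_add]
      push_cast
      exact ⟨hl', by linarith, by linarith⟩
  choose l₀ hl₀ using h2
  let φ : (Σ i : Fin t, Fin (min (u i) k)) → Σ i : Fin t, Fin (u i) := fun b =>
    ⟨b.1, ⟨l₀ b.1 + b.2, (hl₀ b.1 b.2 b.2.2).1⟩⟩
  have hφ : Function.Injective φ := by
    rintro ⟨i, l⟩ ⟨j, m⟩ h
    have hij : i = j := congrArg Sigma.fst h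
    subst hij
    simp only [φ, Sigma.mk.injEq, heq_eq_eq, true_and, Fin.mk.injEq, add_right_inj] at h
    rw [Fin.ext h]
  have h3 : (Finset.univ.map ⟨φ, hφ⟩) ⊆ Finset.univ.filter
      fun b : Σ i : Fin t, Fin (u i) => c ≤ wt s w b ∧ (wt s w b : ℤ) < c + (s * k : ℕ) := by
    intro b hb
    obtain ⟨⟨i, l⟩, -, rfl⟩ := Finset.mem_map.1 hb
    obtain ⟨-, h5, h6⟩ := hl₀ i l l.2
    refine Finset.mem_filter.2 ⟨Finset.mem_univ _, ?_⟩
    simp only [Function.Embedding.coeFn_mk, φ, wt]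
    push_cast at h5 h6 ⊢
    exact ⟨h5, h6⟩
  have h4 := Finset.card_le_card h3
  rw [Finset.card_map, Finset.card_univ, Fintype.card_sigma] at h4
  simp only [Fintype.card_fin] at h4
  have h5 : Fintype.card (Σ i : Fin t, Fin (u i)) = ∑ i, u i := by simp
  have h6 : tailSum u k + ∑ i, min (u i) k = ∑ i, u i := by
    rw [tailSum, ← Finset.sum_add_distrib]
    exact Finset.sum_congr rfl fun i _ => by omega
  omega

/-- The minor of the `k`-th power of the leading part of a polynomial perturbation of the shift
which witnesses that the shift has the same rank. -/
noncomputable def chainMinor {R : Type*} [CommRing R] {t : ℕ} (u : Fin t → ℕ) (s : ℕ)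
    (w : Fin t → ℕ) (k : ℕ) (a : Fin t → Fin t → ℕ → R) (z : R) : R :=
  (((shiftMatrix R u - z • toep u (leadCoeffs s w a) ^ s) ^ k).submatrix
    (fun b : Σ i : Fin t, Fin (u i - k) => ⟨b.1, ⟨b.2 + k, by have := b.2.2; omega⟩⟩)
    (fun b => ⟨b.1, ⟨b.2, by have := b.2.2; omega⟩⟩)).det

/-- The minor pairs position `l` with position `l + k` of the same chain, so row and column weights
differ by `s * k` and only leading parts matter. Thus the rank is controlled by a condition on
`z.eval 0` alone. -/
theorem tailSum_le_rank {K : Type*} [Field K] {t : ℕ} {u : Fin t → ℕ} {L s : ℕ} {w : Fin t → ℕ}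
    (hw : IsWeight u s w) {a : Fin t → Fin t → ℕ → K} (ha : IsCoeff u L a) (z : K[X]) {k : ℕ}
    (hk : chainMinor u s w k a (z.eval 0) ≠ 0) :
    tailSum u k ≤ ((shiftMatrix K u - aeval (toep u a) (X ^ s * z)) ^ k).rank := by
  have h1 := (raises_shiftMatrix (R := K) u s w).sub_aeval (ha.raises_toep hw) z
  rw [chainMinor, ← leadPart_toep, ← leadPart_shiftMatrix u s w,
    ← leadPart_sub_aeval (ha.raises_toep hw), ← leadPart_pow h1,
    ← (h1.pow k).det_submatrix _ _ (by rintro ⟨i, l⟩; simp only [wt]; ring)] at hk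
  have h2 := card_le_rank_of_det_submatrix_ne_zero _ _ _ hk
  simpa [tailSum] using h2

theorem toep_map {R R' : Type*} [Semiring R] [Semiring R'] (φ : R →+* R') {t : ℕ} (u : Fin t → ℕ)
    (a : Fin t → Fin t → ℕ → R) : (toep u a).map φ = toep u fun j i l => φ (a j i l) := by
  ext b c
  simp only [toep, Matrix.map_apply, Matrix.of_apply]
  split_ifs <;> simp

theorem shiftMatrix_map {R R' : Type*} [Semiring R] [Semiring R'] (φ : R →+* R') {t : ℕ}
    (u : Fin t → ℕ) : (shiftMatrix R u).map φ = shiftMatrix R' u := by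
  ext b c
  simp only [shiftMatrix, Matrix.map_apply, Matrix.of_apply]
  split_ifs <;> simp

theorem chainMinor_map {R R' : Type*} [CommRing R] [CommRing R'] (φ : R →+* R') {t : ℕ}
    (u : Fin t → ℕ) (s : ℕ) (w : Fin t → ℕ) (k : ℕ) (a : Fin t → Fin t → ℕ → R) (z : R) :
    φ (chainMinor u s w k a z) = chainMinor u s w k (fun j i l => φ (a j i l)) (φ z) := by
  have h : ∀ j i l, φ (leadCoeffs s w a j i l) =
      leadCoeffs s w (fun j i l => φ (a j i l)) j i l := fun j i l => by
    simp only [leadCoeffs]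
    split_ifs <;> simp
  have h2 : φ.mapMatrix (shiftMatrix R u - z • toep u (leadCoeffs s w a) ^ s) =
      shiftMatrix R' u - φ z • toep u (leadCoeffs s w fun j i l => φ (a j i l)) ^ s := by
    rw [map_sub, RingHom.mapMatrix_apply, shiftMatrix_map, RingHom.mapMatrix_apply,
      Matrix.map_smul' φ z _ (map_mul φ), ← RingHom.mapMatrix_apply, map_pow,
      RingHom.mapMatrix_apply, toep_map]
    simp only [h]
  rw [chainMinor, chainMinor, RingHom.map_det, ← h2, ← map_pow]
  rfl

/-! ### From eigenvectors modulo a power of `X` to kernel vectors -/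

section Truncate

variable {K ι : Type*} [Field K] [Fintype ι] [DecidableEq ι]

theorem vecMul_aeval {R : Type*} [CommRing R] [Algebra K R] {A : Matrix ι ι K} {F : ι → R} {x : R}
    (hA : Matrix.vecMul F (A.map (algebraMap K R)) = x • F) (g : K[X]) :
    Matrix.vecMul F ((aeval A g).map (algebraMap K R)) = aeval x g • F := by
  induction g using Polynomial.induction_on' with
  | add p q hp hq =>
    rw [map_add, map_add, Matrix.map_add _ (map_add _), Matrix.vecMul_add, hp, hq, add_smul]
  | monomial k c =>
    have h1 : ∀ k, Matrix.vecMul F ((A ^ k).map (algebraMap K R)) = x ^ k • F := by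
      intro k
      induction k with
      | zero => simp [Matrix.map_one]
      | succ k ih =>
        rw [pow_succ, Matrix.map_mul, ← Matrix.vecMul_vecMul, ih, Matrix.smul_vecMul, hA, smul_smul,
          pow_succ]
    rw [aeval_monomial, aeval_monomial, ← Algebra.smul_def, Matrix.map_smul' _ c _ (map_mul _),
      Matrix.vecMul_smul, h1, smul_smul]

theorem aeval_mulVec {R : Type*} [CommRing R] [Algebra K R] {A : Matrix ι ι K} {F : ι → R} {x : R}
    (hA : (A.map (algebraMap K R)).mulVec F = x • F) (g : K[X]) :
    ((aeval A g).map (algebraMap K R)).mulVec F = aeval x g • F := by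
  induction g using Polynomial.induction_on' with
  | add p q hp hq =>
    rw [map_add, map_add, Matrix.map_add _ (map_add _), Matrix.add_mulVec, hp, hq, add_smul]
  | monomial k c =>
    have h1 : ∀ k, ((A ^ k).map (algebraMap K R)).mulVec F = x ^ k • F := by
      intro k
      induction k with
      | zero => simp [Matrix.map_one]
      | succ k ih =>
        rw [pow_succ', Matrix.map_mul, ← Matrix.mulVec_mulVec, ih, Matrix.mulVec_smul, hA,
          smul_smul, pow_succ]
    rw [aeval_monomial, aeval_monomial, ← Algebra.smul_def, Matrix.map_smul' _ c _ (map_mul _),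
      Matrix.smul_mulVec, h1, smul_smul]

theorem aeval_mk_X (I : Ideal K[X]) (g : K[X]) :
    aeval (Ideal.Quotient.mk I X) g = Ideal.Quotient.mk I g := by
  have := aeval_algHom_apply (Ideal.Quotient.mkₐ K I) X g
  simpa using this

variable {A B : Matrix ι ι K} {F : ι → K[X]} {h : ℕ} {g : K[X]}

/-- The coefficients of a left eigenvector modulo `X ^ h` are left kernel vectors. -/
theorem coeff_vecMul_sub_aeval
    (hA : Matrix.vecMul (fun b => Ideal.Quotient.mk (Ideal.span {(X : K[X]) ^ h}) (F b))
      (A.map (algebraMap K _)) = Ideal.Quotient.mk (Ideal.span {(X : K[X]) ^ h}) X •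
        fun b => Ideal.Quotient.mk (Ideal.span {(X : K[X]) ^ h}) (F b))
    (hB : Matrix.vecMul (fun b => Ideal.Quotient.mk (Ideal.span {(X : K[X]) ^ h}) (F b))
      (B.map (algebraMap K _)) = Ideal.Quotient.mk (Ideal.span {(X : K[X]) ^ h}) g •
        fun b => Ideal.Quotient.mk (Ideal.span {(X : K[X]) ^ h}) (F b)) {e : ℕ} (he : e < h) :
    Matrix.vecMul (fun b => (F b).coeff e) (B - aeval A g) = 0 := by
  have h1 := vecMul_aeval hA g
  rw [aeval_mk_X, ← hB] at h1
  have h2 : Matrix.vecMul (fun b => Ideal.Quotient.mk (Ideal.span {(X : K[X]) ^ h}) (F b))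
      ((B - aeval A g).map (algebraMap K _)) = 0 := by
    rw [Matrix.map_sub _ (map_sub _), Matrix.vecMul_sub, h1, sub_self]
  funext a
  -- The matrix `B - aeval A g` has constant entries, so the relation can be read off coefficient by
  -- coefficient below degree `h`.
  have h3 : Ideal.Quotient.mk (Ideal.span {(X : K[X]) ^ h}) (∑ b, F b * C ((B - aeval A g) b a)) =
      0 := by
    rw [map_sum]
    refine Eq.trans ?_ (congrFun h2 a)
    simp only [map_mul]
    rfl
  rw [Ideal.Quotient.eq_zero_iff_mem, Ideal.mem_span_singleton, X_pow_dvd_iff] at h3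
  have h4 := h3 e he
  simp only [finsetSum_coeff, coeff_mul_C] at h4
  exact h4

/-- The coefficients of a right eigenvector modulo `X ^ h` are kernel vectors. -/
theorem coeff_sub_aeval_mulVec
    (hA : (A.map (algebraMap K _)).mulVec
      (fun b => Ideal.Quotient.mk (Ideal.span {(X : K[X]) ^ h}) (F b)) =
        Ideal.Quotient.mk (Ideal.span {(X : K[X]) ^ h}) X •
          fun b => Ideal.Quotient.mk (Ideal.span {(X : K[X]) ^ h}) (F b))
    (hB : (B.map (algebraMap K _)).mulVec
      (fun b => Ideal.Quotient.mk (Ideal.span {(X : K[X]) ^ h}) (F b)) =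
        Ideal.Quotient.mk (Ideal.span {(X : K[X]) ^ h}) g •
          fun b => Ideal.Quotient.mk (Ideal.span {(X : K[X]) ^ h}) (F b)) {e : ℕ} (he : e < h) :
    (B - aeval A g).mulVec (fun b => (F b).coeff e) = 0 := by
  have h1 := aeval_mulVec hA g
  rw [aeval_mk_X, ← hB] at h1
  have h2 : ((B - aeval A g).map (algebraMap K _)).mulVec
      (fun b => Ideal.Quotient.mk (Ideal.span {(X : K[X]) ^ h}) (F b)) = 0 := by
    rw [Matrix.map_sub _ (map_sub _), Matrix.sub_mulVec, h1, sub_self]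
  funext a
  have h3 : Ideal.Quotient.mk (Ideal.span {(X : K[X]) ^ h}) (∑ b, C ((B - aeval A g) a b) * F b) =
      0 := by
    rw [map_sum]
    refine Eq.trans ?_ (congrFun h2 a)
    simp only [map_mul]
    rfl
  rw [Ideal.Quotient.eq_zero_iff_mem, Ideal.mem_span_singleton, X_pow_dvd_iff] at h3
  have h4 := h3 e he
  simp only [finsetSum_coeff, coeff_C_mul] at h4
  exact h4

end Truncate

/-! ### Pairing kernel and cokernel vectors -/

section Pairing

/-- The determinant of `1 - symbol` for the leading symbol. -/
noncomputable def symbolDet {R : Type*} [CommRing R] {t : ℕ} (s : ℕ) (w : Fin t → ℕ) (L : ℕ)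
    (a : Fin t → Fin t → ℕ → R) (z : R) : R :=
  (1 - symbol s w L a 0 z).det

/-- The pairing between kernel vectors and cokernel vectors of complementary weights. -/
noncomputable def pairing {R : Type*} [CommRing R] {t : ℕ} (u : Fin t → ℕ) (s : ℕ) (w : Fin t → ℕ)
    (L : ℕ) (p q : Fin t) (e : ℕ) (a : Fin t → Fin t → ℕ → R) (z : R) : R :=
  ∑ b : Σ i : Fin t, Fin (u i), if wt s w b = e then
    (1 - symbol s w L a 0 z).adjugate q b.1 * (1 - symbol s w L a 0 z).adjugate b.1 p else 0

variable {R R' : Type*} [CommRing R] [CommRing R']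

theorem one_sub_symbol_map (φ : R →+* R') {t : ℕ} (s : ℕ) (w : Fin t → ℕ) (L : ℕ)
    (a : Fin t → Fin t → ℕ → R) (x z : R) :
    φ.mapMatrix (1 - symbol s w L a x z) =
      1 - symbol s w L (fun j i l => φ (a j i l)) (φ x) (φ z) := by
  rw [map_sub, map_one, RingHom.mapMatrix_apply, symbol_map]

theorem symbolDet_map (φ : R →+* R') {t : ℕ} (s : ℕ) (w : Fin t → ℕ) (L : ℕ)
    (a : Fin t → Fin t → ℕ → R) (z : R) :
    φ (symbolDet s w L a z) = symbolDet s w L (fun j i l => φ (a j i l)) (φ z) := by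
  rw [symbolDet, RingHom.map_det, one_sub_symbol_map, map_zero, symbolDet]

theorem pairing_map (φ : R →+* R') {t : ℕ} (u : Fin t → ℕ) (s : ℕ) (w : Fin t → ℕ) (L : ℕ)
    (p q : Fin t) (e : ℕ) (a : Fin t → Fin t → ℕ → R) (z : R) :
    φ (pairing u s w L p q e a z) = pairing u s w L p q e (fun j i l => φ (a j i l)) (φ z) := by
  have h : ∀ i j, φ ((1 - symbol s w L a 0 z).adjugate i j) =
      (1 - symbol s w L (fun j i l => φ (a j i l)) 0 (φ z)).adjugate i j := fun i j => by
    have h1 := one_sub_symbol_map φ s w L a 0 z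
    rw [map_zero] at h1
    rw [← h1, ← RingHom.map_adjugate]
    rfl
  simp only [pairing, map_sum, apply_ite φ, map_mul, map_zero, h]

/-- Modulo a power of `X` dividing det(1 - N), every row and column of the adjugate of 1 - N is
fixed by N. Row `q` and column `p` therefore give a left eigenvector `F` modulo `X ^ (c + s)` and a
right eigenvector `G` modulo `X ^ (M - c + 1)`. The matrices `D₂` and `D₁` collect their
coefficients in the complementary degrees `c + k` and `M - (c + k)` for `k < s`. -/
theorem exists_pairing {K : Type*} [Field K] {t : ℕ} {u : Fin t → ℕ} {L s : ℕ} {w : Fin t → ℕ}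
    {a : Fin t → Fin t → ℕ → K} (ha : IsCoeff u L a) (hw : IsWeight u s w) (hs : 0 < s) {c M U : ℕ}
    (hc1 : ∀ i, w i < c + s) (hc2 : ∀ i, c + s ≤ w i + s * u i)
    (hM : ∀ i, w i + s * u i ≤ M + s) (hMc : c + s ≤ M + 1) (hU : ∀ i, u i ≤ U) (p q : Fin t)
    {z : K[X]} (hz : X ^ (M + s + 1) ∣ (1 - symbol s w L (fun j i l => C (a j i l)) X z).det)
    (hz0 : z.eval 0 ≠ 0) (hd : ∀ k < s, pairing u s w L p q (c + k) a (z.eval 0) ≠ 0) :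
    ∃ (D₁ : Matrix (Σ i : Fin t, Fin (u i)) (Fin s) K)
      (D₂ : Matrix (Fin s) (Σ i : Fin t, Fin (u i)) K),
      (shiftMatrix K u - aeval (toep u a) (X ^ s * z)) * D₁ = 0 ∧
      D₂ * (shiftMatrix K u - aeval (toep u a) (X ^ s * z)) = 0 ∧ (D₂ * D₁).det ≠ 0 := by
  set N := symbol s w L (fun j i l => C (a j i l)) X z with hN
  let ν : Fin t → K[X] := fun i => (1 - N).adjugate q i
  let m : Fin t → K[X] := fun i => (1 - N).adjugate i p
  let F : (Σ i : Fin t, Fin (u i)) → K[X] := fun b => X ^ wt s w b * z ^ (b.2 : ℕ) * ν b.1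
  let G : (Σ i : Fin t, Fin (u i)) → K[X] := fun b => X ^ (M - wt s w b) * z ^ (U - b.2) * m b.1
  have hdvd : ∀ h ≤ M + s + 1, ∀ i j, Ideal.Quotient.mk (Ideal.span {(X : K[X]) ^ h})
      (((1 - N).det • (1 : Matrix (Fin t) (Fin t) K[X])) i j) = 0 := by
    intro h hh i j
    rw [Ideal.Quotient.eq_zero_iff_mem, Ideal.mem_span_singleton, Matrix.smul_apply, smul_eq_mul]
    exact ((pow_dvd_pow X hh).trans hz).mul_right _
  have hNR : ∀ h, N.map (Ideal.Quotient.mk (Ideal.span {(X : K[X]) ^ h})) =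
      symbol s w L (fun j i l => algebraMap K _ (a j i l)) (Ideal.Quotient.mk _ X)
        (Ideal.Quotient.mk _ z) := fun h => by
    rw [hN, symbol_map]
    rfl
  have hx : ∀ h, (Ideal.Quotient.mk (Ideal.span {(X : K[X]) ^ h}) X) ^ h = 0 := fun h => by
    rw [← map_pow, Ideal.Quotient.eq_zero_iff_mem]
    exact Ideal.mem_span_singleton_self _
  have haR : ∀ h, IsCoeff u L fun j i l => algebraMap K (K[X] ⧸ Ideal.span {(X : K[X]) ^ h})
      (a j i l) := fun h =>
    ⟨fun j i l h1 => ha.le_of_ne j i l fun h2 => h1 (by rw [h2, map_zero]),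
      fun j i h1 => ha.lt_of_ne j i fun h2 => h1 (by rw [h2, map_zero]),
      fun j i l h1 => by rw [ha.eq_zero j i l h1, map_zero]⟩
  have hν : ∀ h ≤ M + s + 1, Matrix.vecMul
      (fun i => Ideal.Quotient.mk (Ideal.span {(X : K[X]) ^ h}) (ν i))
      (N.map (Ideal.Quotient.mk (Ideal.span {(X : K[X]) ^ h}))) =
      fun i => Ideal.Quotient.mk (Ideal.span {(X : K[X]) ^ h}) (ν i) := by
    intro h hh
    funext i
    have h1 := hdvd h hh q i
    rw [← Matrix.adjugate_mul, Matrix.mul_sub, mul_one, Matrix.sub_apply, map_sub, sub_eq_zero]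
      at h1
    refine Eq.trans ?_ h1.symm
    rw [Matrix.mul_apply, map_sum]
    simp only [map_mul]
    rfl
  have hm : ∀ h ≤ M + s + 1, (N.map (Ideal.Quotient.mk (Ideal.span {(X : K[X]) ^ h}))).mulVec
      (fun i => Ideal.Quotient.mk (Ideal.span {(X : K[X]) ^ h}) (m i)) =
      fun i => Ideal.Quotient.mk (Ideal.span {(X : K[X]) ^ h}) (m i) := by
    intro h hh
    funext i
    have h1 := hdvd h hh i p
    rw [← Matrix.mul_adjugate, Matrix.sub_mul, one_mul, Matrix.sub_apply, map_sub, sub_eq_zero]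
      at h1
    refine Eq.trans ?_ h1.symm
    rw [Matrix.mul_apply, map_sum]
    simp only [map_mul]
    rfl
  have hF : ∀ e < c + s, Matrix.vecMul (fun b => (F b).coeff e)
      (shiftMatrix K u - aeval (toep u a) (X ^ s * z)) = 0 := by
    intro e he
    have h1 := hν (c + s) (by omega)
    rw [hNR] at h1
    have hA := vecMul_toep_of_symbol (haR (c + s)) hw (hx (c + s)) hc2 h1
    have hB := vecMul_shiftMatrix (z := Ideal.Quotient.mk _ z) (hx (c + s)) hc2
      (fun i => Ideal.Quotient.mk (Ideal.span {(X : K[X]) ^ (c + s)}) (ν i))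
    refine coeff_vecMul_sub_aeval (h := c + s) (F := F) ?_ ?_ he
    · rw [toep_map]
      simpa only [F, map_mul, map_pow] using hA
    · rw [shiftMatrix_map]
      simpa only [F, map_mul, map_pow] using hB
  have hG : ∀ e < M - c + 1, (shiftMatrix K u - aeval (toep u a) (X ^ s * z)).mulVec
      (fun b => (G b).coeff e) = 0 := by
    intro e he
    have h1 := hm (M - c + 1) (by omega)
    rw [hNR] at h1
    have hh : ∀ i, M - c + 1 + w i ≤ M + s := fun i => by
      have := hc1 i
      omega
    have hA := toep_mulVec_of_symbol (haR (M - c + 1)) hw (hx (M - c + 1)) hh hM hU h1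
    have hB := shiftMatrix_mulVec (z := Ideal.Quotient.mk _ z) (hx (M - c + 1)) hh hM hU
      (fun i => Ideal.Quotient.mk (Ideal.span {(X : K[X]) ^ (M - c + 1)}) (m i))
    refine coeff_sub_aeval_mulVec (h := M - c + 1) (F := G) ?_ ?_ he
    · rw [toep_map]
      simpa only [G, map_mul, map_pow] using hA
    · rw [shiftMatrix_map]
      simpa only [G, map_mul, map_pow] using hB
  have hwM : ∀ b : Σ i : Fin t, Fin (u i), wt s w b ≤ M := by
    rintro ⟨i, l⟩
    have h1 := hM i
    have h2 := Nat.mul_le_mul_left s (Nat.succ_le_of_lt l.2)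
    rw [Nat.mul_succ] at h2
    simp only [wt]
    omega
  refine ⟨Matrix.of fun b k => (G b).coeff (M - (c + k)), Matrix.of fun k b => (F b).coeff (c + k),
    ?_, ?_, ?_⟩
  · ext b k
    exact congrFun (hG (M - (c + k)) (by omega)) b
  · ext k b
    exact congrFun (hF (c + k) (by omega)) b
  · have hcoefF : ∀ b e, e < wt s w b → (F b).coeff e = 0 := by
      intro b e he
      simp only [F, mul_assoc]
      rw [coeff_X_pow_mul', if_neg (by omega)]
    have hcoefG : ∀ b e, e < M - wt s w b → (G b).coeff e = 0 := by
      intro b e he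
      simp only [G, mul_assoc]
      rw [coeff_X_pow_mul', if_neg (by omega)]
    -- `F b` starts in degree `wt s w b` and `G b` in degree `M - wt s w b`, so entry (k, k')
    -- involves only weights between `c + k'` and `c + k`. The matrix is triangular, and its
    -- diagonal entries are `z.eval 0 ^ U` times the pairings.
    rw [Matrix.det_of_isLowerTriangular]
    · rw [Finset.prod_ne_zero_iff]
      intro k _
      have h1 : (fun b : Σ i : Fin t, Fin (u i) => (F b).coeff (c + k) * (G b).coeff (M - (c + k))) =
          fun b => z.eval 0 ^ U * if wt s w b = c + k then
            (1 - symbol s w L a 0 (z.eval 0)).adjugate q b.1 *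
            (1 - symbol s w L a 0 (z.eval 0)).adjugate b.1 p else 0 := by
        have hadj : ∀ i j, ((1 - N).adjugate i j).eval 0 =
            (1 - symbol s w L a 0 (z.eval 0)).adjugate i j := by
          intro i j
          have h2 := one_sub_symbol_map (evalRingHom (0 : K)) s w L (fun j i l => C (a j i l)) X z
          simp only [coe_evalRingHom, eval_C, eval_X] at h2
          rw [← h2, ← RingHom.map_adjugate]
          rfl
        funext b
        rcases lt_trichotomy (wt s w b) (c + k) with h2 | h2 | h2
        · rw [if_neg h2.ne, hcoefG b _ (by omega), mul_zero, mul_zero]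
        · rw [if_pos h2, ← h2]
          simp only [F, G, mul_assoc]
          have h3 := coeff_X_pow_mul (z ^ (b.2 : ℕ) * ν b.1) (wt s w b) 0
          have h4 := coeff_X_pow_mul (z ^ (U - (b.2 : ℕ)) * m b.1) (M - wt s w b) 0
          rw [zero_add] at h3 h4
          rw [h3, h4, coeff_zero_eq_eval_zero, coeff_zero_eq_eval_zero, eval_mul, eval_mul,
            eval_pow, eval_pow]
          simp only [ν, m, hadj]
          have h5 : U = b.2 + (U - b.2) := by
            have h6 := hU b.1
            have h7 := b.2.2
            omega
          conv_rhs => rw [h5, pow_add]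
          ring
        · rw [if_neg h2.ne', hcoefF b _ h2, zero_mul, mul_zero]
      have h2 : (Matrix.of (fun (k : Fin s) b => (F b).coeff (c + k)) *
          Matrix.of (fun b (k : Fin s) => (G b).coeff (M - (c + k)))) k k =
          z.eval 0 ^ U * pairing u s w L p q (c + k) a (z.eval 0) := by
        rw [pairing, Finset.mul_sum, ← h1]
        rfl
      rw [h2]
      exact mul_ne_zero (pow_ne_zero _ hz0) (hd k k.2)
    · intro k k' hkk
      have hkk' : (k : ℕ) < k' := hkk
      refine Finset.sum_eq_zero fun b _ => ?_
      simp only [Matrix.of_apply]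
      by_cases h1 : c + k < wt s w b
      · rw [hcoefF b _ h1, zero_mul]
      · have := k'.2
        rw [hcoefG b _ (by omega), mul_zero]

end Pairing

/-! ### The cyclic endomorphism of a full window -/

/-- The coefficients of the endomorphism `e_f ↦ e_{f + 1} ↦ … ↦ e_g ↦ y e_f`, which sends the
remaining `e_i` to `0`. -/
def cyclicCoeffs (R : Type*) [Zero R] [One R] {t : ℕ} (f g : Fin t) : Fin t → Fin t → ℕ → R :=
  fun j i l => if (l = 0 ∧ f ≤ i ∧ i < g ∧ (j : ℕ) = i + 1) ∨ (l = 1 ∧ i = g ∧ j = f) then 1 else 0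

theorem map_cyclicCoeffs {R R' : Type*} [Semiring R] [Semiring R'] (φ : R →+* R') {t : ℕ}
    (f g : Fin t) (j i : Fin t) (l : ℕ) :
    φ (cyclicCoeffs R f g j i l) = cyclicCoeffs R' f g j i l := by
  simp only [cyclicCoeffs]
  split_ifs <;> simp

section Cyclic

variable {R : Type*} [CommRing R] {t : ℕ} {u : Fin t → ℕ} {f g : Fin t} {s L : ℕ} {w : Fin t → ℕ}

theorem isCoeff_cyclicCoeffs (hu : Antitone u) (hfg : u f ≤ u g + 1) (hL : 2 ≤ L) :
    IsCoeff u L (cyclicCoeffs R f g) := by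
  refine ⟨fun j i l h => ?_, fun j i h => ?_, fun j i l h => ?_⟩
  · simp only [cyclicCoeffs, ne_eq, ite_eq_right_iff, not_forall] at h
    obtain ⟨h, -⟩ := h
    rcases h with ⟨h1, -, -, h4⟩ | ⟨h1, h2, h3⟩
    · rw [h1]
      exact hu (Fin.le_def.2 (by omega))
    · rw [h1, h2, h3]
      exact hfg
  · simp only [cyclicCoeffs, ne_eq, ite_eq_right_iff, not_forall] at h
    obtain ⟨h, -⟩ := h
    rcases h with ⟨-, -, -, h4⟩ | ⟨h1, -⟩
    · exact Fin.lt_def.2 (by omega)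
    · omega
  · simp only [cyclicCoeffs]
    rw [if_neg (by omega)]

/-- On consecutive weights every arrow of the cycle raises weight by exactly one, including the
last, from `w g` to `w f + s`. All exponents of `x` are therefore zero and nothing is lost at `x =
0`. -/
theorem symbol_cyclicCoeffs (hL : 2 ≤ L) (hfg : f ≤ g) (hs : (g : ℕ) + 1 = f + s)
    (hw : ∀ i j, f ≤ i → i ≤ g → f ≤ j → j ≤ g → w i + j = w j + i) (z : R) :
    symbol s w L (cyclicCoeffs R f g) 0 z = Matrix.of fun j i : Fin t =>
      (if f ≤ i ∧ i < g ∧ (j : ℕ) = i + 1 then 1 else 0) + if i = g ∧ j = f then z else 0 := by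
  obtain ⟨L, rfl⟩ := Nat.exists_eq_add_of_le' hL
  ext j i
  simp only [symbol, Matrix.of_apply]
  rw [Finset.sum_range_succ', Finset.sum_range_succ', Finset.sum_eq_zero, zero_add, add_comm]
  · congr 1
    · simp only [cyclicCoeffs, pow_zero, mul_one, mul_zero, add_zero, zero_ne_one, true_and,
        false_and, or_false]
      split_ifs with h
      · obtain ⟨h1, h2, h3⟩ := h
        have h4 := hw i j h1 h2.le (Fin.le_def.2 (by rw [Fin.le_def] at h1; omega))
          (Fin.le_def.2 (by rw [Fin.lt_def] at h2; omega))
        have h5 : w j - w i - 1 = 0 := by omega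
        rw [h5, pow_zero, mul_one]
      · simp
    · simp only [cyclicCoeffs, zero_add, one_ne_zero, false_and, true_and, false_or, pow_one,
        mul_one]
      split_ifs with h
      · obtain ⟨rfl, rfl⟩ := h
        have h4 := hw i j hfg le_rfl le_rfl hfg
        have h5 : w j + s - w i - 1 = 0 := by omega
        rw [h5, pow_zero, mul_one, one_mul]
      · simp
  · intro l _
    simp only [cyclicCoeffs]
    rw [if_neg (by omega), zero_mul, zero_mul]

/-- At `z = 1` the cycle fixes the indicator of [f, g]; for general `z` the only defect is where the
cycle closes. -/
theorem one_sub_symbol_mulVec (hL : 2 ≤ L) (hfg : f ≤ g) (hs : (g : ℕ) + 1 = f + s)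
    (hw : ∀ i j, f ≤ i → i ≤ g → f ≤ j → j ≤ g → w i + j = w j + i) (z : R) :
    (1 - symbol s w L (cyclicCoeffs R f g) 0 z).mulVec
      (fun i => if f ≤ i ∧ i ≤ g then 1 else 0) = Pi.single f (1 - z) := by
  rw [symbol_cyclicCoeffs hL hfg hs hw, Matrix.sub_mulVec, Matrix.one_mulVec]
  funext j
  simp only [Pi.sub_apply, Matrix.mulVec, dotProduct, Matrix.of_apply, add_mul,
    Finset.sum_add_distrib]
  have h2 : ∑ i, (if i = g ∧ j = f then z else 0) * (if f ≤ i ∧ i ≤ g then 1 else 0) =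
      if j = f then z else 0 := by
    rw [Finset.sum_eq_single g]
    · simp [hfg]
    · intro i _ hi
      simp [hi]
    · simp
  have h1 : ∑ i : Fin t, (if f ≤ i ∧ i < g ∧ (j : ℕ) = i + 1 then (1 : R) else 0) *
      (if f ≤ i ∧ i ≤ g then 1 else 0) = if f < j ∧ j ≤ g then 1 else 0 := by
    by_cases hj : f < j ∧ j ≤ g
    · have h3 := Fin.lt_def.1 hj.1
      have h4 := Fin.le_def.1 hj.2
      rw [if_pos hj, Finset.sum_eq_single ⟨j - 1, by omega⟩]
      · rw [if_pos ⟨Fin.le_def.2 (by simp only; omega), Fin.lt_def.2 (by simp only; omega),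
          by simp only; omega⟩, if_pos ⟨Fin.le_def.2 (by simp only; omega),
          Fin.le_def.2 (by simp only; omega)⟩, mul_one]
      · intro i _ hi
        rw [if_neg, zero_mul]
        rintro ⟨-, -, h5⟩
        exact hi (Fin.ext (by simp only; omega))
      · simp
    · rw [if_neg hj]
      refine Finset.sum_eq_zero fun i _ => ?_
      rw [if_neg, zero_mul]
      rintro ⟨h3, h4, h5⟩
      rw [Fin.le_def] at h3
      rw [Fin.lt_def] at h4
      exact hj ⟨Fin.lt_def.2 (by omega), Fin.le_def.2 (by omega)⟩
  rw [h1, h2]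
  rcases eq_or_ne j f with rfl | hj
  · simp [hfg]
  · have : f < j ↔ f ≤ j := ⟨le_of_lt, fun h => lt_of_le_of_ne h hj.symm⟩
    simp [hj, this]

theorem vecMul_one_sub_symbol (hL : 2 ≤ L) (hfg : f ≤ g) (hs : (g : ℕ) + 1 = f + s)
    (hw : ∀ i j, f ≤ i → i ≤ g → f ≤ j → j ≤ g → w i + j = w j + i) (z : R) :
    Matrix.vecMul (fun i => if f ≤ i ∧ i ≤ g then 1 else 0)
      (1 - symbol s w L (cyclicCoeffs R f g) 0 z) = Pi.single g (1 - z) := by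
  rw [symbol_cyclicCoeffs hL hfg hs hw, Matrix.vecMul_sub, Matrix.vecMul_one]
  funext i
  simp only [Pi.sub_apply, Matrix.vecMul, dotProduct, Matrix.of_apply, mul_add,
    Finset.sum_add_distrib]
  have h2 : ∑ j, (if f ≤ j ∧ j ≤ g then 1 else 0) * (if i = g ∧ j = f then z else 0) =
      if i = g then z else 0 := by
    rw [Finset.sum_eq_single f]
    · simp [hfg]
    · intro j _ hj
      simp [hj]
    · simp
  have h1 : ∑ j : Fin t, (if f ≤ j ∧ j ≤ g then 1 else 0) *
      (if f ≤ i ∧ i < g ∧ (j : ℕ) = i + 1 then (1 : R) else 0) =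
        if f ≤ i ∧ i < g then 1 else 0 := by
    by_cases hi : f ≤ i ∧ i < g
    · have h3 := Fin.le_def.1 hi.1
      have h4 := Fin.lt_def.1 hi.2
      rw [if_pos hi, Finset.sum_eq_single ⟨i + 1, by omega⟩]
      · rw [if_pos (c := f ≤ i ∧ i < g ∧ _) ⟨hi.1, hi.2, rfl⟩, if_pos
          ⟨Fin.le_def.2 (by simp only; omega), Fin.le_def.2 (by simp only; omega)⟩, mul_one]
      · intro j _ hj
        rw [if_neg (c := f ≤ i ∧ i < g ∧ (j : ℕ) = i + 1), mul_zero]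
        rintro ⟨-, -, h5⟩
        exact hj (Fin.ext h5)
      · simp
    · rw [if_neg hi]
      refine Finset.sum_eq_zero fun j _ => ?_
      rw [if_neg (c := f ≤ i ∧ i < g ∧ (j : ℕ) = i + 1), mul_zero]
      exact fun h => hi ⟨h.1, h.2.1⟩
  rw [h1, h2]
  rcases eq_or_ne i g with rfl | hi
  · simp [hfg]
  · have : i < g ↔ i ≤ g := ⟨le_of_lt, fun h => lt_of_le_of_ne h hi⟩
    simp [hi, this]

/-- At `z = 0` only the terms with `l = 0` survive, and these are strictly triangular. -/
theorem symbolDet_zero {a : Fin t → Fin t → ℕ → R} (ha : IsCoeff u L a) :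
    symbolDet s w L a 0 = 1 := by
  rw [symbolDet, Matrix.det_of_isLowerTriangular]
  · refine Finset.prod_eq_one fun i _ => ?_
    rw [Matrix.sub_apply, Matrix.one_apply_eq, sub_eq_self, symbol, Matrix.of_apply]
    refine Finset.sum_eq_zero fun l _ => ?_
    rcases Nat.eq_zero_or_pos l with rfl | hl
    · have : a i i 0 = 0 := by
        by_contra h
        exact lt_irrefl _ (ha.lt_of_ne i i h)
      rw [this, zero_mul, zero_mul]
    · rw [zero_pow hl.ne', mul_zero, zero_mul]
  · intro j i hji
    have hji' : j < i := hji
    rw [Matrix.sub_apply, Matrix.one_apply_ne hji'.ne, zero_sub, neg_eq_zero, symbol, Matrix.of_apply]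
    refine Finset.sum_eq_zero fun l _ => ?_
    rcases Nat.eq_zero_or_pos l with rfl | hl
    · have : a j i 0 = 0 := by
        by_contra h
        exact lt_asymm hji' (ha.lt_of_ne j i h)
      rw [this, zero_mul, zero_mul]
    · rw [zero_pow hl.ne', mul_zero, zero_mul]

/-- The closing arrow is a rank-one perturbation of the unipotent matrix at `z = 0`, so the matrix
determinant lemma applies. -/
theorem symbolDet_cyclicCoeffs (hu : Antitone u) (hfu : u f ≤ u g + 1) (hL : 2 ≤ L) (hfg : f ≤ g)
    (hs : (g : ℕ) + 1 = f + s)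
    (hw : ∀ i j, f ≤ i → i ≤ g → f ≤ j → j ≤ g → w i + j = w j + i) (z : R) :
    symbolDet s w L (cyclicCoeffs R f g) z = 1 - z := by
  have h0 := one_sub_symbol_mulVec hL hfg hs hw (0 : R)
  have hz : 1 - symbol s w L (cyclicCoeffs R f g) 0 z =
      (1 - symbol s w L (cyclicCoeffs R f g) 0 0) *
        (1 + Matrix.replicateCol Unit (fun i => if f ≤ i ∧ i ≤ g then (1 : R) else 0) *
          Matrix.replicateRow Unit (Pi.single g (-z))) := by
    rw [mul_add, mul_one, ← Matrix.mul_assoc, ← Matrix.replicateCol_mulVec, h0,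
      symbol_cyclicCoeffs hL hfg hs hw, symbol_cyclicCoeffs hL hfg hs hw]
    ext j i
    simp only [Matrix.sub_apply, Matrix.add_apply, Matrix.of_apply, Matrix.mul_apply,
      Matrix.replicateCol_apply, Matrix.replicateRow_apply, Finset.univ_unique,
      Finset.sum_singleton, sub_zero, ite_self, add_zero, Pi.single_apply]
    by_cases h1 : i = g <;> by_cases h2 : j = f <;> simp [h1, h2, sub_eq_add_neg]
  rw [symbolDet, hz, Matrix.det_mul, Matrix.det_one_add_replicateCol_mul_replicateRow]
  have h1 := symbolDet_zero (s := s) (w := w) (isCoeff_cyclicCoeffs (R := R) hu hfu hL)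
  rw [symbolDet] at h1
  rw [h1, one_mul, single_dotProduct]
  simp [hfg, sub_eq_add_neg]

/-- Cancelling 1 - z identifies row `g` and column `f` of the adjugate with the indicator of [f, g].
The head weights of these chains are `s` consecutive integers, one in each residue class modulo `s`,
so exactly one vector of weight `e` lies on them. -/
theorem pairing_cyclicCoeffs [IsDomain R] (hu : Antitone u) (hfu : u f ≤ u g + 1) (hL : 2 ≤ L)
    (hfg : f ≤ g) (hs : (g : ℕ) + 1 = f + s)
    (hw : ∀ i j, f ≤ i → i ≤ g → f ≤ j → j ≤ g → w i + j = w j + i) {z : R} (hz : 1 - z ≠ 0)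
    {c e : ℕ} (hc1 : ∀ i, w i < c + s) (hc2 : ∀ i, c + s ≤ w i + s * u i) (he : c ≤ e)
    (he' : e < c + s) : pairing u s w L f g e (cyclicCoeffs R f g) z = 1 := by
  have hdet := symbolDet_cyclicCoeffs hu hfu hL hfg hs hw z
  rw [symbolDet] at hdet
  have hrow : ∀ i, (1 - symbol s w L (cyclicCoeffs R f g) 0 z).adjugate g i =
      if f ≤ i ∧ i ≤ g then 1 else 0 := by
    intro i
    have h1 := congrArg (fun v => Matrix.vecMul v
      (1 - symbol s w L (cyclicCoeffs R f g) 0 z).adjugate) (vecMul_one_sub_symbol hL hfg hs hw z)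
    simp only [Matrix.vecMul_vecMul, Matrix.mul_adjugate, hdet] at h1
    have h2 := congrFun h1 i
    rw [Matrix.vecMul_smul, Matrix.vecMul_one, Matrix.single_vecMul] at h2
    exact (mul_left_cancel₀ hz h2).symm
  have hcol : ∀ i, (1 - symbol s w L (cyclicCoeffs R f g) 0 z).adjugate i f =
      if f ≤ i ∧ i ≤ g then 1 else 0 := by
    intro i
    have h1 := congrArg (fun v => Matrix.mulVec
      (1 - symbol s w L (cyclicCoeffs R f g) 0 z).adjugate v) (one_sub_symbol_mulVec hL hfg hs hw z)
    simp only [Matrix.mulVec_mulVec, Matrix.adjugate_mul, hdet] at h1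
    have h2 := congrFun h1 i
    rw [Matrix.smul_mulVec, Matrix.one_mulVec, Matrix.mulVec_single] at h2
    have h3 : (1 - z) * (if f ≤ i ∧ i ≤ g then 1 else 0) =
        (1 - symbol s w L (cyclicCoeffs R f g) 0 z).adjugate i f * (1 - z) := h2
    rw [mul_comm] at h3
    exact (mul_right_cancel₀ hz h3).symm
  have hs0 : 0 < s := by
    have := Fin.le_def.1 hfg
    omega
  obtain ⟨l, hl1, hl2⟩ : ∃ i : Fin t, (f ≤ i ∧ i ≤ g) ∧ w i % s = e % s := by
    -- The residue of `e - w f`, with `(s - 1) * w f` standing in for `-w f`.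
    let r := (e + (s - 1) * w f) % s
    have hr : r < s := Nat.mod_lt _ hs0
    have hgt := g.2
    refine ⟨⟨f + r, by omega⟩, ⟨Fin.le_def.2 (by simp), Fin.le_def.2 (by simp only; omega)⟩, ?_⟩
    have h1 := hw ⟨f + r, by omega⟩ f (Fin.le_def.2 (by simp)) (Fin.le_def.2 (by simp only; omega))
      le_rfl hfg
    have h2 : w ⟨f + r, by omega⟩ = w f + r := by
      simp only at h1
      omega
    rw [h2]
    have h3 : w f + (e + (s - 1) * w f) = e + s * w f := by
      obtain ⟨s', rfl⟩ := Nat.exists_eq_add_of_le' hs0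
      simp only [Nat.add_sub_cancel]
      ring
    simp only [r]
    rw [Nat.add_mod_mod, h3, Nat.add_mul_mod_self_left]
  obtain ⟨m, hm⟩ : ∃ m, w l + s * m = e := by
    have h1 : w l ≤ e := by
      by_contra h
      have h2 : (w l - e) % s = 0 := (Nat.sub_mod_eq_zero_of_mod_eq hl2)
      have h3 : w l - e < s := by
        have := hc1 l
        omega
      rw [Nat.mod_eq_of_lt h3] at h2
      omega
    obtain ⟨m, hm⟩ := Nat.dvd_of_mod_eq_zero (Nat.sub_mod_eq_zero_of_mod_eq hl2.symm)
    exact ⟨m, by omega⟩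
  have hmu : m < u l := by
    have := hc2 l
    exact Nat.lt_of_mul_lt_mul_left (a := s) (by omega)
  rw [pairing, Finset.sum_eq_single ⟨l, ⟨m, hmu⟩⟩]
  · refine (if_pos hm).trans ?_
    rw [hrow, hcol, if_pos hl1, mul_one]
  · rintro ⟨i, k⟩ _ hne
    by_cases hik : wt s w (⟨i, k⟩ : Σ i : Fin t, Fin (u i)) = e
    · rw [if_pos hik, hrow]
      rw [if_neg, zero_mul]
      intro (hi : f ≤ i ∧ i ≤ g)
      simp only [wt] at hik
      have h1 := hw i l hi.1 hi.2 hl1.1 hl1.2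
      have h2 : w i % s = w l % s := by
        rw [hl2, ← hik, Nat.add_mul_mod_self_left]
      have hil : i = l := by
        have a1 := Fin.le_def.1 hi.1
        have a2 := Fin.le_def.1 hi.2
        have a3 := Fin.le_def.1 hl1.1
        have a4 := Fin.le_def.1 hl1.2
        rcases le_total (w i) (w l) with h | h
        · have h3 := Nat.sub_mod_eq_zero_of_mod_eq h2.symm
          rw [Nat.mod_eq_of_lt (by omega)] at h3
          exact Fin.ext (by omega)
        · have h3 := Nat.sub_mod_eq_zero_of_mod_eq h2
          rw [Nat.mod_eq_of_lt (by omega)] at h3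
          exact Fin.ext (by omega)
      subst hil
      have h3 : (k : ℕ) = m := Nat.eq_of_mul_eq_mul_left hs0 (by omega)
      exact hne (by rw [Sigma.mk.injEq]; exact ⟨rfl, heq_of_eq (Fin.ext h3)⟩)
    · rw [if_neg hik]
  · simp

/-- Chains longer than `k` lie outside [f, g] and are killed by the cyclic endomorphism. On them the
perturbed matrix acts as the shift, and the minor is that of an identity matrix. -/
theorem chainMinor_cyclicCoeffs (hfg : f ≤ g) (hs0 : 0 < s) {k : ℕ}
    (hk : ∀ i, f ≤ i → i ≤ g → u i ≤ k) (z : R) :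
    chainMinor u s w k (cyclicCoeffs R f g) z = 1 := by
  set T := toep u (leadCoeffs s w (cyclicCoeffs R f g)) with hT
  have hT0 : ∀ x (i : Fin t) (l : Fin (u i)), k < u i → T x ⟨i, l⟩ = 0 := by
    rintro ⟨j, l'⟩ i l hi
    have hi' : ¬ (f ≤ i ∧ i ≤ g) := fun h => absurd (hk i h.1 h.2) (not_le.2 hi)
    simp only [hT, toep, Matrix.of_apply, leadCoeffs, cyclicCoeffs]
    rw [if_neg (c := (_ ∧ _ ∧ _ ∧ _) ∨ _)]
    · simp
    · rintro (⟨-, h1, h2, -⟩ | ⟨-, h1, -⟩)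
      · exact hi' ⟨h1, h2.le⟩
      · exact hi' ⟨h1 ▸ hfg, h1.le⟩
  have hTs : ∀ x (i : Fin t) (l : Fin (u i)), k < u i → (T ^ s) x ⟨i, l⟩ = 0 := by
    intro x i l hi
    obtain ⟨s, rfl⟩ := Nat.exists_eq_add_of_le' hs0
    rw [pow_succ]
    exact Finset.sum_eq_zero fun y _ => mul_eq_zero_of_right _ (hT0 y i l hi)
  have hpow : ∀ (m : ℕ) (x) (i : Fin t) (l : ℕ) (hl : l + m < u i), k < u i →
      ((shiftMatrix R u - z • T ^ s) ^ m) x ⟨i, ⟨l, by omega⟩⟩ =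
        if x = ⟨i, ⟨l + m, hl⟩⟩ then 1 else 0 := by
    intro m
    induction m with
    | zero => intro x i l hl _; simp [Matrix.one_apply]
    | succ m ih =>
      intro x i l hl hi
      rw [pow_succ, Matrix.mul_apply, Finset.sum_eq_single ⟨i, ⟨l + 1, by omega⟩⟩]
      · rw [ih x i (l + 1) (by omega) hi, Matrix.sub_apply, Matrix.smul_apply, hTs _ _ _ hi,
          smul_zero, sub_zero]
        have : l + 1 + m = l + (m + 1) := by ring
        simp only [shiftMatrix, Matrix.of_apply, and_self, if_true, mul_one, this]
      · rintro ⟨j, l'⟩ _ hne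
        rw [Matrix.sub_apply, Matrix.smul_apply, hTs _ _ _ hi, smul_zero, sub_zero]
        simp only [shiftMatrix, Matrix.of_apply]
        rw [if_neg, mul_zero]
        rintro ⟨h1, h2⟩
        subst h1
        exact hne (by rw [Sigma.mk.injEq]; exact ⟨rfl, heq_of_eq (Fin.ext h2)⟩)
      · simp
  rw [chainMinor, ← Matrix.det_one (n := Σ i : Fin t, Fin (u i - k))]
  congr 1
  ext ⟨j, l'⟩ ⟨i, l⟩
  have hl := l.2
  rw [Matrix.submatrix_apply, hpow k _ i l (by omega) (by omega), Matrix.one_apply]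
  refine if_congr ?_ rfl rfl
  constructor
  · intro h
    have hij : j = i := congrArg Sigma.fst h
    subst hij
    simp only [Sigma.mk.injEq, heq_eq_eq, true_and, Fin.mk.injEq, add_left_inj] at h
    rw [Fin.ext h]
  · intro h
    rw [Sigma.mk.injEq] at h
    obtain ⟨rfl, h⟩ := h
    rw [eq_of_heq h]

end Cyclic

/-! ### The degeneration in normal form -/

theorem IsWeight.add_const {t : ℕ} {u : Fin t → ℕ} {s : ℕ} {w : Fin t → ℕ} (hw : IsWeight u s w)
    (d : ℕ) : IsWeight u s fun i => w i + d := by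
  refine ⟨fun i j l h h0 => ?_, fun k => ?_, fun p hp i j hi hj => ?_⟩
  · have := hw.raise i j l h h0
    omega
  · obtain ⟨c, hc⟩ := hw.centre k
    refine ⟨c + d, fun i => ⟨fun h => ?_, fun h => ?_⟩⟩
    · have := (hc i).1 h
      push_cast
      constructor <;> linarith
    · have := (hc i).2 h
      push_cast
      constructor <;> linarith
  · have := hw.consecutive p hp i j hi hj
    omega

theorem IsCoeff.interpolate {R : Type*} [CommRing R] {t : ℕ} {u : Fin t → ℕ} {L : ℕ}
    {a a' : Fin t → Fin t → ℕ → R} (ha : IsCoeff u L a) (ha' : IsCoeff u L a') (x y : R) :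
    IsCoeff u L fun j i l => x * a j i l + y * a' j i l := by
  have h : ∀ j i l, x * a j i l + y * a' j i l ≠ 0 → a j i l ≠ 0 ∨ a' j i l ≠ 0 := by
    intro j i l hne
    by_contra hcon
    push Not at hcon
    exact hne (by rw [hcon.1, hcon.2, mul_zero, mul_zero, add_zero])
  refine ⟨fun j i l hne => ?_, fun j i hne => ?_, fun j i l hl => ?_⟩
  · exact (h j i l hne).elim (ha.le_of_ne j i l) (ha'.le_of_ne j i l)
  · exact (h j i 0 hne).elim (ha.lt_of_ne j i) (ha'.lt_of_ne j i)
  · simp only [ha.eq_zero j i l hl, ha'.eq_zero j i l hl, mul_zero, add_zero]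

theorem IsCoeff.map {R R' : Type*} [Semiring R] [Semiring R'] (φ : R →+* R') {t : ℕ}
    {u : Fin t → ℕ} {L : ℕ} {a : Fin t → Fin t → ℕ → R} (ha : IsCoeff u L a) :
    IsCoeff u L fun j i l => φ (a j i l) :=
  ⟨fun j i l h => ha.le_of_ne j i l fun h0 => h (by rw [h0, map_zero]),
    fun j i h => ha.lt_of_ne j i fun h0 => h (by rw [h0, map_zero]),
    fun j i l h => by rw [ha.eq_zero j i l h, map_zero]⟩

/-- The entries of `u` in a nonempty window form an interval. -/
theorem exists_window_eq_Icc {t : ℕ} {u : Fin t → ℕ} (hu : Antitone u) {p : ℕ}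
    (hp : 0 < window u p) : ∃ f g : Fin t, f ≤ g ∧ (g : ℕ) + 1 = f + window u p ∧
      ∀ i, (u i = p ∨ u i + 1 = p) ↔ f ≤ i ∧ i ≤ g := by
  set S := Finset.univ.filter fun i => u i = p ∨ u i + 1 = p with hS
  have hne : S.Nonempty := Finset.card_pos.1 hp
  have hf : u (S.min' hne) = p ∨ u (S.min' hne) + 1 = p :=
    (Finset.mem_filter.1 (S.min'_mem hne)).2
  have hg : u (S.max' hne) = p ∨ u (S.max' hne) + 1 = p :=
    (Finset.mem_filter.1 (S.max'_mem hne)).2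
  have hmem : ∀ i, (u i = p ∨ u i + 1 = p) ↔ S.min' hne ≤ i ∧ i ≤ S.max' hne := by
    intro i
    constructor
    · intro h
      have : i ∈ S := Finset.mem_filter.2 ⟨Finset.mem_univ _, h⟩
      exact ⟨S.min'_le i this, S.le_max' i this⟩
    · rintro ⟨h1, h2⟩
      have := hu h1
      have := hu h2
      omega
  have hle : S.min' hne ≤ S.max' hne := S.min'_le_max' hne
  refine ⟨S.min' hne, S.max' hne, hle, ?_, hmem⟩
  have h1 : S = Finset.Icc (S.min' hne) (S.max' hne) := by
    ext i
    rw [Finset.mem_Icc, ← hmem, hS, Finset.mem_filter]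
    simp
  have h2 : window u p = (Finset.Icc (S.min' hne) (S.max' hne)).card := by rw [← h1, window]
  rw [h2, Fin.card_Icc]
  have := Fin.le_def.1 hle
  omega

/-- The endomorphism `a₁` is fixed before `h`, because the `h` used later depends on the line
joining `a₁` to `a`. All other requirements on (τ, z) are nonvanishing conditions valid at (0, 1).
-/
theorem exists_degeneration_toep {K : Type*} [Field K] [IsAlgClosed K] {t : ℕ} {u : Fin t → ℕ}
    (hu : Antitone u) (hpos : ∀ i, 0 < u i) {L : ℕ} (hL : 2 ≤ L) {a : Fin t → Fin t → ℕ → K}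
    (ha : IsCoeff u L a) {i₁ : Fin t} (hmax : window u (u i₁) = maxAlmostEqual u) :
    ∃ a₁ : Fin t → Fin t → ℕ → K, IsCoeff u L a₁ ∧ ∀ h : K[X], h ≠ 0 → ∃ τ : K, h.eval τ ≠ 0 ∧
      ∃ g : K[X], X ∣ g ∧ ∃ T, T = toep u (fun j i l => (1 - τ) * a₁ j i l + τ * a j i l) ∧
        (∀ k, ((shiftMatrix K u - aeval T g) ^ k).rank ≤ tailSum u k) ∧
        (∀ k, u i₁ ≤ k → tailSum u k ≤ ((shiftMatrix K u - aeval T g) ^ k).rank) ∧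
        ∃ (D₁ : Matrix (Σ i : Fin t, Fin (u i)) (Fin (maxAlmostEqual u)) K)
          (D₂ : Matrix (Fin (maxAlmostEqual u)) (Σ i : Fin t, Fin (u i)) K),
          (shiftMatrix K u - aeval T g) * D₁ = 0 ∧ D₂ * (shiftMatrix K u - aeval T g) = 0 ∧
          (D₂ * D₁).det ≠ 0 := by
  set s := maxAlmostEqual u with hs
  have hwin : 0 < window u (u i₁) :=
    Finset.card_pos.2 ⟨i₁, Finset.mem_filter.2 ⟨Finset.mem_univ _, Or.inl rfl⟩⟩
  have hs0 : 0 < s := hmax ▸ hwin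
  obtain ⟨p, hp⟩ := Nat.exists_eq_add_of_le' (hpos i₁)
  obtain ⟨f, g, hfg, hgs, hS⟩ := exists_window_eq_Icc hu hwin
  rw [hmax] at hgs
  obtain ⟨w₀, hw₀⟩ := exists_isWeight hu fun p => window_le u p
  -- Translating by `s` makes the start `c'` of the centred interval nonnegative.
  have hw := hw₀.add_const s
  set w : Fin t → ℕ := fun i => w₀ i + s with hwdef
  have hcons : ∀ i j, f ≤ i → i ≤ g → f ≤ j → j ≤ g → w i + j = w j + i := by
    intro i j h1 h2 h3 h4
    have hi := (hS i).2 ⟨h1, h2⟩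
    have hj := (hS j).2 ⟨h3, h4⟩
    exact hw.consecutive p (by rw [← hp]; exact hmax) i j (by omega) (by omega)
  have hfu : u f ≤ u g + 1 := by
    have h1 := (hS f).2 ⟨le_rfl, hfg⟩
    have h2 := (hS g).2 ⟨hfg, le_rfl⟩
    omega
  -- For `k = 1` the interval has length `s` and meets each chain exactly once; its `s` weights will
  -- index the kernel vectors.
  obtain ⟨c', hc'⟩ := hw.centre 1
  have hc0 : 0 ≤ c' := by
    have := ((hc' i₁).1 (hpos i₁)).1
    simp only [w] at this
    push_cast at this
    omega
  obtain ⟨c, rfl⟩ := Int.eq_ofNat_of_zero_le hc0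
  have hc1 : ∀ i, w i < c + s := fun i => by
    have := ((hc' i).1 (hpos i)).1
    exact_mod_cast this
  have hc2 : ∀ i, c + s ≤ w i + s * u i := fun i => by
    have := ((hc' i).1 (hpos i)).2
    rw [Nat.cast_one, mul_one] at this
    exact_mod_cast this
  have hU : ∀ i, u i ≤ ∑ i, u i := fun i =>
    Finset.single_le_sum (fun _ _ => Nat.zero_le _) (Finset.mem_univ i)
  have hM : ∀ i, w i + s * u i ≤ (∑ i, (w i + s * u i) + c + s) + s := fun i => by
    have := Finset.single_le_sum (f := fun i => w i + s * u i) (fun _ _ => Nat.zero_le _)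
      (Finset.mem_univ i)
    omega
  have ha₁ : IsCoeff u L (cyclicCoeffs K f g) := isCoeff_cyclicCoeffs hu hfu hL
  refine ⟨cyclicCoeffs K f g, ha₁, fun h hh => ?_⟩
  let aτ : K → Fin t → Fin t → ℕ → K := fun τ j i l =>
    (1 - τ) * cyclicCoeffs K f g j i l + τ * a j i l
  let aX : Fin t → Fin t → ℕ → K[X] := fun j i l =>
    (1 - X) * C (cyclicCoeffs K f g j i l) + X * C (a j i l)
  have haX : IsCoeff u L aX := (ha₁.map C).interpolate (ha.map C) _ _
  have haτ : ∀ τ, IsCoeff u L (aτ τ) := fun τ => ha₁.interpolate ha _ _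
  have hev : ∀ τ j i l, (aX j i l).eval τ = aτ τ j i l := fun τ j i l => by
    simp only [aX, aτ, eval_add, eval_mul, eval_sub, eval_one, eval_X, eval_C]
  have hevv : ∀ τ z, (fun j i l => evalEvalRingHom τ z (C (aX j i l))) = aτ τ := fun τ z => by
    funext j i l
    rw [← hev]
    simp
  have hevX : ∀ τ z : K, evalEvalRingHom τ z X = z := fun τ z => by simp
  have haτ0 : aτ 0 = cyclicCoeffs K f g := by
    funext j i l
    simp [aτ]
  let Q : K[X][X] := symbolDet s w L (fun j i l => C (aX j i l)) X
  let P : ℕ → K[X][X] := fun k => pairing u s w L f g (c + k) (fun j i l => C (aX j i l)) X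
  let N : ℕ → K[X][X] := fun k => chainMinor u s w k (fun j i l => C (aX j i l)) X
  have hQev : ∀ τ z, Q.evalEval τ z = symbolDet s w L (aτ τ) z := fun τ z => by
    have := symbolDet_map (evalEvalRingHom τ z) s w L (fun j i l => C (aX j i l)) X
    rw [hevv, hevX] at this
    exact this
  have hPev : ∀ k τ z, (P k).evalEval τ z = pairing u s w L f g (c + k) (aτ τ) z := fun k τ z => by
    have := pairing_map (evalEvalRingHom τ z) u s w L f g (c + k) (fun j i l => C (aX j i l)) X
    rw [hevv, hevX] at this
    exact this
  have hNev : ∀ k τ z, (N k).evalEval τ z = chainMinor u s w k (aτ τ) z := fun k τ z => by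
    have := chainMinor_map (evalEvalRingHom τ z) u s w k (fun j i l => C (aX j i l)) X
    rw [hevv, hevX] at this
    exact this
  have hQmap : ∀ τ, Q.map (evalRingHom τ) = symbolDet s w L (fun j i l => C (aτ τ j i l)) X :=
    fun τ => by
      have := symbolDet_map (mapRingHom (evalRingHom τ)) s w L (fun j i l => C (aX j i l)) X
      simp only [coe_mapRingHom, map_C, map_X, coe_evalRingHom, hev] at this
      exact this
  have hQ1 : Q.evalEval 0 1 = 0 := by
    rw [hQev, haτ0, symbolDet_cyclicCoeffs hu hfu hL hfg hgs hcons, sub_self]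
  have hQ0 : Q.eval 0 = 1 := by
    have h1 := symbolDet_map (evalRingHom (0 : K[X])) s w L (fun j i l => C (aX j i l)) X
    simp only [coe_evalRingHom, eval_C, eval_X] at h1
    rw [symbolDet_zero haX] at h1
    exact h1
  have hderiv : Q.derivative.evalEval 0 1 ≠ 0 := by
    rw [← map_evalRingHom_eval, ← derivative_map, hQmap, haτ0]
    have h1 : (fun j i l => C (cyclicCoeffs K f g j i l)) = cyclicCoeffs K[X] f g := by
      funext j i l
      exact map_cyclicCoeffs C f g j i l
    rw [h1, symbolDet_cyclicCoeffs hu hfu hL hfg hgs hcons]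
    simp
  have hP1 : ∀ k < s, (P k).evalEval 0 1 = 1 := fun k hk => by
    -- At `z = 1` the factor 1 - z cannot be cancelled, so the pairing is computed for an
    -- indeterminate and then specialised.
    have h1 := pairing_map (evalRingHom (1 : K)) u s w L f g (c + k) (cyclicCoeffs K[X] f g) X
    have h2 : (1 : K[X]) - X ≠ 0 := fun h => by
      have := congrArg (eval 0) h
      simp at this
    rw [pairing_cyclicCoeffs hu hfu hL hfg hgs hcons h2 hc1 hc2 (by omega) (by omega), map_one]
      at h1
    simp only [map_cyclicCoeffs, coe_evalRingHom, eval_X] at h1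
    rw [hPev, haτ0]
    exact h1.symm
  have hN1 : ∀ k, u i₁ ≤ k → (N k).evalEval 0 1 = 1 := fun k hk => by
    rw [hNev, haτ0]
    refine chainMinor_cyclicCoeffs hfg hs0 (fun i h1 h2 => ?_) 1
    have := (hS i).2 ⟨h1, h2⟩
    omega
  -- The factors ensure, in order: z ≠ 0, a simple root for Newton's method, the `s` nonzero
  -- pairings, and the ranks of the k-th powers. Beyond `∑ i, u i` the bound on ranks is trivial.
  let D : K[X][X] := X * Q.derivative * (∏ k ∈ Finset.range s, P k) *
    ∏ k ∈ Finset.Icc (u i₁) (∑ i, u i), N k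
  have hDev : ∀ τ z, D.evalEval τ z = z * Q.derivative.evalEval τ z *
      (∏ k ∈ Finset.range s, (P k).evalEval τ z) *
      ∏ k ∈ Finset.Icc (u i₁) (∑ i, u i), (N k).evalEval τ z := fun τ z => by
    change evalEvalRingHom τ z D = _
    simp only [D, map_mul, map_prod, hevX]
    rfl
  have hD : D.evalEval 0 1 ≠ 0 := by
    rw [hDev, Finset.prod_eq_one fun k hk => hP1 k (Finset.mem_range.1 hk),
      Finset.prod_eq_one fun k hk => hN1 k (Finset.mem_Icc.1 hk).1]
    simpa using hderiv
  obtain ⟨τ, z₀, hQz, hDz, hhτ⟩ := exists_evalEval_eq_zero_ne_zero hQ1 hQ0 hD hh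
  rw [hDev] at hDz
  have hN2 := right_ne_zero_of_mul hDz
  have hP2 := right_ne_zero_of_mul (left_ne_zero_of_mul hDz)
  have hQ2 := right_ne_zero_of_mul (left_ne_zero_of_mul (left_ne_zero_of_mul hDz))
  have hz0 := left_ne_zero_of_mul (left_ne_zero_of_mul (left_ne_zero_of_mul hDz))
  rw [Finset.prod_ne_zero_iff] at hN2 hP2
  -- For the chosen τ, the full equation for `z` over the coefficient ring K[x]; at x = 0 it is the
  -- fibre of the curve `Q` above τ.
  let q : K[X][X] := (1 - symbol s w L (fun j i l => C (C (aτ τ j i l))) (C X) X).det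
  have hqmap : q.map (evalRingHom 0) = Q.map (evalRingHom τ) := by
    rw [hQmap, symbolDet]
    have := one_sub_symbol_map (mapRingHom (evalRingHom (0 : K))) s w L
      (fun j i l => C (C (aτ τ j i l))) (C X) X
    simp only [coe_mapRingHom, map_C, map_X, coe_evalRingHom, eval_C, eval_X, map_zero] at this
    rw [← this, ← RingHom.map_det]
    rfl
  have hqev : ∀ z : K[X], q.eval z =
      (1 - symbol s w L (fun j i l => C (aτ τ j i l)) X z).det := fun z => by
    have := one_sub_symbol_map (evalRingHom z) s w L (fun j i l => C (C (aτ τ j i l))) (C X) X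
    simp only [coe_evalRingHom, eval_C, eval_X] at this
    rw [← this, ← RingHom.map_det]
    rfl
  obtain ⟨z, hz, hdvd⟩ := exists_approximate_root q z₀
    (by
      change q.evalEval 0 z₀ = 0
      rw [← map_evalRingHom_eval, hqmap, map_evalRingHom_eval, hQz])
    (by
      change q.derivative.evalEval 0 z₀ ≠ 0
      rw [← map_evalRingHom_eval, ← derivative_map, hqmap, derivative_map, map_evalRingHom_eval]
      exact hQ2)
    ((∑ i, (w i + s * u i) + c + s) + s + 1)
  rw [hqev] at hdvd
  refine ⟨τ, hhτ, X ^ s * z, (dvd_pow_self X hs0.ne').mul_right z, _, rfl, ?_, ?_, ?_⟩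
  · exact hw.rank_pow_le
      ((raises_shiftMatrix (R := K) u s w).sub_aeval ((haτ τ).raises_toep hw) z)
  · intro k hk
    by_cases hkU : k ≤ ∑ i, u i
    · refine tailSum_le_rank hw (haτ τ) z ?_
      rw [hz, ← hNev]
      exact hN2 k (Finset.mem_Icc.2 ⟨hk, hkU⟩)
    · have : tailSum u k = 0 := Finset.sum_eq_zero fun i _ => by
        have := hU i
        omega
      rw [this]
      exact Nat.zero_le _
  · refine exists_pairing (haτ τ) hw hs0 hc1 hc2 hM (by omega) hU f g hdvd (hz ▸ hz0) ?_
    intro k hk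
    rw [hz, ← hPev]
    exact hP2 k (Finset.mem_range.2 hk)

/-! ### Triangular normal form for matrices commuting with the shift -/

section Toeplitz

variable {K : Type*} [Field K] {t : ℕ} {u : Fin t → ℕ}
  {T : Matrix (Σ i : Fin t, Fin (u i)) (Σ i : Fin t, Fin (u i)) K}

theorem mul_shiftMatrix_apply (x : Σ i : Fin t, Fin (u i)) (i : Fin t) (l : Fin (u i)) :
    (T * shiftMatrix K u) x ⟨i, l⟩ =
      if h : (l : ℕ) + 1 < u i then T x ⟨i, ⟨l + 1, h⟩⟩ else 0 := by
  simp only [Matrix.mul_apply, shiftMatrix, Matrix.of_apply, mul_ite, mul_one, mul_zero]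
  split_ifs with h
  · rw [Finset.sum_eq_single ⟨i, ⟨l + 1, h⟩⟩]
    · simp
    · rintro ⟨j, m⟩ _ hne
      rw [if_neg]
      rintro ⟨h1, h2⟩
      subst h1
      exact hne (by rw [Sigma.mk.injEq]; exact ⟨rfl, heq_of_eq (Fin.ext h2)⟩)
    · simp
  · refine Finset.sum_eq_zero ?_
    rintro ⟨j, m⟩ _
    rw [if_neg]
    rintro ⟨h1, h2⟩
    obtain rfl : j = i := h1
    have h3 : (m : ℕ) = l + 1 := h2
    exact h (h3 ▸ m.2)

theorem shiftMatrix_mul_apply (j : Fin t) (l' : Fin (u j)) (y : Σ i : Fin t, Fin (u i)) :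
    (shiftMatrix K u * T) ⟨j, l'⟩ y =
      if 0 < (l' : ℕ) then T ⟨j, ⟨l' - 1, by omega⟩⟩ y else 0 := by
  simp only [Matrix.mul_apply, shiftMatrix, Matrix.of_apply, ite_mul, one_mul, zero_mul]
  split_ifs with h
  · rw [Finset.sum_eq_single ⟨j, ⟨l' - 1, by omega⟩⟩]
    · rw [if_pos ⟨rfl, by simp only; omega⟩]
    · rintro ⟨i, m⟩ _ hne
      rw [if_neg]
      rintro ⟨h1, h2⟩
      subst h1
      simp only at h2
      exact hne (by rw [Sigma.mk.injEq]; exact ⟨rfl, heq_of_eq (Fin.ext (by simp only; omega))⟩)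
    · simp
  · refine Finset.sum_eq_zero ?_
    rintro ⟨i, m⟩ _
    rw [if_neg]
    rintro ⟨-, h2⟩
    simp only at h2
    omega

/-- A matrix commuting with the shift is determined by the images of the heads of the chains. -/
theorem exists_eq_toep (hpos : ∀ i, 0 < u i) (hT : Commute T (shiftMatrix K u)) :
    ∃ a : Fin t → Fin t → ℕ → K, T = toep u a ∧ (∀ j i l, a j i l ≠ 0 → u j ≤ u i + l) ∧
      (∀ j i l, u j ≤ l → a j i l = 0) ∧
      ∀ j i, a j i 0 = T ⟨j, ⟨0, hpos j⟩⟩ ⟨i, ⟨0, hpos i⟩⟩ := by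
  have hcomm : ∀ (j : Fin t) (l' : Fin (u j)) (i : Fin t) (l : Fin (u i)),
      (if h : (l : ℕ) + 1 < u i then T ⟨j, l'⟩ ⟨i, ⟨l + 1, h⟩⟩ else 0) =
        if 0 < (l' : ℕ) then T ⟨j, ⟨l' - 1, by omega⟩⟩ ⟨i, l⟩ else 0 := fun j l' i l => by
    rw [← mul_shiftMatrix_apply, ← shiftMatrix_mul_apply, hT.eq]
  -- Commutation slides an entry along its diagonal back to the column of the head.
  have hentry : ∀ (j i : Fin t) (l : ℕ) (hl : l < u i) (l' : ℕ) (hl' : l' < u j),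
      T ⟨j, ⟨l', hl'⟩⟩ ⟨i, ⟨l, hl⟩⟩ =
        if l ≤ l' then T ⟨j, ⟨l' - l, by omega⟩⟩ ⟨i, ⟨0, hpos i⟩⟩ else 0 := by
    intro j i l
    induction l with
    | zero => intro hl l' hl'; simp
    | succ l ih =>
      intro hl l' hl'
      have h1 := hcomm j ⟨l', hl'⟩ i ⟨l, by omega⟩
      simp only at h1
      rw [dif_pos hl] at h1
      rw [h1]
      by_cases h0 : 0 < l'
      · rw [if_pos h0, ih]
        by_cases h2 : l + 1 ≤ l'
        · have h3 : l' - 1 - l = l' - (l + 1) := by omega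
          rw [if_pos (by omega), if_pos h2]
          simp only [h3]
        · rw [if_neg (by omega), if_neg h2]
      · rw [if_neg h0, if_neg (by omega)]
  refine ⟨fun j i l => if h : l < u j then T ⟨j, ⟨l, h⟩⟩ ⟨i, ⟨0, hpos i⟩⟩ else 0, ?_, ?_, ?_, ?_⟩
  · ext ⟨j, l'⟩ ⟨i, l⟩
    simp only [toep, Matrix.of_apply]
    refine (hentry j i l l.2 l' l'.2).trans ?_
    split_ifs with h1 h2
    · rfl
    · omega
    · rfl
  · intro j i l hne
    by_contra hcon
    refine hne ((dif_pos (by omega)).trans ?_)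
    have hi := hpos i
    have hl : l + (u i - 1) + 1 < u j := by omega
    have h1 := hentry j i (u i - 1) (by omega) (l + (u i - 1)) (by omega)
    rw [if_pos (by omega)] at h1
    simp only [Nat.add_sub_cancel] at h1
    rw [← h1]
    -- Commutation at the last vector of chain `i`, which the shift kills: this is the constraint
    -- imposed by y^{u_i} e_i = 0.
    have h2 := hcomm j ⟨l + (u i - 1) + 1, hl⟩ i ⟨u i - 1, by omega⟩
    simp only at h2
    rw [dif_neg (by omega), if_pos (by omega)] at h2
    simpa using h2.symm
  · intro j i l h
    exact dif_neg (by omega)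
  · intro j i
    exact dif_pos (hpos j)

end Toeplitz

/-- Nilpotent matrices are similar to strictly lower triangular ones. -/
theorem exists_strictly_lower {K : Type*} [Field K] {I : Type*} [Fintype I] [LinearOrder I]
    (N : Matrix I I K) (hN : IsNilpotent N) :
    ∃ P Q : Matrix I I K, Q * P = 1 ∧ ∀ j i, (Q * N * P) j i ≠ 0 → i < j := by
  have hf : IsNilpotent (Matrix.toLin' N) := by
    obtain ⟨k, hk⟩ := hN
    exact ⟨k, by rw [← Matrix.toLin'_pow, hk, map_zero]⟩
  obtain ⟨m, k, -, -, b, hb⟩ := exists_chainBasis (Matrix.toLin' N) hf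
  have hcard : Fintype.card I = ∑ i, k i := by
    have h1 := Module.finrank_eq_card_basis b
    rw [Module.finrank_fintype_fun_eq_card] at h1
    simpa using h1
  let e : I ≃o Fin (∑ i, k i) := (Fintype.orderIsoFinOfCardEq I hcard).symm
  -- The chains are laid end to end in the order of `I`, so each step along a chain increases the
  -- index.
  let σ : (Σ h : Fin m, Fin (k h)) ≃ I := finSigmaFinEquiv.trans e.symm.toEquiv
  let b' : Module.Basis I K (I → K) := b.reindex σ
  have hlt : ∀ (h : Fin m) (l : Fin (k h)) (hl : (l : ℕ) + 1 < k h),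
      σ ⟨h, l⟩ < σ ⟨h, ⟨l + 1, hl⟩⟩ := by
    intro h l hl
    refine e.symm.lt_iff_lt.2 ?_
    rw [Fin.lt_def, finSigmaFinEquiv_apply, finSigmaFinEquiv_apply]
    simp
  refine ⟨(Pi.basisFun K I).toMatrix b', b'.toMatrix (Pi.basisFun K I),
    Module.Basis.toMatrix_mul_toMatrix_flip _ _, fun j i hji => ?_⟩
  have h1 : b'.toMatrix (Pi.basisFun K I) * N * (Pi.basisFun K I).toMatrix b' =
      LinearMap.toMatrix b' b' (Matrix.toLin' N) := by
    rw [← basis_toMatrix_mul_linearMap_toMatrix_mul_basis_toMatrix b' (Pi.basisFun K I) b'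
      (Pi.basisFun K I), ← Matrix.toLin_eq_toLin', LinearMap.toMatrix_toLin]
  rw [h1, LinearMap.toMatrix_apply] at hji
  obtain ⟨⟨h, l⟩, rfl⟩ := σ.surjective i
  have h2 : b' (σ ⟨h, l⟩) = b ⟨h, l⟩ := by simp [b']
  rw [h2, hb] at hji
  split_ifs at hji with hl
  · have h3 : b' (σ ⟨h, ⟨l + 1, hl⟩⟩) = b ⟨h, ⟨l + 1, hl⟩⟩ := by simp [b']
    rw [← h3, Module.Basis.repr_self, Finsupp.single_apply] at hji
    have h4 : σ ⟨h, ⟨l + 1, hl⟩⟩ = j := by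
      by_contra hne
      exact hji (if_neg hne)
    rw [← h4]
    exact hlt h l hl
  · simp at hji

section Level

variable {K : Type*} [Field K] {I : Type*} (u : I → ℕ)

/-- The block diagonal matrix with blocks indexed by the values of `u`. -/
def levelBlocks (D : ∀ v, Matrix {i // u i = v} {i // u i = v} K) : Matrix I I K :=
  Matrix.of fun j i => if h : u j = u i then D (u i) ⟨j, h⟩ ⟨i, rfl⟩ else 0

variable {u} {D E : ∀ v, Matrix {i // u i = v} {i // u i = v} K}

theorem levelBlocks_apply {v : ℕ} (j i : {i // u i = v}) : levelBlocks u D j i = D v j i := by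
  obtain ⟨i, rfl⟩ := i
  exact dif_pos j.2

theorem levelBlocks_apply_ne {j i : I} (h : u j ≠ u i) : levelBlocks u D j i = 0 := dif_neg h

theorem levelBlocks_mul [Fintype I] : levelBlocks u D * levelBlocks u E = levelBlocks u fun v => D v * E v := by
  ext j i
  rw [Matrix.mul_apply]
  by_cases h : u j = u i
  · have h1 := levelBlocks_apply (D := fun v => D v * E v) (v := u i) ⟨j, h⟩ ⟨i, rfl⟩
    simp only at h1
    rw [h1, Matrix.mul_apply]
    have h2 : ∀ k : {k // u k = u i}, D (u i) ⟨j, h⟩ k * E (u i) k ⟨i, rfl⟩ =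
        levelBlocks u D j k * levelBlocks u E k i := fun k =>
      congrArg₂ _ (levelBlocks_apply (D := D) ⟨j, h⟩ k).symm
        (levelBlocks_apply (D := E) k ⟨i, rfl⟩).symm
    simp only [h2]
    rw [← Finset.sum_subtype (Finset.univ.filter fun k => u k = u i) (by simp)
      fun k => levelBlocks u D j k * levelBlocks u E k i]
    refine (Finset.sum_filter_of_ne fun k _ hk => ?_).symm
    by_contra hki
    exact hk (by rw [levelBlocks_apply_ne (D := E) hki, mul_zero])
  · rw [levelBlocks_apply_ne h]
    refine Finset.sum_eq_zero fun k _ => ?_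
    by_cases h1 : u j = u k
    · rw [levelBlocks_apply_ne (D := E) fun h2 => h (h1.trans h2), mul_zero]
    · rw [levelBlocks_apply_ne h1, zero_mul]

theorem levelBlocks_one [DecidableEq I] : (levelBlocks u fun _ => 1 : Matrix I I K) = 1 := by
  ext j i
  by_cases h : u j = u i
  · have h1 := levelBlocks_apply (K := K) (D := fun _ => 1) (v := u i) ⟨j, h⟩ ⟨i, rfl⟩
    simp only at h1
    rw [h1, Matrix.one_apply, Matrix.one_apply]
    exact if_congr (by simp) rfl rfl
  · rw [levelBlocks_apply_ne h, Matrix.one_apply_ne fun h1 => h (by rw [h1])]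

end Level

section Heads

variable {K : Type*} [Field K] {t : ℕ} {u : Fin t → ℕ}

/-- The matrix induced on the heads of the chains. -/
def heads (hpos : ∀ i, 0 < u i) (T : Matrix (Σ i : Fin t, Fin (u i)) (Σ i : Fin t, Fin (u i)) K) :
    Matrix (Fin t) (Fin t) K :=
  T.submatrix (fun i => ⟨i, ⟨0, hpos i⟩⟩) fun i => ⟨i, ⟨0, hpos i⟩⟩

/-- A matrix commuting with y preserves yV, and `heads` is its action on V/yV. -/
theorem heads_mul (hpos : ∀ i, 0 < u i)
    {S T : Matrix (Σ i : Fin t, Fin (u i)) (Σ i : Fin t, Fin (u i)) K}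
    (hS : Commute S (shiftMatrix K u)) : heads hpos (S * T) = heads hpos S * heads hpos T := by
  obtain ⟨a, rfl, -⟩ := exists_eq_toep hpos hS
  ext j i
  simp only [heads, Matrix.submatrix_apply, Matrix.mul_apply, Fintype.sum_sigma]
  refine Finset.sum_congr rfl fun k _ => ?_
  rw [Finset.sum_eq_single ⟨0, hpos k⟩]
  · intro m _ hm
    have h0 : ¬ (m : ℕ) ≤ 0 := fun h => hm (Fin.ext (Nat.le_zero.1 h))
    refine mul_eq_zero_of_left ?_ _
    simp only [toep, Matrix.of_apply]
    exact if_neg h0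
  · simp

theorem heads_pow (hpos : ∀ i, 0 < u i)
    {T : Matrix (Σ i : Fin t, Fin (u i)) (Σ i : Fin t, Fin (u i)) K}
    (hT : Commute T (shiftMatrix K u)) (k : ℕ) : heads hpos (T ^ k) = heads hpos T ^ k := by
  induction k with
  | zero =>
    ext j i
    simp only [heads, pow_zero, Matrix.submatrix_apply, Matrix.one_apply]
    refine if_congr ⟨fun h => congrArg Sigma.fst h, ?_⟩ rfl rfl
    rintro rfl
    rfl
  | succ k ih => rw [pow_succ, heads_mul hpos (hT.pow_left k), ih, pow_succ]

/-- The matrix acting on all the layers of the chains as `X` acts on the heads. -/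
def layerwise (u : Fin t → ℕ) (X : Matrix (Fin t) (Fin t) K) :
    Matrix (Σ i : Fin t, Fin (u i)) (Σ i : Fin t, Fin (u i)) K :=
  Matrix.of fun b c => if (b.2 : ℕ) = c.2 then X b.1 c.1 else 0

theorem layerwise_mul {X Y : Matrix (Fin t) (Fin t) K} (hX : ∀ j i, X j i ≠ 0 → u j = u i) :
    layerwise u X * layerwise u Y = layerwise u (X * Y) := by
  ext ⟨j, l'⟩ ⟨i, l⟩
  simp only [layerwise, Matrix.mul_apply, Matrix.of_apply, Fintype.sum_sigma]
  have h : ∀ k, (∑ m : Fin (u k), (if (l' : ℕ) = m then X j k else 0) *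
      (if (m : ℕ) = l then Y k i else 0)) = if (l' : ℕ) = l then X j k * Y k i else 0 := by
    intro k
    by_cases hjk : X j k = 0
    · simp [hjk]
    have hl : (l' : ℕ) < u k := hX j k hjk ▸ l'.2
    rw [Finset.sum_eq_single ⟨l', hl⟩]
    · simp
    · intro m _ hm
      rw [if_neg (fun h => hm (Fin.ext h.symm)), zero_mul]
    · simp
  simp only [h]
  split_ifs with h1
  · rfl
  · simp

theorem layerwise_one : layerwise u (1 : Matrix (Fin t) (Fin t) K) = 1 := by
  ext ⟨j, l'⟩ ⟨i, l⟩
  simp only [layerwise, Matrix.of_apply, Matrix.one_apply, Sigma.mk.injEq]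
  by_cases hji : j = i
  · subst hji
    simp [Fin.ext_iff]
  · simp [hji]

theorem commute_layerwise {X : Matrix (Fin t) (Fin t) K} (hX : ∀ j i, X j i ≠ 0 → u j = u i) :
    Commute (layerwise u X) (shiftMatrix K u) := by
  ext ⟨j, l'⟩ ⟨i, l⟩
  rw [mul_shiftMatrix_apply, shiftMatrix_mul_apply]
  simp only [layerwise, Matrix.of_apply]
  by_cases hji : X j i = 0
  · simp [hji]
  have h1 := hX j i hji
  have h2 := l'.2
  split_ifs <;> first | rfl | omega

theorem heads_layerwise (hpos : ∀ i, 0 < u i) (X : Matrix (Fin t) (Fin t) K) :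
    heads hpos (layerwise u X) = X := by
  ext j i
  simp [heads, layerwise]

/-- After a change of basis fixing the shift, a nilpotent matrix commuting with the shift is in
triangular position. -/
theorem exists_conj_eq_toep (hu : Antitone u) (hpos : ∀ i, 0 < u i)
    {T : Matrix (Σ i : Fin t, Fin (u i)) (Σ i : Fin t, Fin (u i)) K}
    (hT : Commute T (shiftMatrix K u)) (hnil : IsNilpotent T) :
    ∃ P Q : Matrix (Σ i : Fin t, Fin (u i)) (Σ i : Fin t, Fin (u i)) K, Q * P = 1 ∧
      Q * shiftMatrix K u * P = shiftMatrix K u ∧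
      ∃ (a : Fin t → Fin t → ℕ → K) (L : ℕ), 2 ≤ L ∧ IsCoeff u L a ∧ Q * T * P = toep u a := by
  obtain ⟨U, hU⟩ : ∃ U, ∀ i, u i ≤ U := ⟨∑ i, u i, fun i =>
    Finset.single_le_sum (f := u) (fun _ _ => Nat.zero_le _) (Finset.mem_univ i)⟩
  -- With these weights the matrix on the heads does not lower weight, and its leading part is block
  -- diagonal by chain length.
  let ω : Fin t → ℕ := fun i => U - u i
  have hω : ∀ j i, ω j = ω i + 0 ↔ u j = u i := fun j i => by
    have := hU i
    have := hU j
    simp only [ω]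
    omega
  have hlead : ∀ X : Matrix (Fin t) (Fin t) K, leadPart ω 0 X =
      levelBlocks u fun v => X.submatrix Subtype.val Subtype.val := by
    intro X
    ext j i
    simp only [leadPart, Matrix.of_apply, hω, levelBlocks]
    split_ifs <;> rfl
  have hraise : ∀ {S : Matrix (Σ i : Fin t, Fin (u i)) (Σ i : Fin t, Fin (u i)) K},
      Commute S (shiftMatrix K u) → Raises ω 0 (heads hpos S) := by
    intro S hS j i hji
    obtain ⟨a, -, h1, -, h2⟩ := exists_eq_toep hpos hS
    have h3 := h1 j i 0 (by rw [h2]; exact hji)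
    simp only [ω]
    omega
  obtain ⟨k, hk⟩ := hnil
  have hck : heads hpos T ^ k = 0 := by
    rw [← heads_pow hpos hT, hk]
    rfl
  have hblock : ∀ v, IsNilpotent ((heads hpos T).submatrix Subtype.val Subtype.val :
      Matrix {i // u i = v} {i // u i = v} K) := by
    have h1 := leadPart_pow (hraise hT) k
    rw [hck, hlead (heads hpos T)] at h1
    have h2 : ∀ m, (levelBlocks u fun v => ((heads hpos T).submatrix Subtype.val Subtype.val :
        Matrix {i // u i = v} {i // u i = v} K)) ^ m = levelBlocks u fun v =>
        ((heads hpos T).submatrix Subtype.val Subtype.val :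
          Matrix {i // u i = v} {i // u i = v} K) ^ m := by
      intro m
      induction m with
      | zero => simp only [pow_zero, levelBlocks_one]
      | succ m ih => simp only [pow_succ, ih, levelBlocks_mul]
    rw [h2] at h1
    intro v
    refine ⟨k, ?_⟩
    ext j i
    rw [← levelBlocks_apply (D := fun v => ((heads hpos T).submatrix Subtype.val Subtype.val :
      Matrix {i // u i = v} {i // u i = v} K) ^ k), ← h1]
    simp [leadPart]
  -- Each block is nilpotent and is triangularised separately. The base change mixes only chains of
  -- equal length, so applied on all layers it commutes with the shift.
  choose P Q hQP hlow using fun v => exists_strictly_lower _ (hblock v)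
  have hP : ∀ j i, levelBlocks u P j i ≠ 0 → u j = u i := fun j i h => by
    by_contra hne
    exact h (levelBlocks_apply_ne hne)
  have hQ : ∀ j i, levelBlocks u Q j i ≠ 0 → u j = u i := fun j i h => by
    by_contra hne
    exact h (levelBlocks_apply_ne hne)
  have hcP := commute_layerwise hP
  have hcQ := commute_layerwise hQ
  have hQP1 : layerwise u (levelBlocks u Q) * layerwise u (levelBlocks u P) = 1 := by
    rw [layerwise_mul hQ, levelBlocks_mul, funext hQP, ← layerwise_one]
    congr 1
    convert levelBlocks_one (K := K) (u := u)
  have hcT : Commute (layerwise u (levelBlocks u Q) * T * layerwise u (levelBlocks u P))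
      (shiftMatrix K u) := (hcQ.mul_left hT).mul_left hcP
  obtain ⟨a, ha, h1, h2, h3⟩ := exists_eq_toep hpos hcT
  refine ⟨layerwise u (levelBlocks u P), layerwise u (levelBlocks u Q), hQP1, ?_, a, U + 2,
    by omega, ⟨h1, fun j i hji => ?_, fun j i l hl => h2 j i l ((hU j).trans (by omega))⟩, ha⟩
  · rw [hcQ.eq, mul_assoc, hQP1, mul_one]
  -- A head coefficient from `i` to `j` requires `u j ≤ u i`. If the inequality is strict, the
  -- ordering of `u` gives `i < j`; if not, the triangularised block does.
  · have h4 := h1 j i 0 hji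
    rcases h4.lt_or_eq with h5 | h5
    · by_contra hij
      exact absurd (hu (not_lt.1 hij)) (not_le.2 h5)
    · rw [add_zero] at h5
      have h6 : heads hpos (layerwise u (levelBlocks u Q) * T * layerwise u (levelBlocks u P)) =
          levelBlocks u Q * heads hpos T * levelBlocks u P := by
        rw [heads_mul hpos (hcQ.mul_left hT), heads_mul hpos hcQ, heads_layerwise, heads_layerwise]
      have hrQ := hraise hcQ
      have hrP := hraise hcP
      rw [heads_layerwise] at hrQ hrP
      have hlv : ∀ D : ∀ v, Matrix {i // u i = v} {i // u i = v} K,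
          leadPart ω 0 (levelBlocks u D) = levelBlocks u D := by
        intro D
        ext j i
        simp only [leadPart, Matrix.of_apply, hω]
        split_ifs with h
        · rfl
        · exact (levelBlocks_apply_ne h).symm
      have h7 : leadPart ω (0 + 0 + 0) (levelBlocks u Q * heads hpos T * levelBlocks u P) =
          levelBlocks u fun v => Q v *
            ((heads hpos T).submatrix Subtype.val Subtype.val) * P v := by
        rw [leadPart_mul (hrQ.mul (hraise hT)) hrP, leadPart_mul hrQ (hraise hT), hlv, hlv, hlead,
          levelBlocks_mul, levelBlocks_mul]
      have h8 : a j i 0 = (levelBlocks u fun v => Q v *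
          ((heads hpos T).submatrix Subtype.val Subtype.val) * P v) j i := by
        rw [← h7, ← h6, h3]
        exact (if_pos ((hω j i).2 h5)).symm
      rw [h8] at hji
      have h9 := levelBlocks_apply (D := fun v => Q v *
          ((heads hpos T).submatrix Subtype.val Subtype.val) * P v) (v := u i) ⟨j, h5⟩ ⟨i, rfl⟩
      exact hlow (u i) ⟨j, h5⟩ ⟨i, rfl⟩ (h9 ▸ hji)

/-- Toeplitz matrices commute with the shift. -/
theorem commute_toep {a : Fin t → Fin t → ℕ → K} (ha : ∀ j i l, a j i l ≠ 0 → u j ≤ u i + l) :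
    Commute (toep u a) (shiftMatrix K u) := by
  ext ⟨j, l'⟩ ⟨i, l⟩
  rw [mul_shiftMatrix_apply, shiftMatrix_mul_apply]
  simp only [toep, Matrix.of_apply]
  have h1 := l'.2
  have h2 : (l' : ℕ) - 1 - l = l' - (l + 1) := by omega
  have h3 : u i ≤ (l : ℕ) + 1 → a j i (l' - (l + 1)) ≠ 0 → (l' : ℕ) < l + 1 := fun h h' => by
    have := ha j i _ h'
    omega
  rw [h2]
  split_ifs
  all_goals first | rfl | omega | skip
  by_contra hne
  have := h3 (by omega) (Ne.symm hne)
  omega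

end Heads

/-! ### Transport to arbitrary commuting pairs -/

/-- Conjugation by mutually inverse rectangular matrices. -/
def conjAlgHom {K m n : Type*} [Field K] [Fintype m] [DecidableEq m] [Fintype n] [DecidableEq n]
    {R : Matrix n m K} {R' : Matrix m n K} (h : R * R' = 1) (h' : R' * R = 1) :
    Matrix m m K →ₐ[K] Matrix n n K where
  toFun X := R * X * R'
  map_one' := by rw [Matrix.mul_one, h]
  map_mul' X Y := by
    calc R * (X * Y) * R' = R * X * (1 * Y) * R' := by simp only [Matrix.mul_assoc, Matrix.one_mul]
      _ = R * X * R' * (R * Y * R') := by rw [← h']; simp only [Matrix.mul_assoc]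
  map_zero' := by rw [Matrix.mul_zero, Matrix.zero_mul]
  map_add' X Y := by rw [Matrix.mul_add, Matrix.add_mul]
  commutes' r := by
    rw [Algebra.algebraMap_eq_smul_one, Algebra.algebraMap_eq_smul_one, Matrix.mul_smul,
      Matrix.mul_one, Matrix.smul_mul, h]

theorem rank_conjAlgHom {K m n : Type*} [Field K] [Fintype m] [DecidableEq m] [Fintype n]
    [DecidableEq n] {R : Matrix n m K} {R' : Matrix m n K} (h : R * R' = 1) (h' : R' * R = 1)
    (X : Matrix m m K) : (conjAlgHom h h' X).rank = X.rank := by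
  refine le_antisymm ((Matrix.rank_mul_le_left _ _).trans (Matrix.rank_mul_le_right _ _)) ?_
  have h1 : X = R' * (R * X * R') * R := by
    calc X = R' * R * X * (R' * R) := by rw [h', Matrix.one_mul, Matrix.mul_one]
      _ = _ := by simp only [Matrix.mul_assoc]
  conv_lhs => rw [h1]
  exact (Matrix.rank_mul_le_left _ _).trans (Matrix.rank_mul_le_right _ _)

/-- A nilpotent matrix together with a nilpotent matrix commuting with it can be simultaneously
conjugated to normal form. -/
theorem IsJordanOrders.exists_conj {n : ℕ} {K : Type*} [Field K]
    {A B : Matrix (Fin n) (Fin n) K} (hA : IsNilpotent A) (hAB : Commute A B)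
    {t : ℕ} {u : Fin t → ℕ} (hu : IsJordanOrders B u) :
    ∃ (R : Matrix (Fin n) (Σ i : Fin t, Fin (u i)) K)
      (R' : Matrix (Σ i : Fin t, Fin (u i)) (Fin n) K)
      (h : R * R' = 1) (h' : R' * R = 1), conjAlgHom h h' (shiftMatrix K u) = B ∧
      ∃ (a : Fin t → Fin t → ℕ → K) (L : ℕ), 2 ≤ L ∧ IsCoeff u L a ∧
        conjAlgHom h h' (toep u a) = A := by
  obtain ⟨hanti, hpos, b, hb⟩ := (isJordanOrders_iff B u).1 hu
  set S := (Pi.basisFun K (Fin n)).toMatrix b with hS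
  set S' := b.toMatrix (Pi.basisFun K (Fin n)) with hS'
  have h1 : S * S' = 1 := Module.Basis.toMatrix_mul_toMatrix_flip _ _
  have h2 : S' * S = 1 := Module.Basis.toMatrix_mul_toMatrix_flip _ _
  have h3 : conjAlgHom h2 h1 B = shiftMatrix K u := by
    have h4 : S' * B * S = LinearMap.toMatrix b b (Matrix.toLin' B) := by
      rw [← basis_toMatrix_mul_linearMap_toMatrix_mul_basis_toMatrix b (Pi.basisFun K (Fin n)) b
        (Pi.basisFun K (Fin n)), ← Matrix.toLin_eq_toLin', LinearMap.toMatrix_toLin]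
    refine h4.trans ?_
    ext ⟨j, l'⟩ ⟨i, l⟩
    rw [LinearMap.toMatrix_apply, hb]
    simp only [shiftMatrix, Matrix.of_apply]
    have hl' := l'.2
    split_ifs with h5 h6 h6
    · obtain ⟨rfl, h7⟩ := h6
      have h8 : l' = ⟨l + 1, h5⟩ := Fin.ext h7
      simp [h8]
    · rw [Module.Basis.repr_self, Finsupp.single_apply, if_neg]
      intro h7
      rw [Sigma.mk.injEq] at h7
      obtain ⟨rfl, h7⟩ := h7
      exact h6 ⟨rfl, by rw [← eq_of_heq h7]⟩
    · obtain ⟨rfl, h7⟩ := h6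
      omega
    · simp
  have hcomm : Commute (conjAlgHom h2 h1 A) (shiftMatrix K u) := h3 ▸ hAB.map (conjAlgHom h2 h1)
  obtain ⟨P, Q, hQP, hshift, a, L, hL, ha, hconj⟩ :=
    exists_conj_eq_toep hanti hpos hcomm (hA.map (conjAlgHom h2 h1))
  have hPQ : P * Q = 1 := mul_eq_one_comm.1 hQP
  have key : ∀ X Y, Q * conjAlgHom h2 h1 X * P = Y → S * P * Y * (Q * S') = X := by
    rintro X Y rfl
    calc S * P * (Q * (S' * X * S) * P) * (Q * S') =
        S * (P * Q) * S' * X * (S * (P * Q) * S') := by simp only [Matrix.mul_assoc]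
      _ = X := by rw [hPQ, Matrix.mul_one, h1, Matrix.one_mul, Matrix.mul_one]
  refine ⟨S * P, Q * S', ?_, ?_, key _ _ (h3 ▸ hshift), a, L, hL, ha, key _ _ hconj⟩
  · calc S * P * (Q * S') = S * (P * Q) * S' := by simp only [Matrix.mul_assoc]
      _ = 1 := by rw [hPQ, Matrix.mul_one, h1]
  · calc Q * S' * (S * P) = Q * (S' * S) * P := by simp only [Matrix.mul_assoc]
      _ = 1 := by rw [h2, Matrix.mul_one, hQP]

/-- Conjugation carries `exists_degeneration_toep` over. The whole line consists of nilpotent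
matrices, since all its points raise the same weights. -/
theorem exists_degeneration {n : ℕ} {K : Type*} [Field K] [IsAlgClosed K]
    {A B : Matrix (Fin n) (Fin n) K} (hA : IsNilpotent A) (hAB : Commute A B)
    {t : ℕ} {u : Fin t → ℕ} (hu : IsJordanOrders B u) {i₁ : Fin t}
    (hmax : window u (u i₁) = maxAlmostEqual u) :
    ∃ A₁ : Matrix (Fin n) (Fin n) K, Commute A₁ B ∧
      (∀ τ : K, IsNilpotent ((1 - τ) • A₁ + τ • A)) ∧
      ∀ h : K[X], h ≠ 0 → ∃ τ : K, h.eval τ ≠ 0 ∧ ∃ g : K[X], X ∣ g ∧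
        (∀ k, ((B - aeval ((1 - τ) • A₁ + τ • A) g) ^ k).rank ≤ (B ^ k).rank) ∧
        (∀ k, u i₁ ≤ k → (B ^ k).rank ≤ ((B - aeval ((1 - τ) • A₁ + τ • A) g) ^ k).rank) ∧
        ∃ (D₁ : Matrix (Fin n) (Fin (maxAlmostEqual u)) K)
          (D₂ : Matrix (Fin (maxAlmostEqual u)) (Fin n) K),
          (B - aeval ((1 - τ) • A₁ + τ • A) g) * D₁ = 0 ∧
          D₂ * (B - aeval ((1 - τ) • A₁ + τ • A) g) = 0 ∧ (D₂ * D₁).det ≠ 0 := by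
  obtain ⟨R, R', h, h', hB, a, L, hL, ha, rfl⟩ := hu.exists_conj hA hAB
  obtain ⟨a₁, ha₁, hdeg⟩ := exists_degeneration_toep hu.1 hu.2.1 hL ha hmax
  obtain ⟨w, hw⟩ := exists_isWeight hu.1 fun p => window_le u p
  have hline : ∀ τ : K, (1 - τ) • conjAlgHom h h' (toep u a₁) + τ • conjAlgHom h h' (toep u a) =
      conjAlgHom h h' (toep u fun j i l => (1 - τ) * a₁ j i l + τ * a j i l) := by
    intro τ
    rw [← map_smul, ← map_smul, ← map_add]
    congr 1
    ext b c
    simp only [toep, Matrix.add_apply, Matrix.smul_apply, Matrix.of_apply, smul_eq_mul]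
    split_ifs <;> simp
  refine ⟨conjAlgHom h h' (toep u a₁), ?_, fun τ => ?_, fun p hp => ?_⟩
  · rw [← hB]
    exact (commute_toep ha₁.le_of_ne).map (conjAlgHom h h')
  · rw [hline]
    exact ((ha₁.interpolate ha _ _).raises_toep hw).isNilpotent.map (conjAlgHom h h')
  · obtain ⟨τ, hτ, g, hg, T, rfl, hle, hge, D₁, D₂, hD₁, hD₂, hdet⟩ := hdeg p hp
    refine ⟨τ, hτ, g, hg, ?_⟩
    have hC : B - aeval ((1 - τ) • conjAlgHom h h' (toep u a₁) + τ • conjAlgHom h h' (toep u a)) g =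
        conjAlgHom h h' (shiftMatrix K u -
          aeval (toep u fun j i l => (1 - τ) * a₁ j i l + τ * a j i l) g) := by
      rw [hline, aeval_algHom_apply, map_sub, hB]
    set C := shiftMatrix K u - aeval (toep u fun j i l => (1 - τ) * a₁ j i l + τ * a j i l) g
    rw [hC]
    simp only [← map_pow, rank_conjAlgHom, hu.rank_pow]
    refine ⟨hle, hge, R * D₁, D₂ * R', ?_, ?_, ?_⟩
    · calc R * C * R' * (R * D₁) = R * C * (R' * R) * D₁ := by simp only [Matrix.mul_assoc]
        _ = 0 := by rw [h', Matrix.mul_one, Matrix.mul_assoc, hD₁, Matrix.mul_zero]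
    · calc D₂ * R' * (R * C * R') = D₂ * (R' * R) * C * R' := by simp only [Matrix.mul_assoc]
        _ = 0 := by rw [h', Matrix.mul_one, hD₂, Matrix.zero_mul]
    · have : D₂ * R' * (R * D₁) = D₂ * (R' * R) * D₁ := by simp only [Matrix.mul_assoc]
      rw [this, h', Matrix.mul_one]
      exact hdet

/-! ### Open sets, one degeneration step, and iteration -/

theorem commute_aeval {n : ℕ} {K : Type*} [Field K] {A B : Matrix (Fin n) (Fin n) K}
    (h : Commute A B) (f : K[X]) : Commute (aeval A f) B := by
  rw [aeval_eq_sum_range]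
  exact Commute.sum_left _ _ _ fun i _ => (h.pow_left i).smul_left _

theorem isNilpotent_aeval {n : ℕ} {K : Type*} [Field K] {A : Matrix (Fin n) (Fin n) K}
    (hA : IsNilpotent A) {f : K[X]} (hf : X ∣ f) : IsNilpotent (aeval A f) := by
  obtain ⟨q, rfl⟩ := hf
  rw [map_mul, aeval_X]
  refine Commute.isNilpotent_mul_right ?_ hA
  exact (commute_aeval (Commute.refl A) q).symm

theorem Reach.commNilp {n : ℕ} {K : Type*} [Field K]
    {𝒜 : Set (Matrix (Fin n) (Fin n) K × Matrix (Fin n) (Fin n) K)} (h𝒜 : IsZariskiOpen 𝒜)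
    {A C : Matrix (Fin n) (Fin n) K} (h : Reach 𝒜 A C) :
    IsNilpotent A ∧ IsNilpotent C ∧ Commute A C := by
  obtain ⟨f, hf, hmem⟩ := h
  obtain ⟨I, rfl⟩ := h𝒜
  obtain ⟨⟨hA, hB, hc⟩, -⟩ := hmem
  have h1 : Commute A (aeval A f) := (commute_aeval (Commute.refl A) f).symm
  have hc' : Commute A C := by simpa using hc.add_right h1
  refine ⟨hA, ?_, hc'⟩
  have h2 : Commute (C - aeval A f) (aeval A f) :=
    ((commute_aeval hc f).symm)
  simpa using h2.isNilpotent_add hB (isNilpotent_aeval hA hf)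

/-- Along the line through `A₁` and `A`, membership of `(A_τ, B - f(A_τ))` in a Zariski-open set is
the nonvanishing of a polynomial in `τ`. -/
theorem exists_polynomial_of_isZariskiOpen {n : ℕ} {K : Type*} [Field K]
    {𝒜 : Set (Matrix (Fin n) (Fin n) K × Matrix (Fin n) (Fin n) K)} (h𝒜 : IsZariskiOpen 𝒜)
    {A A₁ B : Matrix (Fin n) (Fin n) K} {f : K[X]} (hmem : (A, B - aeval A f) ∈ 𝒜)
    (hline : ∀ τ : K, ((1 - τ) • A₁ + τ • A, B - aeval ((1 - τ) • A₁ + τ • A) f) ∈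
      commNilpPairs n K) :
    ∃ h : K[X], h ≠ 0 ∧ ∀ τ, h.eval τ ≠ 0 →
      ((1 - τ) • A₁ + τ • A, B - aeval ((1 - τ) • A₁ + τ • A) f) ∈ 𝒜 := by
  obtain ⟨I, rfl⟩ := h𝒜
  obtain ⟨-, hnz⟩ := hmem
  simp only [MvPolynomial.mem_zeroLocus_iff, not_forall] at hnz
  obtain ⟨F, hF, hF0⟩ := hnz
  let A' : Matrix (Fin n) (Fin n) K[X] :=
    (1 - X : K[X]) • A₁.map Polynomial.C + (X : K[X]) • A.map Polynomial.C
  let B' : Matrix (Fin n) (Fin n) K[X] := B.map Polynomial.C - aeval A' f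
  let h : K[X] := MvPolynomial.aeval
    (Sum.elim (fun e : Fin n × Fin n => A' e.1 e.2) (fun e : Fin n × Fin n => B' e.1 e.2)) F
  have hA' : ∀ τ : K, (Polynomial.aeval τ : K[X] →ₐ[K] K).mapMatrix A' =
      (1 - τ) • A₁ + τ • A := by
    intro τ
    ext i j
    simp only [A', AlgHom.mapMatrix_apply, Matrix.map_apply, Matrix.add_apply, Matrix.smul_apply,
      smul_eq_mul, map_add, map_mul, map_sub, map_one, aeval_X, aeval_C, Algebra.algebraMap_self,
      RingHom.id_apply]
  have hB' : ∀ τ : K, (Polynomial.aeval τ : K[X] →ₐ[K] K).mapMatrix B' =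
      B - aeval ((1 - τ) • A₁ + τ • A) f := by
    intro τ
    rw [map_sub, ← Polynomial.aeval_algHom_apply, hA']
    congr 1
    ext i j
    simp
  have heval : ∀ τ : K, h.eval τ = MvPolynomial.aeval
      (coords ((1 - τ) • A₁ + τ • A, B - aeval ((1 - τ) • A₁ + τ • A) f)) F := by
    intro τ
    rw [← Polynomial.coe_aeval_eq_eval]
    change (Polynomial.aeval τ : K[X] →ₐ[K] K) (MvPolynomial.aeval _ F) = _
    rw [← AlgHom.comp_apply, MvPolynomial.comp_aeval]
    congr 2
    funext e
    rcases e with e | e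
    · exact congrFun (congrFun (hA' τ) e.1) e.2
    · exact congrFun (congrFun (hB' τ) e.1) e.2
  refine ⟨h, ?_, fun τ hτ => ⟨hline τ, fun hz => hτ ?_⟩⟩
  -- At τ = 1 the line passes through the given pair, where `F` does not vanish.
  · intro h0
    apply hF0
    have := heval 1
    rw [h0] at this
    simpa using this.symm
  · rw [heval]
    exact hz F hF

/-- The old polynomial `f` keeps (A_τ, B - f(A_τ)) in the open set for generic τ, while `g` produces
C = B - g(A_τ). The two second matrices differ by (f - g)(A_τ), which `Reach` allows. -/
theorem Reach.exists_step {n : ℕ} {K : Type*} [Field K] [IsAlgClosed K]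
    {𝒜 : Set (Matrix (Fin n) (Fin n) K × Matrix (Fin n) (Fin n) K)} (h𝒜 : IsZariskiOpen 𝒜)
    {A B : Matrix (Fin n) (Fin n) K} (h : Reach 𝒜 A B)
    {t : ℕ} {u : Fin t → ℕ} (hu : IsJordanOrders B u) {i₁ : Fin t}
    (hmax : window u (u i₁) = maxAlmostEqual u) :
    ∃ A' C : Matrix (Fin n) (Fin n) K, Reach 𝒜 A' C ∧
      ∃ (t' : ℕ) (v : Fin t' → ℕ), IsJordanOrders C v ∧
        (∀ k, tailSum v k ≤ tailSum u k) ∧ (∀ k, u i₁ ≤ k → tailSum v k = tailSum u k) ∧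
        maxAlmostEqual u ≤ window v 1 := by
  obtain ⟨hA, hB, hAB⟩ := h.commNilp h𝒜
  obtain ⟨f, hf, hmem⟩ := h
  obtain ⟨A₁, hA₁, hnil, hdeg⟩ := exists_degeneration hA hAB hu hmax
  have hcomm : ∀ τ : K, Commute ((1 - τ) • A₁ + τ • A) B := fun τ =>
    (hA₁.smul_left _).add_left (hAB.smul_left _)
  have hline : ∀ (τ : K) (g : K[X]), X ∣ g →
      ((1 - τ) • A₁ + τ • A, B - aeval ((1 - τ) • A₁ + τ • A) g) ∈ commNilpPairs n K := by
    intro τ g hg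
    refine ⟨hnil τ, ?_, ?_⟩
    · exact (commute_aeval (hcomm τ) g).symm.isNilpotent_sub hB (isNilpotent_aeval (hnil τ) hg)
    · exact (hcomm τ).sub_right ((commute_aeval (Commute.refl _) g).symm)
  obtain ⟨h, h0, hh⟩ := exists_polynomial_of_isZariskiOpen h𝒜 hmem fun τ => hline τ f hf
  obtain ⟨τ, hτ, g, hg, hle, hge, D₁, D₂, hD₁, hD₂, hdet⟩ := hdeg h h0
  have hCnil : IsNilpotent (B - aeval ((1 - τ) • A₁ + τ • A) g) := (hline τ g hg).2.1
  obtain ⟨t', v, hv⟩ := exists_isJordanOrders hCnil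
  refine ⟨(1 - τ) • A₁ + τ • A, _, ⟨f - g, dvd_sub hf hg, ?_⟩, t', v, hv, ?_, ?_, ?_⟩
  · convert hh τ hτ using 2
    rw [map_sub]
    abel
  · intro k
    rw [← hv.rank_pow, ← hu.rank_pow]
    exact hle k
  · intro k hk
    rw [← hv.rank_pow, ← hu.rank_pow]
    exact le_antisymm (hle k) (hge k hk)
  · rw [← card_ones_eq_window hv.2.1]
    exact hv.le_card_ones D₁ D₂ hD₁ hD₂ hdet

/-- If the blocks of order one are fewer than s_B, a step makes them at least s_B, so their number
grows; it is bounded by `n`. Should `v` still have a larger window, that window lies at a value at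
most `p`, so the next step again leaves the ranks of the k-th powers unchanged for `k ≥ p`. -/
theorem Reach.exists_final {n : ℕ} {K : Type*} [Field K] [IsAlgClosed K]
    {𝒜 : Set (Matrix (Fin n) (Fin n) K × Matrix (Fin n) (Fin n) K)} (h𝒜 : IsZariskiOpen 𝒜)
    (p : ℕ) (m : ℕ) {A B : Matrix (Fin n) (Fin n) K} (h : Reach 𝒜 A B)
    {t : ℕ} {u : Fin t → ℕ} (hu : IsJordanOrders B u) {i₁ : Fin t} (hi₁ : u i₁ ≤ p)
    (hmax : window u (u i₁) = maxAlmostEqual u) (hm : n ≤ m + window u 1) :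
    ∃ A' C : Matrix (Fin n) (Fin n) K, Reach 𝒜 A' C ∧
      ∃ (t' : ℕ) (v : Fin t' → ℕ), IsJordanOrders C v ∧
        (∀ k, tailSum v k ≤ tailSum u k) ∧ (∀ k, p ≤ k → tailSum v k = tailSum u k) ∧
        window v 1 = maxAlmostEqual v := by
  induction m using Nat.strong_induction_on generalizing A B t u with
  | _ m ih =>
    rcases (window_le u 1).eq_or_lt with heq | hlt
    · exact ⟨A, B, h, t, u, hu, fun _ => le_rfl, fun _ _ => rfl, heq⟩
    obtain ⟨A', C, hR, t', v, hv, hle, heq, hones⟩ := h.exists_step h𝒜 hu hmax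
    have hn : ∀ {t : ℕ} {w : Fin t → ℕ} {M : Matrix (Fin n) (Fin n) K},
        IsJordanOrders M w → window w 1 ≤ n := by
      intro t w M hw
      have h1 := hw.rank_pow 0
      rw [pow_zero, Matrix.rank_one, Fintype.card_fin] at h1
      have h2 := tailSum_eq w 0
      have h3 := countGE_add_window w 0
      have h4 := countGE_zero w
      have h5 := countGE_one hw.2.1
      simp only [zero_add] at h2 h3
      omega
    have hmv := hn hv
    -- The step preserves the number of blocks of each order above `p` and does not increase the
    -- number of blocks of order at least `p`, so windows above `p` do not grow.
    have hpv : ∀ a, p < a → window v a ≤ maxAlmostEqual u := by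
      intro a ha
      obtain ⟨b, rfl⟩ : ∃ b, a = b + 1 := ⟨a - 1, by omega⟩
      refine le_trans ?_ (window_le u (b + 1))
      have e1 := countGE_add_window v b
      have e2 := countGE_add_window u b
      have hc : ∀ k, p ≤ k → countGE v (k + 1) = countGE u (k + 1) := by
        intro k hk
        have f1 := tailSum_eq v k
        have f2 := tailSum_eq u k
        rw [heq k (by omega), heq (k + 1) (by omega)] at f1
        omega
      have e3 := hc (b + 1) (by omega)
      have e4 : countGE v b ≤ countGE u b := by
        rcases Nat.eq_zero_or_pos b with hb0 | hb0
        · subst hb0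
          rw [countGE_zero, countGE_zero, ← countGE_one hu.2.1, ← countGE_one hv.2.1]
          exact (hc 0 (by omega)).le
        obtain ⟨c, rfl⟩ : ∃ c, b = c + 1 := ⟨b - 1, by omega⟩
        have f1 := tailSum_eq v c
        have f2 := tailSum_eq u c
        have f3 := heq (c + 1) (by omega)
        have f4 := hle c
        omega
      simp only [Nat.add_assoc, Nat.reduceAdd] at e1 e2 e3
      omega
    have hvpos : 0 < maxAlmostEqual v := lt_of_lt_of_le (by omega) (window_le v 1)
    rcases (window_le v 1).eq_or_lt with heq' | hlt'
    · exact ⟨A', C, hR, t', v, hv, hle, fun k hk => heq k (by omega), heq'⟩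
    obtain ⟨j, hj⟩ := exists_window_eq hv.1 hvpos
    have hjp : v j ≤ p := by
      by_contra hcon
      have := hpv _ (not_le.1 hcon)
      omega
    obtain ⟨A'', C', hR', t'', w, hw, hle', heq'', hfin⟩ :=
      ih (m - 1) (by omega) hR hv hjp hj (by omega)
    exact ⟨A'', C', hR', t'', w, hw, fun k => (hle' k).trans (hle k),
      fun k hk => (heq'' k hk).trans (heq k (by omega)), hfin⟩

end CommNilp

/-! ### Conclusion -/

open CommNilp in
theorem corollary3p8 {K : Type*} [Field K] [IsAlgClosed K] {n : ℕ}
    (𝒜 : Set (Matrix (Fin n) (Fin n) K × Matrix (Fin n) (Fin n) K))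
    (h𝒜 : CommNilp.IsZariskiOpen 𝒜)
    (A B : Matrix (Fin n) (Fin n) K) (hAB : (A, B) ∈ 𝒜)
    {t : ℕ} (u : Fin t → ℕ) (hu : CommNilp.IsJordanOrders B u)
    (S : Finset (Fin t)) (hS : CommNilp.AlmostEqual u S)
    (hScard : S.card = CommNilp.maxAlmostEqual u)
    (i₁ : Fin t) (hi₁ : IsLeast (S : Set (Fin t)) i₁) :
    ∃ A' B' : Matrix (Fin n) (Fin n) K, (A', B') ∈ 𝒜 ∧
      ∃ f : K[X], X ∣ f ∧
        ∃ (t' : ℕ) (u' : Fin t' → ℕ),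
          CommNilp.IsJordanOrders (B' + aeval A' f) u' ∧
          (Finset.univ.filter fun j => u' j = 1).card = CommNilp.maxAlmostEqual u' ∧
          ∃ htt' : t ≤ t', ∀ j : Fin t, j < i₁ → u' (Fin.castLE htt' j) = u j := by
  have hmax := window_eq_of_isLeast hu.1 hS hScard hi₁
  have hR : Reach 𝒜 A B := ⟨0, dvd_zero _, by simpa using hAB⟩
  obtain ⟨A', C, ⟨f, hf, hmem⟩, t', v, hv, hle, heq, hfin⟩ :=
    hR.exists_final h𝒜 (u i₁) n hu le_rfl hmax (by omega)
  have hn : tailSum v 0 = tailSum u 0 := by rw [← hv.rank_pow, ← hu.rank_pow]; simp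
  have htt' : t ≤ t' := by
    have f1 := tailSum_eq v 0
    have f2 := tailSum_eq u 0
    have f3 := hle 1
    rw [zero_add, countGE_one hv.2.1] at f1
    rw [zero_add, countGE_one hu.2.1] at f2
    omega
  refine ⟨A', C - aeval A' f, hmem, f, hf, t', v, by simpa using hv, ?_, htt', ?_⟩
  · rw [card_ones_eq_window hv.2.1, hfin]
  intro j hj
  have hcount : ∀ k, u i₁ < k → countGE v k = countGE u k := by
    intro k hk
    obtain ⟨l, rfl⟩ : ∃ l, k = l + 1 := ⟨k - 1, by omega⟩
    have f1 := tailSum_eq v l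
    have f2 := tailSum_eq u l
    rw [heq l (by omega), heq (l + 1) (by omega)] at f1
    omega
  -- Equality would allow `j` to be added to `S`, contradicting maximality.
  have hju : u i₁ < u j := by
    by_contra hcon
    have hjs : u j = u i₁ := le_antisymm (not_lt.1 hcon) (hu.1 hj.le)
    have hjS : j ∉ S := fun h => absurd (hi₁.2 h) (not_le.2 hj)
    have : AlmostEqual u (insert j S) := by
      intro a ha b hb
      have hle1 : ∀ c ∈ insert j S, u c ≤ u i₁ ∧ u i₁ ≤ u c + 1 := by
        intro c hc
        rcases Finset.mem_insert.1 hc with rfl | hc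
        · omega
        · exact ⟨hu.1 (hi₁.2 hc), hS _ hi₁.1 _ hc⟩
      have h1 := hle1 a ha
      have h2 := hle1 b hb
      omega
    have := card_le_maxAlmostEqual this
    rw [Finset.card_insert_of_notMem hjS] at this
    omega
  -- Above `u i₁` the counts for `v` and `u` agree. Testing with `k = u j` and then with the new
  -- order itself gives equality.
  have key : ∀ k, u i₁ < k → (k ≤ v (Fin.castLE htt' j) ↔ k ≤ u j) := by
    intro k hk
    rw [le_iff_lt_countGE hv.1, le_iff_lt_countGE hu.1, hcount k hk]
    rfl
  have h1 := (key (u j) hju).2 le_rfl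
  have h2 := (key (v (Fin.castLE htt' j)) (by omega)).1 le_rfl
  omega
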